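/- Let $d\ge 3$, $T>0$, $\varepsilon>0$, let $\mathbb T^d=\mathbb R^d/(2\pi\mathbb Z)^d$ and $Q_T=\mathbb T^d\times(0,T)$. Fix a Littlewood–Paley cutoff $\chi\in C_c^\infty(\mathbb R^d)$: $\chi$ is radially non-increasing, $\chi(\xi)=1$ for $|\xi|\le 1/2$ and $\chi(\xi)=0$ for $|\xi|\ge 1$. Let $\Delta_{-1}$ be the Fourier multiplier with symbol $\chi(\xi)$, let $\Delta_q$ ($q\ge 0$) be the one with symbol $\chi(2^{-q-1}\xi)-\chi(2^{-q}\xi)$, and let $v_{\le q}=\sum_{-1\le r\le q}\Delta_r v$, which has symbol $\chi(2^{-q-1}\xi)$. Let $\|v\|_{B^s_{p,r}}=\big\|(2^{qs}\|\Delta_q v\|_{L^p})_{q\ge -1}\big\|_{\ell^r}$ and $H^s=B^s_{2,2}$, and let $\langle\cdot,\cdot\rangle$ be the $L^2(\mathbb T^d)$ inner product. Let $\mathcal N(Q_T)$ be the class of pairs $(u,f)$ of vector fields $u,f\in C^\infty(Q_T;\mathbb R^d)$ such that: $u\in L^\infty(0,T;L^2(\mathbb T^d))$; for some smooth pressure $p$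 on $Q_T$, $\partial_t u-\Delta u+\operatorname{div}(u\otimes u)+\nabla p=f$ and $\operatorname{div}u=0$ on $Q_T$; the limit of $\int_a^b\langle u,f\rangle\,dt$ as $a\to 0^+$, $b\to T^-$ exists; and the limits of $f(t)$ as $t\to 0^+$ and as $t\to T^-$ exist in the space of distributions on $\mathbb T^d$. Then there is $(u,f)\in\mathcal N(Q_T)$ such that the following hold. 1. (Energy equality on $[0,T]$.) The weak $L^2$ limits $u(0)$ and $u(T)$ of $u(t)$ as $t\to 0^+$ and $t\to T^-$ exist, $\int_0^T\|\nabla u(t)\|_2^2\,dt<\infty$, and for all $t_0,t_1\in[0,T]$ $$\tfrac12\|u(t_1)\|_2^2-\tfrac12\|u(t_0)\|_2^2+\int_{t_0}^{t_1}\|\nabla u(t)\|_2^2\,dt=\int_{t_0}^{t_1}\langle u,f\rangle\,dt,$$ where the last integral is an improper one at the endpoints $0$ and $T$. 2. (Anomalous dissipation.) The limit $$\lim_{q\to\infty}\Big|\int_{T/2}^{T}\langle (u\cdot\nabla u)_{\le q},u_{\le q}\rangle\,dt\Big|$$ exists, is finite, and is positive. 3. (Regularity.) $u\in L^3(0,T;B^{1/3-\varepsilon}_{3,\infty})$;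 $u\in L^p(0,T;L^q(\mathbb T^d))$ for all $p,q\in[1,\infty]$ with $\frac2p+\frac2q=1+\varepsilon$; and, if $\varepsilon<2$, $f\in L^{2-\varepsilon}(0,T;H^{-1})$, that is, $\int_0^T\|f(t)\|_{H^{-1}}^{2-\varepsilon}\,dt<\infty$. -/

import Mathlib

open Set Filter Topology MeasureTheory
open scoped ContDiff ENNReal

noncomputable section

/-! ### Fields on the torus

The torus is `ℝ^d / (2πℤ)^d`. A field on it is a field on `ℝ^d` which is `2π`-periodic in every
coordinate; integrals over the torus are integrals over the fundamental cube `[0, 2π)^d`. -/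

/-- Euclidean space of dimension `d`. -/
abbrev Euc (d : ℕ) : Type := EuclideanSpace ℝ (Fin d)

/-- The `j`-th coordinate vector. -/
def basisVec {d : ℕ} (j : Fin d) : Euc d := EuclideanSpace.single j (1 : ℝ)

/-- Periodicity with period `2π` in every coordinate. -/
def TorusPeriodic {d : ℕ} {F : Type*} (v : Euc d → F) : Prop :=
  ∀ (x : Euc d) (j : Fin d), v (x + (2 * Real.pi) • basisVec j) = v x

/-- Lebesgue measure on the fundamental cube `[0, 2π)^d`, i.e. on the torus. -/
def torusMeasure (d : ℕ) : Measure (Euc d) :=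
  (volume : Measure (Euc d)).restrict {x | ∀ j, x j ∈ Ico (0 : ℝ) (2 * Real.pi)}

/-- The `L²` inner product of two vector fields on the torus. -/
def torusInner {d : ℕ} (v w : Euc d → Euc d) : ℝ :=
  ∫ x, inner ℝ (v x) (w x) ∂(torusMeasure d)

/-- `‖v‖₂²` over the torus. -/
def energySq {d : ℕ} (v : Euc d → Euc d) : ℝ :=
  ∫ x, ‖v x‖ ^ 2 ∂(torusMeasure d)

/-- `‖∇v‖₂²` over the torus. -/
def dissipationSq {d : ℕ} (v : Euc d → Euc d) : ℝ :=
  ∫ x, ∑ j, ‖fderiv ℝ v x (basisVec j)‖ ^ 2 ∂(torusMeasure d)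

/-! ### Differential operators -/

/-- Divergence of a vector field. -/
def divergence {d : ℕ} (v : Euc d → Euc d) (x : Euc d) : ℝ :=
  ∑ j, fderiv ℝ v x (basisVec j) j

/-- `div (v ⊗ v) = ∑ⱼ ∂ⱼ (vⱼ v)`. -/
def divTensor {d : ℕ} (v : Euc d → Euc d) (x : Euc d) : Euc d :=
  ∑ j, fderiv ℝ (fun y => v y j • v y) x (basisVec j)

/-- The convective term `(v · ∇) v`. -/
def convective {d : ℕ} (v : Euc d → Euc d) (x : Euc d) : Euc d :=
  fderiv ℝ v x (v x)

/-! ### Smooth solutions with finite energy input -/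

/-- The improper integral of `g` over `(a, b)`, for `a < b`, converges to `I`:
the integrals over `[a', b']` tend to `I` as `a' → a⁺` and `b' → b⁻`. -/
def HasImproperIntegral (g : ℝ → ℝ) (a b I : ℝ) : Prop :=
  Tendsto (fun p : ℝ × ℝ => ∫ t in p.1..p.2, g t) (𝓝[>] a ×ˢ 𝓝[<] b) (𝓝 I)

/-- The space of locally integrable functions on `(0, T)` whose improper integral over `(0, T)`
exists. -/
def MemImproperL (T : ℝ) (g : ℝ → ℝ) : Prop :=
  LocallyIntegrableOn g (Ioo 0 T) ∧ ∃ I : ℝ, HasImproperIntegral g 0 T I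

/-- Smoothness on the open set `(0, T) × ℝ^d`, together with periodicity in space. -/
def SmoothOnQ {d : ℕ} {F : Type*} [NormedAddCommGroup F] [NormedSpace ℝ F]
    (T : ℝ) (v : ℝ → Euc d → F) : Prop :=
  ContDiffOn ℝ ∞ (fun z : ℝ × Euc d => v z.1 z.2) (Ioo 0 T ×ˢ univ) ∧
    ∀ t ∈ Ioo 0 T, TorusPeriodic (v t)

/-- The limit of `f t` along `l` exists in the space of distributions on the torus. (A pointwise
limit of distributions along `t → 0⁺` or `t → T⁻` is again a distribution.) -/
def HasDistributionLimit {d : ℕ} (f : ℝ → Euc d → Euc d) (l : Filter ℝ) : Prop :=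
  ∀ φ : Euc d → Euc d, ContDiff ℝ ∞ φ → TorusPeriodic φ →
    ∃ c : ℝ, Tendsto (fun t => torusInner (f t) φ) l (𝓝 c)

/-- The incompressible Navier–Stokes equations with viscosity one and force `f` hold pointwise on
the torus times `(0, T)`, with a smooth pressure. -/
def SolvesNavierStokes {d : ℕ} (T : ℝ) (u f : ℝ → Euc d → Euc d) : Prop :=
  ∃ p : ℝ → Euc d → ℝ, SmoothOnQ T p ∧ ∀ t ∈ Ioo 0 T, ∀ x : Euc d,
    deriv (fun s => u s x) t - Laplacian.laplacian (u t) x + divTensor (u t) x + gradient (p t) x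
        = f t x ∧
      divergence (u t) x = 0

/-- The norm of `L^p(0, T; L^q)` over the torus. -/
def mixedNorm {d : ℕ} (T : ℝ) (p q : ℝ≥0∞) (v : ℝ → Euc d → Euc d) : ℝ≥0∞ :=
  eLpNorm (fun t => eLpNorm (v t) q (torusMeasure d)) p (volume.restrict (Ioo 0 T))

/-- The class `𝒩(Q_T)` of smooth solutions with finite energy input. -/
structure SmoothSolutionClass {d : ℕ} (T : ℝ) (u f : ℝ → Euc d → Euc d) : Prop where
  smooth_velocity : SmoothOnQ T u
  bounded_energy : mixedNorm T ⊤ 2 u < ⊤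
  smooth_force : SmoothOnQ T f
  equation : SolvesNavierStokes T u f
  finite_input : MemImproperL T (fun t => torusInner (u t) (f t))
  force_limit_zero : HasDistributionLimit f (𝓝[>] 0)
  force_limit_end : HasDistributionLimit f (𝓝[<] T)

/-- `v` is the weak `L²` limit of `u t` along `l`. -/
def IsWeakL2Limit {d : ℕ} (u : ℝ → Euc d → Euc d) (l : Filter ℝ) (v : Euc d → Euc d) : Prop :=
  TorusPeriodic v ∧ MemLp v 2 (torusMeasure d) ∧
    ∀ φ : Euc d → Euc d, MemLp φ 2 (torusMeasure d) →
      Tendsto (fun t => torusInner (u t) φ) l (𝓝 (torusInner v φ))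

/-- The energy equality on the closed interval `[0, T]`. The values `u 0` and `u T` are the weak
`L²` limits of the solution, the dissipation is integrable over `(0, T)`, and the work of the force
is an improper integral, which agrees with the ordinary one on `[t₀, t₁] ⊆ (0, T)`. For `t₁ < t₀`
the equality is the one below with the endpoints exchanged, and for `t₀ = t₁` it is trivial. -/
def EnergyEquality {d : ℕ} (T : ℝ) (u f : ℝ → Euc d → Euc d) : Prop :=
  IsWeakL2Limit u (𝓝[>] 0) (u 0) ∧ IsWeakL2Limit u (𝓝[<] T) (u T) ∧
    IntegrableOn (fun t => dissipationSq (u t)) (Ioo 0 T) ∧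
    ∀ t₀ t₁ : ℝ, 0 ≤ t₀ → t₀ < t₁ → t₁ ≤ T →
      HasImproperIntegral (fun t => torusInner (u t) (f t)) t₀ t₁
        (energySq (u t₁) / 2 - energySq (u t₀) / 2 + ∫ t in t₀..t₁, dissipationSq (u t))

/-! ### Littlewood–Paley decomposition -/

/-- A cutoff function defining a Littlewood–Paley decomposition: smooth, radially non-increasing,
equal to `1` for `|ξ| ≤ 1/2` and to `0` for `|ξ| ≥ 1`. -/
structure IsLPCutoff {d : ℕ} (χ : Euc d → ℝ) : Prop where
  smooth : ContDiff ℝ ∞ χ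
  radially_antitone : ∀ ξ η : Euc d, ‖ξ‖ ≤ ‖η‖ → χ η ≤ χ ξ
  eq_one : ∀ ξ : Euc d, ‖ξ‖ ≤ 1 / 2 → χ ξ = 1
  eq_zero : ∀ ξ : Euc d, 1 ≤ ‖ξ‖ → χ ξ = 0

/-- The lattice frequency `k ∈ ℤ^d` as a vector of `ℝ^d`. -/
def waveVec {d : ℕ} (k : Fin d → ℤ) : Euc d := WithLp.toLp 2 (fun j => (k j : ℝ))

/-- The `i`-th component of the Fourier coefficient `(2π)^{-d} ∫ v(x) e^{-ik·x} dx`. -/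
def torusCoeff {d : ℕ} (v : Euc d → Euc d) (i : Fin d) (k : Fin d → ℤ) : ℂ :=
  (((2 * Real.pi) ^ d)⁻¹ : ℝ) *
    ∫ x, (v x i : ℂ) * Complex.exp (-(Complex.I * (inner ℝ (waveVec k) x : ℝ))) ∂(torusMeasure d)

/-- The Fourier multiplier `∑ₖ m(k) v̂(k) e^{ik·x}` applied to a real vector field. The symbols used
below are real, even and of compact support, so that the sum is finite and real: taking real parts
termwise does not change it. -/
def fourierMultiplier {d : ℕ} (m : Euc d → ℝ) (v : Euc d → Euc d) (x : Euc d) : Euc d :=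
  WithLp.toLp 2 fun i => ∑' k : Fin d → ℤ,
    m (waveVec k) *
      (torusCoeff v i k * Complex.exp (Complex.I * (inner ℝ (waveVec k) x : ℝ))).re

/-- The low-frequency projection `v_{≤ q}`, with symbol `χ(2^{-(q+1)} ξ)`. -/
def lpLow {d : ℕ} (χ : Euc d → ℝ) (q : ℕ) (v : Euc d → Euc d) : Euc d → Euc d :=
  fourierMultiplier (fun ξ => χ (((2 : ℝ) ^ (q + 1))⁻¹ • ξ)) v

/-- The Littlewood–Paley block of index `n - 1`. For `n = 0` it is the block `Δ_{-1}`, with symbol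
`χ(ξ)`; for `n = q + 1` it is the block `Δ_q`, with symbol `χ(2^{-(q+1)} ξ) - χ(2^{-q} ξ)`. -/
def lpBlock {d : ℕ} (χ : Euc d → ℝ) : ℕ → (Euc d → Euc d) → Euc d → Euc d
  | 0, v => fourierMultiplier χ v
  | q + 1, v => fourierMultiplier
      (fun ξ => χ (((2 : ℝ) ^ (q + 1))⁻¹ • ξ) - χ (((2 : ℝ) ^ q)⁻¹ • ξ)) v

/-- The Besov norm `‖v‖_{B^s_{p,r}}`: the `ℓ^r` norm over `q ≥ -1` of `2^{qs} ‖Δ_q v‖_p`. -/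
def besovNorm {d : ℕ} (χ : Euc d → ℝ) (s : ℝ) (p r : ℝ≥0∞) (v : Euc d → Euc d) : ℝ≥0∞ :=
  eLpNorm (fun n : ℕ => ENNReal.ofReal ((2 : ℝ) ^ (((n : ℝ) - 1) * s)) *
    eLpNorm (lpBlock χ n v) p (torusMeasure d)) r Measure.count

/-- The norm of `L^a(0, T; B^s_{p,r})`; the case `p = r = 2` is `L^a(0, T; H^s)`. -/
def timeBesovNorm {d : ℕ} (χ : Euc d → ℝ) (T : ℝ) (a : ℝ≥0∞) (s : ℝ) (p r : ℝ≥0∞)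
    (v : ℝ → Euc d → Euc d) : ℝ≥0∞ :=
  eLpNorm (fun t => besovNorm χ s p r (v t)) a (volume.restrict (Ioo 0 T))

/-- The energy flux `∫_{T/2}^T ⟨(u·∇u)_{≤q}, u_{≤q}⟩ dt` through frequency `2^q`. -/
def energyFlux {d : ℕ} (χ : Euc d → ℝ) (T : ℝ) (u : ℝ → Euc d → Euc d) (q : ℕ) : ℝ :=
  ∫ t in (T / 2)..T, torusInner (lpLow χ q (convective (u t))) (lpLow χ q (u t))

end

/-! The velocity is a sequence of short bursts. On disjoint time intervals that accumulate at `T` it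
is a smooth bump in time multiplied by a fixed divergence-free trigonometric field `U m`, and at all
other times it is zero. The pressure is zero and the force is whatever the equation leaves over
(`stageForce`). Before `T` only finitely many bursts matter, so smoothness, the equation and the
energy balance on inner intervals come for free. The energy equality reaches `T` as soon as the
energies of the `U m` tend to zero and the dissipation is summable (`energyEquality`). The point is
to choose `U m` so small that all norms converge, and yet so that every burst carries one unit of
energy across its range of frequencies.

Flux. A burst is `b (V + W)`, with frequencies of `V` just below `2 ^ Q` and of `W` just below `2 ^
Q'`. For three different coordinates 0, 1, 2 and a common bump `a` of width `1 / N`, to leading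
order `V = a cos(L x₁) e₂` and `W = a cos(L' x₀) (1 + sin(L x₁)) (e₁ + e₂)`. Moving the derivative
from `W` to `V` gives `∫ (W·∇W)·V ≈ L ∫ a³ cos²(L' x₀) (1 + sin(L x₁))² sin(L x₁)`. The odd powers
of the sine integrate to zero, and the positive term `2 sin²` leaves a transfer of order `L N^(-d)`
(`integral_transport_high_ge`, `transfer_ge`). The nonlinearity does no work in total, so what `V`
loses `W` gains. A low-pass filter at `2 ^ q` therefore sees no flux for `q < Q`, the full transfer
for `Q ≤ q < Q'` and none for `q ≥ Q'`. Errors occur only at the two edges; they are small because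
the spectra lie close to the sphere on which the Lipschitz cutoff vanishes (`abs_dyadicFlux_sub_le`,
`abs_dyadicFlux_le`). The amplitude `b` normalizes the transfer over the duration of a burst to one.
The ranges `[Q, Q')` of successive bursts tile the integers, so every large `q` is crossed by
exactly one burst, and the flux tends to 1 (`tendsto_energyFlux`).

Regularity is a matter of powers of `y = growth n = 2 ^ n²`. The choices are `N = y^(2M+5)`, `2 ^ Q
= y^(dM)` and duration `y^(-(2M+1)d)`; the normalization then gives `b ≲ y^(d(M+2))`. Since a burst
has size `b` on a set of volume `N^(-d)`, its energy is `y^(-d)`, its dissipation in time `y^(-2d)`,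
its norm in `L^p L^q` is `y` to the power `d (M + 2 - (2M+5)/q - (2M+1)/p)`, its norm in `L³ B^s`
for `0 ≤ s` has the exponent `-dM (1/3 - s)`, and its force in `L^(2-ε) H^(-1)` the exponent `d (M +
3/2 - (2M+1)/(2-ε))`. All are negative once `M` is large compared with `1/ε`. The square in `2 ^ n²`
makes the ratio of consecutive frequencies unbounded, which the flux errors require, and still
smaller than every power of `y` (`eventually_growth_le`), so that the high frequencies cost nothing
in these counts. Besides the three directions, `d ≥ 3` ensures `dM > 2M + 5`: the oscillation is
faster than the variation of the bump. -/

noncomputable section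

/-! ### Integration over the torus -/

/-- The `j`-th partial derivative. -/
def partialD {d : ℕ} {F : Type*} [NormedAddCommGroup F] [NormedSpace ℝ F] (j : Fin d)
    (v : Euc d → F) (x : Euc d) : F :=
  fderiv ℝ v x (basisVec j)

/-- Moves integrals from the Euclidean cube to the product cube in `Fin d → ℝ`, where Fubini and the
divergence theorem on boxes apply. -/
theorem measurePreserving_toLp_torus (d : ℕ) :
    MeasurePreserving (WithLp.toLp 2 : (Fin d → ℝ) → Euc d)
      (volume.restrict (Set.pi univ fun _ => Ico (0 : ℝ) (2 * Real.pi))) (torusMeasure d) := by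
  have h := (PiLp.volume_preserving_toLp (Fin d)).restrict_preimage_emb
    (MeasurableEquiv.toLp 2 (Fin d → ℝ)).measurableEmbedding
    {x : Euc d | ∀ j, x j ∈ Ico (0 : ℝ) (2 * Real.pi)}
  have hs : (WithLp.toLp 2 : (Fin d → ℝ) → Euc d) ⁻¹'
      {x : Euc d | ∀ j, x j ∈ Ico (0 : ℝ) (2 * Real.pi)} =
      Set.pi univ fun _ => Ico (0 : ℝ) (2 * Real.pi) := by
    ext y; simp [Set.mem_pi]
  rw [hs] at h
  exact h

theorem integral_torus_eq {d : ℕ} {E : Type*} [NormedAddCommGroup E] [NormedSpace ℝ E]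
    (g : Euc d → E) :
    ∫ x, g x ∂(torusMeasure d) =
      ∫ y in Set.pi univ fun _ => Ico (0 : ℝ) (2 * Real.pi), g (WithLp.toLp 2 y) :=
  ((measurePreserving_toLp_torus d).integral_comp
    (MeasurableEquiv.toLp 2 (Fin d → ℝ)).measurableEmbedding g).symm

theorem torusMeasure_univ (d : ℕ) :
    torusMeasure d univ = ENNReal.ofReal ((2 * Real.pi) ^ d) := by
  rw [← (measurePreserving_toLp_torus d).measure_preimage MeasurableSet.univ.nullMeasurableSet]
  simp [Real.volume_pi_Ico, ENNReal.ofReal_pow Real.two_pi_pos.le]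

instance instIsFiniteMeasureTorus (d : ℕ) : IsFiniteMeasure (torusMeasure d) :=
  ⟨by rw [torusMeasure_univ]; exact ENNReal.ofReal_lt_top⟩

theorem Continuous.integrable_torus {d : ℕ} {E : Type*} [NormedAddCommGroup E]
    {g : Euc d → E} (hg : Continuous g) : Integrable g (torusMeasure d) := by
  have hK : IsCompact ((WithLp.toLp 2 : (Fin d → ℝ) → Euc d) ''
      (Icc (0 : Fin d → ℝ) (fun _ => 2 * Real.pi))) :=
    isCompact_Icc.image (PiLp.continuous_toLp 2 _)
  refine (hg.continuousOn.integrableOn_compact hK).mono_set ?_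
  intro x hx
  refine ⟨x.ofLp, ⟨fun j => (hx j).1, fun j => (hx j).2.le⟩, rfl⟩

theorem integral_torus_prod {d : ℕ} {𝕜 : Type*} [RCLike 𝕜] (g : Fin d → ℝ → 𝕜) :
    ∫ x, ∏ j, g j (x j) ∂(torusMeasure d) = ∏ j, ∫ s in (0 : ℝ)..(2 * Real.pi), g j s := by
  rw [integral_torus_eq, volume_pi, Measure.restrict_pi_pi]
  rw [integral_fintype_prod_eq_prod (𝕜 := 𝕜) (fun j => g j)]
  refine Finset.prod_congr rfl fun j _ => ?_
  rw [intervalIntegral.integral_of_le Real.two_pi_pos.le, integral_Ico_eq_integral_Ioc]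

/-- The divergence theorem on the cube, for a field whose only component points in direction `j`:
the two faces orthogonal to `j` cancel by periodicity. -/
theorem integral_partialD_eq_zero {d : ℕ} {E : Type*} [NormedAddCommGroup E] [NormedSpace ℝ E]
    [CompleteSpace E] {g : Euc d → E} (hg : ContDiff ℝ 1 g) (hp : TorusPeriodic g) (j : Fin d) :
    ∫ x, partialD j g x ∂(torusMeasure d) = 0 := by
  obtain _ | n := d
  · exact j.elim0
  rw [integral_torus_eq]
  let L : (Fin (n + 1) → ℝ) →L[ℝ] Euc (n + 1) :=
    (PiLp.continuousLinearEquiv 2 ℝ (fun _ : Fin (n + 1) => ℝ)).symm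
  have hL : ∀ y, L y = WithLp.toLp 2 y := fun y => rfl
  let G : (Fin (n + 1) → ℝ) → E := fun y => g (L y)
  have hGd : ∀ y, HasFDerivAt G ((fderiv ℝ g (L y)).comp L) y := fun y =>
    ((hg.differentiable one_ne_zero _).hasFDerivAt).comp y L.hasFDerivAt
  have key := integral_divergence_of_hasFDerivAt_off_countable' (E := E)
    (a := (0 : Fin (n + 1) → ℝ)) (b := fun _ => 2 * Real.pi) (fun _ => Real.two_pi_pos.le)
    (fun i => if i = j then G else 0)
    (fun i y => if i = j then (fderiv ℝ g (L y)).comp L else 0) ∅ countable_empty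
    (fun i => by
      split_ifs
      · exact (hg.continuous.comp L.continuous).continuousOn
      · exact continuousOn_const)
    (fun y _ i => by
      split_ifs
      · exact hGd y
      · exact hasFDerivAt_const _ _)
    (by
      refine Continuous.integrableOn_Icc ?_
      refine continuous_finsetSum _ fun i _ => ?_
      split_ifs
      · have : Continuous fun y => fderiv ℝ g (L y) :=
          (hg.continuous_fderiv one_ne_zero).comp L.continuous
        exact (this.clm_apply continuous_const)
      · simpa using continuous_const)
  have hsum : ∀ y : Fin (n + 1) → ℝ,
      (∑ i, (if i = j then (fderiv ℝ g (L y)).comp L else 0 : (Fin (n + 1) → ℝ) →L[ℝ] E)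
        (Pi.single i 1)) = partialD j g (WithLp.toLp 2 y) := by
    intro y
    rw [Finset.sum_eq_single j]
    · simp only [if_true, ContinuousLinearMap.comp_apply]
      rfl
    · intro i _ hi
      simp [hi]
    · simp
  simp only [hsum] at key
  have hpi : (Set.pi univ fun _ : Fin (n + 1) => Ico (0 : ℝ) (2 * Real.pi)) =ᵐ[volume]
      Icc (0 : Fin (n + 1) → ℝ) (fun _ => 2 * Real.pi) :=
    Measure.univ_pi_Ico_ae_eq_Icc
  rw [setIntegral_congr_set hpi, key]
  refine Finset.sum_eq_zero fun i _ => ?_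
  by_cases hi : i = j
  · subst hi
    simp only [if_true]
    rw [sub_eq_zero]
    refine setIntegral_congr_fun measurableSet_Icc fun y _ => ?_
    have := hp (L (i.insertNth (0 : ℝ) y)) i
    refine Eq.trans ?_ this
    show g (L _) = _
    congr 1
    ext k
    refine Fin.succAboveCases i ?_ (fun k => ?_) k
    · simp [hL, basisVec]
    · simp [hL, basisVec]
  · simp [hi]

/-! ### Periodicity -/

theorem TorusPeriodic.partialD {d : ℕ} {F : Type*} [NormedAddCommGroup F] [NormedSpace ℝ F]
    {v : Euc d → F} (h : TorusPeriodic v) (j : Fin d) : TorusPeriodic (partialD j v) := by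
  intro x i
  have : (fun y => v (y + (2 * Real.pi) • basisVec i)) = v := funext fun y => h y i
  conv_rhs => rw [_root_.partialD, ← this, fderiv_comp_add_right]
  rfl

theorem TorusPeriodic.comp₂ {d : ℕ} {F G H : Type*} {v : Euc d → F} {w : Euc d → G}
    (hv : TorusPeriodic v) (hw : TorusPeriodic w) (op : F → G → H) :
    TorusPeriodic fun x => op (v x) (w x) := fun x j => by
  show op _ _ = op _ _
  rw [hv x j, hw x j]

theorem TorusPeriodic.comp {d : ℕ} {F H : Type*} {v : Euc d → F}
    (hv : TorusPeriodic v) (op : F → H) : TorusPeriodic fun x => op (v x) := fun x j => by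
  show op _ = op _
  rw [hv x j]

theorem TorusPeriodic.sum {d : ℕ} {ι F : Type*} [AddCommMonoid F] {s : Finset ι}
    {v : ι → Euc d → F} (hv : ∀ i ∈ s, TorusPeriodic (v i)) :
    TorusPeriodic fun x => ∑ i ∈ s, v i x := fun x j =>
  Finset.sum_congr rfl fun i hi => hv i hi x j

theorem ContDiff.partialD {d : ℕ} {F : Type*} [NormedAddCommGroup F] [NormedSpace ℝ F]
    {v : Euc d → F} (h : ContDiff ℝ ∞ v) (j : Fin d) : ContDiff ℝ ∞ (partialD j v) :=
  (h.fderiv_right (m := ∞) (by simp)).clm_apply contDiff_const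

theorem Euc.hasFDerivAt_apply {d : ℕ} {v : Euc d → Euc d} {x : Euc d}
    (h : DifferentiableAt ℝ v x) (i : Fin d) (y : Euc d) :
    fderiv ℝ (fun z => v z i) x y = fderiv ℝ v x y i := by
  have := ((EuclideanSpace.proj (𝕜 := ℝ) i).hasFDerivAt.comp x h.hasFDerivAt).fderiv
  have h2 : ((EuclideanSpace.proj (𝕜 := ℝ) i) ∘ v) = fun z => v z i := rfl
  rw [h2] at this
  rw [this]; rfl

theorem partialD_apply {d : ℕ} {v : Euc d → Euc d} (h : Differentiable ℝ v) (i j : Fin d)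
    (x : Euc d) : partialD j (fun z => v z i) x = partialD j v x i :=
  Euc.hasFDerivAt_apply (h x) i _

theorem Euc.sum_basisVec {d : ℕ} (y : Euc d) : ∑ j, y j • basisVec j = y := by
  ext i
  simp [basisVec, Finset.sum_apply, Pi.single_apply]

theorem fderiv_apply_eq_sum {d : ℕ} {F : Type*} [NormedAddCommGroup F] [NormedSpace ℝ F]
    (v : Euc d → F) (x y : Euc d) : fderiv ℝ v x y = ∑ j, y j • partialD j v x := by
  conv_lhs => rw [← Euc.sum_basisVec y]
  simp [partialD]

theorem integral_partialD_mul {d : ℕ} {𝕜 : Type*} [RCLike 𝕜] {v w : Euc d → 𝕜}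
    (hv : ContDiff ℝ ∞ v) (hw : ContDiff ℝ ∞ w) (pv : TorusPeriodic v) (pw : TorusPeriodic w)
    (j : Fin d) :
    ∫ x, partialD j v x * w x ∂(torusMeasure d) =
      -∫ x, v x * partialD j w x ∂(torusMeasure d) := by
  have h := integral_partialD_eq_zero ((hv.mul hw).of_le (by simp)) (pv.comp₂ pw (· * ·)) j
  have e : ∀ x, partialD j (fun x => v x * w x) x =
      v x * partialD j w x + partialD j v x * w x := by
    intro x
    rw [partialD, fderiv_fun_mul (hv.differentiable (by simp) x) (hw.differentiable (by simp) x)]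
    simp [partialD, mul_comm]
  simp only [e] at h
  rw [integral_add (f := fun x => v x * partialD j w x) (g := fun x => partialD j v x * w x)
    (hv.continuous.mul (hw.partialD j).continuous).integrable_torus
    ((hv.partialD j).continuous.mul hw.continuous).integrable_torus] at h
  linear_combination h

theorem integral_inner_partialD {d : ℕ} {v w : Euc d → Euc d}
    (hv : ContDiff ℝ ∞ v) (hw : ContDiff ℝ ∞ w) (pv : TorusPeriodic v) (pw : TorusPeriodic w)
    (j : Fin d) :
    ∫ x, inner ℝ (partialD j v x) (w x) ∂(torusMeasure d) =
      -∫ x, inner ℝ (v x) (partialD j w x) ∂(torusMeasure d) := by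
  have h := integral_partialD_eq_zero ((hv.inner ℝ hw).of_le (by simp))
    (pv.comp₂ pw (inner ℝ)) j
  have e : ∀ x, partialD j (fun x => inner ℝ (v x) (w x)) x =
      inner ℝ (v x) (partialD j w x) + inner ℝ (partialD j v x) (w x) := by
    intro x
    rw [partialD, fderiv_inner_apply ℝ (hv.differentiable (by simp) x)
      (hw.differentiable (by simp) x)]
    rfl
  simp only [e] at h
  rw [integral_add (hv.continuous.inner (hw.partialD j).continuous).integrable_torus
    ((hv.partialD j).continuous.inner hw.continuous).integrable_torus] at h
  linear_combination h

/-! ### The operators of the equation in terms of partial derivatives -/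

theorem laplacian_eq_sum_partialD {d : ℕ} {v : Euc d → Euc d} (hv : ContDiff ℝ ∞ v) (x : Euc d) :
    Laplacian.laplacian v x = ∑ j, partialD j (partialD j v) x := by
  rw [InnerProductSpace.laplacian_eq_iteratedFDeriv_orthonormalBasis v
    (EuclideanSpace.basisFun (Fin d) ℝ)]
  refine Finset.sum_congr rfl fun j _ => ?_
  rw [iteratedFDeriv_two_apply]
  have h1 : DifferentiableAt ℝ (fderiv ℝ v) x :=
    (hv.fderiv_right (m := ∞) (by simp)).differentiable (by simp) x
  have := fderiv_clm_apply h1 (differentiableAt_const (basisVec j))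
  have e : partialD j (partialD j v) x = _ := congrArg (fun A => A (basisVec j)) this
  rw [e]
  simp [basisVec]

theorem divTensor_eq_sum {d : ℕ} (v : Euc d → Euc d) (x : Euc d) :
    divTensor v x = ∑ j, partialD j (fun y => v y j • v y) x := rfl

theorem contDiff_component {d : ℕ} {v : Euc d → Euc d} (hv : ContDiff ℝ ∞ v) (j : Fin d) :
    ContDiff ℝ ∞ fun x => v x j :=
  (EuclideanSpace.proj (𝕜 := ℝ) j).contDiff.comp hv

/-- The product rule produces one more term, `divergence v` times `v`. -/
theorem divTensor_eq_convective {d : ℕ} {v : Euc d → Euc d} (hv : ContDiff ℝ ∞ v)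
    (hd : ∀ x, divergence v x = 0) (x : Euc d) : divTensor v x = convective v x := by
  rw [divTensor_eq_sum, convective, fderiv_apply_eq_sum]
  have hv1 := hv.differentiable (by simp)
  have : ∀ j, partialD j (fun y => v y j • v y) x =
      v x j • partialD j v x + partialD j v x j • v x := by
    intro j
    rw [partialD, fderiv_fun_smul ((contDiff_component hv j).differentiable (by simp) x) (hv1 x)]
    simp only [add_apply, smul_apply,
      ContinuousLinearMap.smulRight_apply]
    rw [Euc.hasFDerivAt_apply (hv1 x)]
    rfl
  simp only [this, Finset.sum_add_distrib, ← Finset.sum_smul]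
  have := hd x
  rw [divergence] at this
  simp only [partialD]
  rw [this]; simp

theorem contDiff_laplacian {d : ℕ} {v : Euc d → Euc d} (hv : ContDiff ℝ ∞ v) :
    ContDiff ℝ ∞ (Laplacian.laplacian v) := by
  rw [show Laplacian.laplacian v = fun x => ∑ j, partialD j (partialD j v) x from
    funext (laplacian_eq_sum_partialD hv)]
  exact ContDiff.sum fun j _ => (hv.partialD j).partialD j

theorem torusPeriodic_laplacian {d : ℕ} {v : Euc d → Euc d} (hv : ContDiff ℝ ∞ v)
    (pv : TorusPeriodic v) : TorusPeriodic (Laplacian.laplacian v) := by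
  rw [show Laplacian.laplacian v = fun x => ∑ j, partialD j (partialD j v) x from
    funext (laplacian_eq_sum_partialD hv)]
  exact TorusPeriodic.sum fun j _ => (pv.partialD j).partialD j

theorem contDiff_divTensor {d : ℕ} {v : Euc d → Euc d} (hv : ContDiff ℝ ∞ v) :
    ContDiff ℝ ∞ (divTensor v) :=
  ContDiff.sum fun j _ => ((contDiff_component hv j).smul hv).partialD j

theorem torusPeriodic_divTensor {d : ℕ} {v : Euc d → Euc d}
    (pv : TorusPeriodic v) : TorusPeriodic (divTensor v) :=
  TorusPeriodic.sum fun j _ => (pv.comp fun y => y j • y).partialD j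

theorem torusInner_sum_left {d : ℕ} {ι : Type*} (s : Finset ι) {v : ι → Euc d → Euc d}
    {w : Euc d → Euc d} (hv : ∀ i ∈ s, Continuous (v i)) (hw : Continuous w) :
    torusInner (fun x => ∑ i ∈ s, v i x) w = ∑ i ∈ s, torusInner (v i) w := by
  simp only [torusInner, sum_inner]
  exact integral_finsetSum _ fun i hi => ((hv i hi).inner hw).integrable_torus

theorem torusInner_laplacian {d : ℕ} {v w : Euc d → Euc d}
    (hv : ContDiff ℝ ∞ v) (hw : ContDiff ℝ ∞ w) (pv : TorusPeriodic v) (pw : TorusPeriodic w) :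
    torusInner (Laplacian.laplacian v) w =
      -∑ j, ∫ x, inner ℝ (partialD j v x) (partialD j w x) ∂(torusMeasure d) := by
  rw [show Laplacian.laplacian v = fun x => ∑ j, partialD j (partialD j v) x from
    funext (laplacian_eq_sum_partialD hv), torusInner_sum_left _
    (fun j _ => ((hv.partialD j).partialD j).continuous) hw.continuous, ← Finset.sum_neg_distrib]
  exact Finset.sum_congr rfl fun j _ =>
    integral_inner_partialD (hv.partialD j) hw (pv.partialD j) pw j

theorem torusInner_laplacian_self {d : ℕ} {v : Euc d → Euc d}
    (hv : ContDiff ℝ ∞ v) (pv : TorusPeriodic v) :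
    torusInner (Laplacian.laplacian v) v = -dissipationSq v := by
  rw [torusInner_laplacian hv hv pv pv, dissipationSq, integral_finsetSum]
  · simp [partialD]
  · exact fun j _ => ((hv.partialD j).continuous.norm.pow 2).integrable_torus

theorem torusInner_divTensor {d : ℕ} {v w : Euc d → Euc d}
    (hv : ContDiff ℝ ∞ v) (hw : ContDiff ℝ ∞ w) (pv : TorusPeriodic v) (pw : TorusPeriodic w) :
    torusInner (divTensor v) w = -∫ x, inner ℝ (v x) (fderiv ℝ w x (v x)) ∂(torusMeasure d) := by
  have h1 : torusInner (divTensor v) w =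
      ∑ j, torusInner (partialD j (fun y => v y j • v y)) w :=
    torusInner_sum_left _
      (fun j _ => (((contDiff_component hv j).smul hv).partialD j).continuous) hw.continuous
  rw [h1]
  simp only [fderiv_apply_eq_sum, inner_sum, inner_smul_right]
  rw [integral_finsetSum, ← Finset.sum_neg_distrib]
  · refine Finset.sum_congr rfl fun j _ => ?_
    rw [torusInner, integral_inner_partialD (v := fun y => v y j • v y)
      ((contDiff_component hv j).smul hv) hw
      (pv.comp fun y => y j • y) pw j]
    simp [inner_smul_left]
  · exact fun j _ => ((contDiff_component hv j).continuous.mul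
      (hv.continuous.inner (hw.partialD j).continuous)).integrable_torus

/-- The transport identity `⟨(v·∇)w, z⟩ = -⟨w, (v·∇)z⟩` for a divergence-free field `v`. -/
theorem integral_inner_transport {d : ℕ} {v w z : Euc d → Euc d}
    (hv : ContDiff ℝ ∞ v) (hw : ContDiff ℝ ∞ w) (hz : ContDiff ℝ ∞ z) (pv : TorusPeriodic v)
    (pw : TorusPeriodic w) (pz : TorusPeriodic z) (hd : ∀ x, divergence v x = 0) :
    ∫ x, inner ℝ (fderiv ℝ w x (v x)) (z x) ∂(torusMeasure d) =
      -∫ x, inner ℝ (w x) (fderiv ℝ z x (v x)) ∂(torusMeasure d) := by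
  have hv1 := hv.differentiable (by simp)
  have hw1 := hw.differentiable (by simp)
  have e : ∀ x, fderiv ℝ w x (v x) = ∑ j, partialD j (fun y => v y j • w y) x := by
    intro x
    have : ∀ j, partialD j (fun y => v y j • w y) x =
        v x j • partialD j w x + partialD j v x j • w x := by
      intro j
      rw [partialD, fderiv_fun_smul ((contDiff_component hv j).differentiable (by simp) x) (hw1 x)]
      simp only [add_apply, smul_apply,
        ContinuousLinearMap.smulRight_apply]
      rw [Euc.hasFDerivAt_apply (hv1 x)]
      rfl
    simp only [this, Finset.sum_add_distrib, ← Finset.sum_smul, fderiv_apply_eq_sum]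
    have := hd x
    rw [divergence] at this
    simp only [partialD]
    rw [this]; simp
  simp only [e]
  have h1 := torusInner_sum_left Finset.univ (v := fun j => partialD j (fun y => v y j • w y))
    (fun j _ => (((contDiff_component hv j).smul hw).partialD j).continuous) hz.continuous
  rw [torusInner] at h1
  rw [h1]
  simp only [fderiv_apply_eq_sum, inner_sum, inner_smul_right]
  rw [integral_finsetSum, ← Finset.sum_neg_distrib]
  · refine Finset.sum_congr rfl fun j _ => ?_
    rw [torusInner, integral_inner_partialD (v := fun y => v y j • w y)
      ((contDiff_component hv j).smul hw) hz
      (pv.comp₂ pw fun y y' => y j • y') pz j]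
    simp [inner_smul_left]
  · exact fun j _ => ((contDiff_component hv j).continuous.mul
      (hw.continuous.inner (hz.partialD j).continuous)).integrable_torus

/-- Transport by a divergence-free field is skew-symmetric, hence zero on the diagonal. Conservation
of energy by the nonlinearity is the special case `w = v`. -/
theorem integral_inner_transport_self {d : ℕ} {v w : Euc d → Euc d}
    (hv : ContDiff ℝ ∞ v) (hw : ContDiff ℝ ∞ w) (pv : TorusPeriodic v)
    (pw : TorusPeriodic w) (hd : ∀ x, divergence v x = 0) :
    ∫ x, inner ℝ (fderiv ℝ w x (v x)) (w x) ∂(torusMeasure d) = 0 := by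
  have h := integral_inner_transport hv hw hw pv pw pw hd
  simp only [real_inner_comm (w _) (fderiv ℝ w _ _)] at h ⊢
  linarith

/-! ### Trigonometric polynomials -/

/-- The character `e^{ik·x}`. -/
def expo {d : ℕ} (k : Fin d → ℤ) (x : Euc d) : ℂ :=
  Complex.exp (Complex.I * (inner ℝ (waveVec k) x : ℝ))

theorem inner_waveVec {d : ℕ} (k : Fin d → ℤ) (x : Euc d) :
    inner ℝ (waveVec k) x = ∑ j, (k j : ℝ) * x j := by
  simp [waveVec, PiLp.inner_apply, mul_comm]

theorem waveVec_neg {d : ℕ} (k : Fin d → ℤ) : waveVec (-k) = -waveVec k := by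
  ext j; simp [waveVec]

theorem waveVec_add {d : ℕ} (k l : Fin d → ℤ) : waveVec (k + l) = waveVec k + waveVec l := by
  ext j; simp [waveVec]

theorem norm_sq_waveVec {d : ℕ} (k : Fin d → ℤ) : ‖waveVec k‖ ^ 2 = ∑ j, (k j : ℝ) ^ 2 := by
  simp [EuclideanSpace.norm_sq_eq, waveVec]

theorem expo_zero {d : ℕ} (x : Euc d) : expo 0 x = 1 := by
  simp [expo, inner_waveVec]

theorem expo_add {d : ℕ} (k l : Fin d → ℤ) (x : Euc d) : expo (k + l) x = expo k x * expo l x := by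
  rw [expo, expo, expo, ← Complex.exp_add, waveVec_add, inner_add_left]
  push_cast; ring_nf

theorem expo_neg {d : ℕ} (k : Fin d → ℤ) (x : Euc d) : expo (-k) x = star (expo k x) := by
  simp [expo, ← Complex.exp_conj, waveVec_neg, inner_neg_left]

theorem norm_expo {d : ℕ} (k : Fin d → ℤ) (x : Euc d) : ‖expo k x‖ = 1 := by
  rw [expo, mul_comm, Complex.norm_exp_ofReal_mul_I]

theorem expo_eq_prod {d : ℕ} (k : Fin d → ℤ) (x : Euc d) :
    expo k x = ∏ j, Complex.exp (Complex.I * (k j : ℂ) * (x j : ℂ)) := by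
  rw [expo, inner_waveVec, ← Complex.exp_sum]
  push_cast
  rw [Finset.mul_sum]
  simp only [mul_assoc]

theorem contDiff_expo {d : ℕ} (k : Fin d → ℤ) : ContDiff ℝ ∞ (expo k : Euc d → ℂ) := by
  have h : ContDiff ℝ ∞ fun x : Euc d => ((inner ℝ (waveVec k) x : ℝ) : ℂ) :=
    Complex.ofRealCLM.contDiff.comp ((contDiff_const (c := waveVec k)).inner ℝ contDiff_id)
  exact Complex.contDiff_exp.comp (contDiff_const.mul h)

@[fun_prop]
theorem continuous_expo {d : ℕ} (k : Fin d → ℤ) : Continuous (expo k : Euc d → ℂ) :=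
  (contDiff_expo k).continuous

theorem torusPeriodic_expo {d : ℕ} (k : Fin d → ℤ) : TorusPeriodic (expo k : Euc d → ℂ) := by
  intro x j
  rw [expo, inner_add_right, inner_smul_right, inner_waveVec k (basisVec j)]
  have : ∑ i, (k i : ℝ) * basisVec j i = k j := by
    simp [basisVec]
  rw [this, expo]
  push_cast
  rw [mul_add, show Complex.I * (2 * (Real.pi : ℂ) * (k j : ℂ)) =
    (k j : ℂ) * (2 * Real.pi * Complex.I) by ring, Complex.exp_add,
    Complex.exp_int_mul_two_pi_mul_I, mul_one]

theorem partialD_expo {d : ℕ} (k : Fin d → ℤ) (j : Fin d) (x : Euc d) :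
    partialD j (expo k) x = Complex.I * (k j : ℂ) * expo k x := by
  have h1 : HasFDerivAt (fun x : Euc d => (inner ℝ (waveVec k) x : ℝ))
      (innerSL ℝ (waveVec k)) x := (innerSL ℝ (waveVec k)).hasFDerivAt
  have h2 := ((Complex.ofRealCLM.hasFDerivAt.comp x h1).const_mul Complex.I).cexp
  have h3 : HasFDerivAt (expo k) _ x := h2
  rw [partialD, h3.fderiv]
  have : (inner ℝ (waveVec k) (basisVec j) : ℝ) = k j := by
    rw [inner_waveVec]
    simp [basisVec]
  simp [this, expo]
  ring

theorem integral_expo {d : ℕ} (k : Fin d → ℤ) :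
    ∫ x, expo k x ∂(torusMeasure d) = if k = 0 then ((2 * Real.pi : ℝ) : ℂ) ^ d else 0 := by
  simp only [expo_eq_prod]
  rw [integral_torus_prod (𝕜 := ℂ) fun j s => Complex.exp (Complex.I * (k j : ℂ) * (s : ℂ))]
  split_ifs with h
  · subst h
    simp
  · obtain ⟨j, hj⟩ := Function.ne_iff.1 h
    refine Finset.prod_eq_zero (Finset.mem_univ j) ?_
    have hj' : (k j : ℂ) ≠ 0 := by exact_mod_cast hj
    rw [integral_exp_mul_complex (mul_ne_zero Complex.I_ne_zero hj')]
    have : Complex.exp (Complex.I * (k j : ℂ) * ((2 * Real.pi : ℝ) : ℂ)) = 1 := by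
      rw [← Complex.exp_int_mul_two_pi_mul_I (k j)]
      push_cast; ring_nf
    rw [this]; simp

/-- The Fourier coefficient of a complex function on the torus. -/
def fcoeff {d : ℕ} (g : Euc d → ℂ) (k : Fin d → ℤ) : ℂ :=
  (((2 * Real.pi) ^ d)⁻¹ : ℝ) * ∫ x, g x * expo (-k) x ∂(torusMeasure d)

theorem torusCoeff_eq_fcoeff {d : ℕ} (v : Euc d → Euc d) (i : Fin d) (k : Fin d → ℤ) :
    torusCoeff v i k = fcoeff (fun x => (v x i : ℂ)) k := by
  simp only [torusCoeff, fcoeff, expo, waveVec_neg, inner_neg_left, Complex.ofReal_neg, mul_neg]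

/-- Trigonometric polynomials with frequencies in `S`. -/
def IsTrig {d : ℕ} (S : Finset (Fin d → ℤ)) (g : Euc d → ℂ) : Prop :=
  ∃ c : (Fin d → ℤ) → ℂ, ∀ x, g x = ∑ k ∈ S, c k * expo k x

theorem fcoeff_sum_expo {d : ℕ} (S : Finset (Fin d → ℤ)) (c : (Fin d → ℤ) → ℂ) (k : Fin d → ℤ) :
    fcoeff (fun x => ∑ l ∈ S, c l * expo l x) k = if k ∈ S then c k else 0 := by
  have h : ∀ x : Euc d, (∑ l ∈ S, c l * expo l x) * expo (-k) x =
      ∑ l ∈ S, c l * expo (l - k) x := by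
    intro x
    rw [Finset.sum_mul]
    refine Finset.sum_congr rfl fun l _ => ?_
    rw [sub_eq_add_neg, expo_add, mul_assoc]
  rw [fcoeff]
  simp only [h]
  rw [integral_finsetSum S (f := fun l x => c l * expo (l - k) x)
    fun l _ => Continuous.integrable_torus (by fun_prop)]
  simp only [integral_const_mul, integral_expo, sub_eq_zero, mul_ite, mul_zero]
  rw [Finset.sum_ite_eq' S k]
  split_ifs
  · have : ((2 * Real.pi : ℝ) : ℂ) ^ d ≠ 0 :=
      pow_ne_zero _ (Complex.ofReal_ne_zero.2 Real.two_pi_pos.ne')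
    rw [Complex.ofReal_inv, Complex.ofReal_pow]
    field_simp
  · simp

namespace IsTrig

variable {d : ℕ} {S T : Finset (Fin d → ℤ)} {g h : Euc d → ℂ}

theorem fcoeff_of_notMem (hg : IsTrig S g) {k : Fin d → ℤ} (hk : k ∉ S) : fcoeff g k = 0 := by
  obtain ⟨c, hc⟩ := hg
  rw [funext hc, fcoeff_sum_expo, if_neg hk]

theorem eq_sum (hg : IsTrig S g) (x : Euc d) : g x = ∑ k ∈ S, fcoeff g k * expo k x := by
  obtain ⟨c, hc⟩ := hg
  rw [hc x]
  refine Finset.sum_congr rfl fun k hk => ?_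
  rw [funext hc, fcoeff_sum_expo, if_pos hk]

theorem mono (hg : IsTrig S g) (hST : S ⊆ T) : IsTrig T g := by
  refine ⟨fcoeff g, fun x => ?_⟩
  rw [hg.eq_sum x]
  refine Finset.sum_subset hST fun k _ hk => ?_
  rw [hg.fcoeff_of_notMem hk, zero_mul]

theorem congr (hg : IsTrig S g) (e : ∀ x, h x = g x) : IsTrig S h := by
  rwa [funext e]

theorem zero : IsTrig S (fun _ => 0) := ⟨0, fun x => by simp⟩

theorem add (hg : IsTrig S g) (hh : IsTrig S h) : IsTrig S fun x => g x + h x := by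
  obtain ⟨c, hc⟩ := hg
  obtain ⟨c', hc'⟩ := hh
  exact ⟨fun k => c k + c' k, fun x => by simp [hc, hc', add_mul, Finset.sum_add_distrib]⟩

theorem const_mul (a : ℂ) (hg : IsTrig S g) : IsTrig S fun x => a * g x := by
  obtain ⟨c, hc⟩ := hg
  exact ⟨fun k => a * c k, fun x => by simp [hc, Finset.mul_sum, mul_assoc]⟩

theorem neg (hg : IsTrig S g) : IsTrig S fun x => -g x := by
  simpa using hg.const_mul (-1)

theorem sub (hg : IsTrig S g) (hh : IsTrig S h) : IsTrig S fun x => g x - h x := by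
  simpa [sub_eq_add_neg] using hg.add hh.neg

theorem sum {ι : Type*} {s : Finset ι} {G : ι → Euc d → ℂ} (hG : ∀ i ∈ s, IsTrig S (G i)) :
    IsTrig S fun x => ∑ i ∈ s, G i x := by
  classical
  induction s using Finset.induction_on with
  | empty => simpa using zero
  | insert a s ha ih =>
    simp only [Finset.sum_insert ha]
    exact (hG a (by simp)).add (ih fun i hi => hG i (by simp [hi]))

theorem expo {k : Fin d → ℤ} (hk : k ∈ S) : IsTrig S (expo k) :=
  ⟨fun l => if l = k then 1 else 0, fun x => by simp [hk]⟩

open scoped Pointwise in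
theorem mul (hg : IsTrig S g) (hh : IsTrig T h) : IsTrig (S + T) fun x => g x * h x := by
  obtain ⟨c, hc⟩ := hg
  obtain ⟨c', hc'⟩ := hh
  simp only [hc, hc', Finset.sum_mul_sum]
  refine sum fun k hk => sum fun l hl => ?_
  have : ∀ x : Euc d, c k * _root_.expo k x * (c' l * _root_.expo l x) =
      (c k * c' l) * _root_.expo (k + l) x := by
    intro x
    rw [expo_add]; ring
  simp only [this]
  exact (expo (Finset.add_mem_add hk hl)).const_mul _

theorem contDiff (hg : IsTrig S g) : ContDiff ℝ ∞ g := by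
  obtain ⟨c, hc⟩ := hg
  rw [funext hc]
  exact ContDiff.sum fun k _ => contDiff_const.mul (contDiff_expo k)

theorem torusPeriodic (hg : IsTrig S g) : TorusPeriodic g := by
  obtain ⟨c, hc⟩ := hg
  rw [funext hc]
  exact TorusPeriodic.sum fun k _ => (torusPeriodic_expo k).comp _

theorem partialD (hg : IsTrig S g) (j : Fin d) : IsTrig S (partialD j g) := by
  obtain ⟨c, hc⟩ := hg
  refine ⟨fun k => c k * (Complex.I * (k j : ℂ)), fun x => ?_⟩
  rw [funext hc, _root_.partialD, fderiv_fun_sum fun k _ =>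
    ((contDiff_expo k).differentiable (by simp) x).const_mul _, sum_apply]
  refine Finset.sum_congr rfl fun k _ => ?_
  rw [fderiv_const_mul ((contDiff_expo k).differentiable (by simp) x)]
  have := partialD_expo k j x
  rw [_root_.partialD] at this
  rw [smul_apply, this, smul_eq_mul]
  ring

end IsTrig

theorem fcoeff_partialD {d : ℕ} {g : Euc d → ℂ} (hg : ContDiff ℝ ∞ g) (pg : TorusPeriodic g)
    (j : Fin d) (k : Fin d → ℤ) : fcoeff (partialD j g) k = Complex.I * (k j : ℂ) * fcoeff g k := by
  rw [fcoeff, fcoeff, integral_partialD_mul hg (contDiff_expo _) pg (torusPeriodic_expo _)]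
  simp only [partialD_expo]
  have e : ∀ x : Euc d, g x * (Complex.I * (((-k) j : ℤ) : ℂ) * expo (-k) x) =
      -(Complex.I * (k j : ℂ)) * (g x * expo (-k) x) := fun x => by
    rw [Pi.neg_apply, Int.cast_neg]; ring
  simp only [e, integral_const_mul]
  ring

theorem fcoeff_add {d : ℕ} {g h : Euc d → ℂ} (hg : Continuous g) (hh : Continuous h)
    (k : Fin d → ℤ) : fcoeff (fun x => g x + h x) k = fcoeff g k + fcoeff h k := by
  simp only [fcoeff, add_mul]
  rw [integral_add (f := fun x => g x * expo (-k) x) (g := fun x => h x * expo (-k) x)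
    (Continuous.integrable_torus (by fun_prop)) (Continuous.integrable_torus (by fun_prop))]
  ring

theorem fcoeff_const_mul {d : ℕ} (a : ℂ) (g : Euc d → ℂ)
    (k : Fin d → ℤ) : fcoeff (fun x => a * g x) k = a * fcoeff g k := by
  simp only [fcoeff, mul_assoc, integral_const_mul]
  ring

theorem fcoeff_sum {d : ℕ} {ι : Type*} (s : Finset ι) {g : ι → Euc d → ℂ}
    (hg : ∀ i ∈ s, Continuous (g i)) (k : Fin d → ℤ) :
    fcoeff (fun x => ∑ i ∈ s, g i x) k = ∑ i ∈ s, fcoeff (g i) k := by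
  simp only [fcoeff, Finset.sum_mul]
  rw [integral_finsetSum s (f := fun i x => g i x * expo (-k) x) fun i hi =>
    ((hg i hi).mul (contDiff_expo _).continuous).integrable_torus, Finset.mul_sum]

theorem fcoeff_star {d : ℕ} (g : Euc d → ℂ) (k : Fin d → ℤ) :
    fcoeff (fun x => star (g x)) k = star (fcoeff g (-k)) := by
  have h : ∀ x : Euc d, star (g x) * expo (-k) x =
      (starRingEnd ℂ) (g x * expo (- -k) x) := by
    intro x
    rw [map_mul, neg_neg, expo_neg]
    rfl
  simp only [fcoeff, h]
  rw [integral_conj]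
  simp

/-- Only one of the factors has to be a trigonometric polynomial. Parseval is then a finite sum and
raises no question of convergence. -/
theorem integral_mul_star_of_isTrig {d : ℕ} {S : Finset (Fin d → ℤ)} {g h : Euc d → ℂ}
    (hg : Continuous g) (hh : IsTrig S h) :
    ∫ x, g x * star (h x) ∂(torusMeasure d) =
      ((2 * Real.pi : ℝ) : ℂ) ^ d * ∑ k ∈ S, fcoeff g k * star (fcoeff h k) := by
  have e : ∀ x, g x * star (h x) = ∑ k ∈ S, star (fcoeff h k) * (g x * expo (-k) x) := by
    intro x
    rw [hh.eq_sum x, star_sum, Finset.mul_sum]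
    refine Finset.sum_congr rfl fun k _ => ?_
    rw [star_mul', expo_neg]; ring
  simp only [e]
  rw [integral_finsetSum S (f := fun k x => star (fcoeff h k) * (g x * expo (-k) x))
    fun k _ => Continuous.integrable_torus (by fun_prop), Finset.mul_sum]
  refine Finset.sum_congr rfl fun k _ => ?_
  rw [integral_const_mul]
  have : ((2 * Real.pi : ℝ) : ℂ) ^ d ≠ 0 :=
    pow_ne_zero _ (Complex.ofReal_ne_zero.2 Real.two_pi_pos.ne')
  generalize star (fcoeff h k) = b
  rw [fcoeff, Complex.ofReal_inv, Complex.ofReal_pow]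
  field_simp

/-! ### Trigonometric vector fields -/

/-- Real vector fields all of whose components are trigonometric polynomials with frequencies
in `S`. -/
def TrigField {d : ℕ} (S : Finset (Fin d → ℤ)) (v : Euc d → Euc d) : Prop :=
  ∀ i, IsTrig S fun x => (v x i : ℂ)

theorem contDiff_of_components {d : ℕ} {v : Euc d → Euc d}
    (h : ∀ i, ContDiff ℝ ∞ fun x => v x i) : ContDiff ℝ ∞ v :=
  contDiff_euclidean.2 h

theorem IsTrig.contDiff_real {d : ℕ} {S : Finset (Fin d → ℤ)} {a : Euc d → ℝ}
    (h : IsTrig S fun x => (a x : ℂ)) : ContDiff ℝ ∞ a := by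
  have := Complex.reCLM.contDiff.comp h.contDiff
  exact this

theorem IsTrig.torusPeriodic_real {d : ℕ} {S : Finset (Fin d → ℤ)} {a : Euc d → ℝ}
    (h : IsTrig S fun x => (a x : ℂ)) : TorusPeriodic a := fun x j =>
  Complex.ofReal_injective (h.torusPeriodic x j)

theorem partialD_ofReal {d : ℕ} {a : Euc d → ℝ} (h : Differentiable ℝ a) (j : Fin d) (x : Euc d) :
    partialD j (fun x => (a x : ℂ)) x = ((partialD j a x : ℝ) : ℂ) := by
  have := (Complex.ofRealCLM.hasFDerivAt.comp x (h x).hasFDerivAt).fderiv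
  have h2 : (Complex.ofRealCLM ∘ a) = fun x => (a x : ℂ) := rfl
  rw [h2] at this
  rw [partialD, this]; rfl

theorem IsTrig.partialD_real {d : ℕ} {S : Finset (Fin d → ℤ)} {a : Euc d → ℝ}
    (h : IsTrig S fun x => (a x : ℂ)) (j : Fin d) :
    IsTrig S fun x => ((_root_.partialD j a x : ℝ) : ℂ) := by
  have := h.partialD j
  rwa [funext (partialD_ofReal (h.contDiff_real.differentiable (by simp)) j)] at this

namespace TrigField

variable {d : ℕ} {S T : Finset (Fin d → ℤ)} {v w : Euc d → Euc d}

theorem contDiff (hv : TrigField S v) : ContDiff ℝ ∞ v :=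
  contDiff_of_components fun i => (hv i).contDiff_real

theorem torusPeriodic (hv : TrigField S v) : TorusPeriodic v := fun x j => by
  ext i
  exact (hv i).torusPeriodic_real x j

theorem mono (hv : TrigField S v) (h : S ⊆ T) : TrigField T v := fun i => (hv i).mono h

theorem add (hv : TrigField S v) (hw : TrigField S w) : TrigField S fun x => v x + w x :=
  fun i => by simpa using (hv i).add (hw i)

theorem const_smul (a : ℝ) (hv : TrigField S v) : TrigField S fun x => a • v x :=
  fun i => by simpa using (hv i).const_mul (a : ℂ)

theorem sum {ι : Type*} {s : Finset ι} {G : ι → Euc d → Euc d} (hG : ∀ i ∈ s, TrigField S (G i)) :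
    TrigField S fun x => ∑ i ∈ s, G i x := fun j => by
  simpa using IsTrig.sum (S := S) (s := s) (G := fun i x => (G i x j : ℂ)) fun i hi => hG i hi j

theorem partialD (hv : TrigField S v) (j : Fin d) : TrigField S (partialD j v) := fun i => by
  have := (hv i).partialD_real j
  simpa only [partialD_apply (hv.contDiff.differentiable (by simp))] using this

open scoped Pointwise in
theorem smul {a : Euc d → ℝ} (ha : IsTrig S fun x => (a x : ℂ)) (hv : TrigField T v) :
    TrigField (S + T) fun x => a x • v x := fun i => by
  simpa using ha.mul (hv i)

open scoped Pointwise in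
theorem convective (hv : TrigField S v) (hw : TrigField T w) :
    TrigField (S + T) fun x => fderiv ℝ w x (v x) := by
  simp only [fderiv_apply_eq_sum]
  exact sum fun j _ => smul (hv j) (hw.partialD j)

theorem torusCoeff_of_notMem (hv : TrigField S v) (i : Fin d) {k : Fin d → ℤ} (hk : k ∉ S) :
    torusCoeff v i k = 0 := by
  rw [torusCoeff_eq_fcoeff, (hv i).fcoeff_of_notMem hk]

end TrigField

theorem torusCoeff_partialD {d : ℕ} {v : Euc d → Euc d} (hv : ContDiff ℝ ∞ v)
    (pv : TorusPeriodic v) (i j : Fin d) (k : Fin d → ℤ) :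
    torusCoeff (partialD j v) i k = Complex.I * (k j : ℂ) * torusCoeff v i k := by
  have h := contDiff_component hv i
  rw [torusCoeff_eq_fcoeff, torusCoeff_eq_fcoeff, ← fcoeff_partialD (g := fun x => (v x i : ℂ))
    (Complex.ofRealCLM.contDiff.comp h) (pv.comp fun y => ((y i : ℝ) : ℂ))]
  congr 1
  ext x
  rw [partialD_ofReal (h.differentiable (by simp)), partialD_apply (hv.differentiable (by simp))]

theorem torusCoeff_smul {d : ℕ} (a : ℝ) (v : Euc d → Euc d) (i : Fin d) (k : Fin d → ℤ) :
    torusCoeff (fun x => a • v x) i k = a * torusCoeff v i k := by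
  simp only [torusCoeff_eq_fcoeff, ← fcoeff_const_mul]
  simp

theorem torusCoeff_add {d : ℕ} {v w : Euc d → Euc d} (hv : Continuous v) (hw : Continuous w)
    (i : Fin d) (k : Fin d → ℤ) :
    torusCoeff (fun x => v x + w x) i k = torusCoeff v i k + torusCoeff w i k := by
  simp only [torusCoeff_eq_fcoeff, PiLp.add_apply, Complex.ofReal_add]
  exact fcoeff_add (by fun_prop) (by fun_prop) k

theorem torusCoeff_sum {d : ℕ} {ι : Type*} (s : Finset ι) {v : ι → Euc d → Euc d}
    (hv : ∀ i ∈ s, Continuous (v i)) (i : Fin d) (k : Fin d → ℤ) :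
    torusCoeff (fun x => ∑ j ∈ s, v j x) i k = ∑ j ∈ s, torusCoeff (v j) i k := by
  simp only [torusCoeff_eq_fcoeff]
  rw [← fcoeff_sum s (g := fun j x => (v j x i : ℂ)) fun j hj => by have := hv j hj; fun_prop]
  simp

theorem torusCoeff_neg_freq {d : ℕ} (v : Euc d → Euc d) (i : Fin d) (k : Fin d → ℤ) :
    torusCoeff v i (-k) = star (torusCoeff v i k) := by
  rw [torusCoeff_eq_fcoeff, torusCoeff_eq_fcoeff]
  have := fcoeff_star (fun x => (v x i : ℂ)) (-k)
  rw [neg_neg] at this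
  rw [← this]
  simp

/-- Parseval's identity against a trigonometric field. -/
theorem torusInner_eq_sum {d : ℕ} {S : Finset (Fin d → ℤ)} {v w : Euc d → Euc d}
    (hv : Continuous v) (hw : TrigField S w) :
    torusInner v w = (2 * Real.pi) ^ d *
      ∑ k ∈ S, ∑ i, (torusCoeff v i k * star (torusCoeff w i k)).re := by
  apply Complex.ofReal_injective
  have hvi : ∀ i, Continuous fun x => v x i := fun i => by fun_prop
  have hwi : ∀ i, Continuous fun x => w x i := fun i => (hw i).contDiff_real.continuous
  have h1 : torusInner v w = ∑ i, ∫ x, v x i * w x i ∂(torusMeasure d) := by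
    rw [← integral_finsetSum _ (f := fun i x => v x i * w x i)
      fun i _ => ((hvi i).mul (hwi i)).integrable_torus]
    simp [torusInner, PiLp.inner_apply, mul_comm]
  have h2 : ∀ i, ((∫ x, v x i * w x i ∂(torusMeasure d) : ℝ) : ℂ) =
      ((2 * Real.pi : ℝ) : ℂ) ^ d * ∑ k ∈ S, torusCoeff v i k * star (torusCoeff w i k) := by
    intro i
    simp only [torusCoeff_eq_fcoeff]
    rw [← integral_mul_star_of_isTrig (g := fun x => (v x i : ℂ))
      (Complex.continuous_ofReal.comp (hvi i)) (hw i),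
      ← integral_complex_ofReal]
    simp
  have h3 : ∀ i, ∫ x, v x i * w x i ∂(torusMeasure d) =
      (2 * Real.pi) ^ d * ∑ k ∈ S, (torusCoeff v i k * star (torusCoeff w i k)).re := by
    intro i
    have := congrArg Complex.re (h2 i)
    rw [Complex.ofReal_re, ← Complex.ofReal_pow, Complex.re_ofReal_mul, Complex.re_sum] at this
    exact this
  rw [h1, Finset.sum_congr rfl fun i _ => h3 i, ← Finset.mul_sum, Finset.sum_comm]

theorem energySq_eq_torusInner {d : ℕ} (v : Euc d → Euc d) : energySq v = torusInner v v := by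
  simp [energySq, torusInner]

theorem energySq_nonneg {d : ℕ} (v : Euc d → Euc d) : 0 ≤ energySq v :=
  integral_nonneg fun _ => by positivity

theorem energySq_eq_sum {d : ℕ} {S : Finset (Fin d → ℤ)} {v : Euc d → Euc d}
    (hv : TrigField S v) :
    energySq v = (2 * Real.pi) ^ d * ∑ k ∈ S, ∑ i, ‖torusCoeff v i k‖ ^ 2 := by
  rw [energySq_eq_torusInner, torusInner_eq_sum hv.contDiff.continuous hv]
  congr 1
  refine Finset.sum_congr rfl fun k _ => Finset.sum_congr rfl fun i _ => ?_
  have := Complex.mul_conj (torusCoeff v i k)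
  rw [Complex.star_def, this, Complex.ofReal_re, Complex.normSq_eq_norm_sq]

/-! ### Fourier multipliers on trigonometric fields -/

theorem fourierMultiplier_smul {d : ℕ} (m : Euc d → ℝ) (a : ℝ) (v : Euc d → Euc d) :
    fourierMultiplier m (fun x => a • v x) = fun x => a • fourierMultiplier m v x := by
  ext x i
  simp only [fourierMultiplier, torusCoeff_smul, PiLp.smul_apply, smul_eq_mul]
  rw [← tsum_mul_left]
  refine tsum_congr fun k => ?_
  rw [mul_assoc, Complex.re_ofReal_mul]
  ring

/-- For a real field the coefficients at `k` and `-k` are conjugate, and the symbol is even, so the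
imaginary parts dropped termwise in the definition cancel in pairs. -/
theorem fourierMultiplier_apply {d : ℕ} {S : Finset (Fin d → ℤ)} {v : Euc d → Euc d}
    (hv : TrigField S v) {m : Euc d → ℝ} (hm : ∀ ξ, m (-ξ) = m ξ) (x : Euc d) (i : Fin d) :
    (fourierMultiplier m v x i : ℂ) =
      ∑ k ∈ S, (m (waveVec k) * torusCoeff v i k) * expo k x := by
  set z : (Fin d → ℤ) → ℂ := fun k => torusCoeff v i k * expo k x with hz
  have hz0 : ∀ k ∉ S, z k = 0 := fun k hk => by simp [hz, hv.torusCoeff_of_notMem i hk]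
  have hzs : ∀ k, z (-k) = star (z k) := fun k => by
    simp [hz, torusCoeff_neg_freq, expo_neg]
  have h1 : fourierMultiplier m v x i = ∑ k ∈ S, m (waveVec k) * (z k).re := by
    show ∑' k, m (waveVec k) * (z k).re = _
    exact tsum_eq_sum fun k hk => by simp [hz0 k hk]
  -- The substitution `k ↦ -k` is made in the sum over the whole lattice, since `S` is not assumed
  -- symmetric.
  have h2 : ∑ k ∈ S, (m (waveVec k) : ℂ) * star (z k) = ∑ k ∈ S, (m (waveVec k) : ℂ) * z k := by
    have e1 : ∑' k, (m (waveVec k) : ℂ) * star (z k) = ∑ k ∈ S, (m (waveVec k) : ℂ) * star (z k) :=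
      tsum_eq_sum fun k hk => by simp [hz0 k hk]
    have e2 : ∑' k, (m (waveVec k) : ℂ) * z k = ∑ k ∈ S, (m (waveVec k) : ℂ) * z k :=
      tsum_eq_sum fun k hk => by simp [hz0 k hk]
    rw [← e1, ← e2, ← (Equiv.neg (Fin d → ℤ)).tsum_eq]
    refine tsum_congr fun k => ?_
    simp [waveVec_neg, hm, hzs]
  have h3 : ∑ k ∈ S, (m (waveVec k) * torusCoeff v i k) * expo k x =
      ∑ k ∈ S, (m (waveVec k) : ℂ) * z k := by simp [hz, mul_assoc]
  rw [h3, h1]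
  push_cast
  have h4 : ∀ k, (((z k).re : ℝ) : ℂ) = (z k + star (z k)) / 2 := fun k => by
    rw [Complex.star_def, Complex.add_conj]; push_cast; ring
  simp only [h4]
  have : ∀ k, (m (waveVec k) : ℂ) * ((z k + star (z k)) / 2) =
      (m (waveVec k) : ℂ) * z k / 2 + (m (waveVec k) : ℂ) * star (z k) / 2 := fun k => by ring
  simp only [this, Finset.sum_add_distrib, ← Finset.sum_div, h2]
  ring

theorem TrigField.fourierMultiplier {d : ℕ} {S : Finset (Fin d → ℤ)} {v : Euc d → Euc d}
    (hv : TrigField S v) {m : Euc d → ℝ} (hm : ∀ ξ, m (-ξ) = m ξ) :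
    TrigField S (fourierMultiplier m v) := fun i =>
  ⟨fun k => m (waveVec k) * torusCoeff v i k, fun x => fourierMultiplier_apply hv hm x i⟩

theorem torusCoeff_fourierMultiplier {d : ℕ} {S : Finset (Fin d → ℤ)} {v : Euc d → Euc d}
    (hv : TrigField S v) {m : Euc d → ℝ} (hm : ∀ ξ, m (-ξ) = m ξ) (i : Fin d) (k : Fin d → ℤ) :
    torusCoeff (fourierMultiplier m v) i k = m (waveVec k) * torusCoeff v i k := by
  rw [torusCoeff_eq_fcoeff (fourierMultiplier m v),
    funext fun x => fourierMultiplier_apply hv hm x i, fcoeff_sum_expo]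
  split_ifs with h
  · rfl
  · rw [hv.torusCoeff_of_notMem i h, mul_zero]

theorem torusInner_fourierMultiplier {d : ℕ} {S T : Finset (Fin d → ℤ)} {v w : Euc d → Euc d}
    (hv : TrigField S v) (hw : TrigField T w) {m : Euc d → ℝ} (hm : ∀ ξ, m (-ξ) = m ξ) :
    torusInner (fourierMultiplier m v) (fourierMultiplier m w) = (2 * Real.pi) ^ d *
      ∑ k ∈ T, m (waveVec k) ^ 2 * ∑ i, (torusCoeff v i k * star (torusCoeff w i k)).re := by
  rw [torusInner_eq_sum (hv.fourierMultiplier hm).contDiff.continuous (hw.fourierMultiplier hm)]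
  congr 1
  refine Finset.sum_congr rfl fun k _ => ?_
  rw [Finset.mul_sum]
  refine Finset.sum_congr rfl fun i _ => ?_
  rw [torusCoeff_fourierMultiplier hv hm, torusCoeff_fourierMultiplier hw hm, ← Complex.re_ofReal_mul]
  congr 1
  simp
  ring

theorem energySq_fourierMultiplier {d : ℕ} {S : Finset (Fin d → ℤ)} {v : Euc d → Euc d}
    (hv : TrigField S v) {m : Euc d → ℝ} (hm : ∀ ξ, m (-ξ) = m ξ) :
    energySq (fourierMultiplier m v) = (2 * Real.pi) ^ d *
      ∑ k ∈ S, m (waveVec k) ^ 2 * ∑ i, ‖torusCoeff v i k‖ ^ 2 := by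
  rw [energySq_eq_sum (hv.fourierMultiplier hm)]
  congr 1
  refine Finset.sum_congr rfl fun k _ => ?_
  rw [Finset.mul_sum]
  refine Finset.sum_congr rfl fun i _ => ?_
  rw [torusCoeff_fourierMultiplier hv hm, norm_mul, Complex.norm_real, mul_pow, Real.norm_eq_abs,
    sq_abs]

theorem dissipationSq_eq_sum_energySq {d : ℕ} {v : Euc d → Euc d} (hv : ContDiff ℝ ∞ v) :
    dissipationSq v = ∑ j, energySq (partialD j v) := by
  rw [dissipationSq, integral_finsetSum]
  · rfl
  · exact fun j _ => ((hv.partialD j).continuous.norm.pow 2).integrable_torus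

/-- Bernstein's inequality in `L²`. -/
theorem TrigField.dissipationSq_le {d : ℕ} {S : Finset (Fin d → ℤ)} {v : Euc d → Euc d}
    (hv : TrigField S v) {R : ℝ} (hR : ∀ k ∈ S, ‖waveVec k‖ ≤ R) :
    dissipationSq v ≤ R ^ 2 * energySq v := by
  rw [dissipationSq_eq_sum_energySq hv.contDiff]
  simp only [energySq_eq_sum (hv.partialD _), energySq_eq_sum hv]
  rw [← Finset.mul_sum, Finset.sum_comm, mul_left_comm]
  refine mul_le_mul_of_nonneg_left ?_ (by positivity)
  rw [Finset.mul_sum]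
  refine Finset.sum_le_sum fun k hk => ?_
  rw [Finset.sum_comm, Finset.mul_sum]
  refine Finset.sum_le_sum fun i _ => ?_
  simp only [torusCoeff_partialD hv.contDiff hv.torusPeriodic, norm_mul, mul_pow,
    Complex.norm_I, one_mul, ← Finset.sum_mul]
  refine mul_le_mul_of_nonneg_right ?_ (by positivity)
  have : ∑ j, ‖(k j : ℂ)‖ ^ 2 = ‖waveVec k‖ ^ 2 := by
    rw [norm_sq_waveVec]
    exact Finset.sum_congr rfl fun j _ => by rw [Complex.norm_intCast, sq_abs]
  rw [this]
  exact pow_le_pow_left₀ (norm_nonneg _) (hR k hk) 2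

/-! ### Lebesgue norms of fields -/

theorem eLpNorm_two_torus {d : ℕ} {v : Euc d → Euc d} (hv : Continuous v) :
    eLpNorm v 2 (torusMeasure d) = ENNReal.ofReal (Real.sqrt (energySq v)) := by
  have hm : MemLp v 2 (torusMeasure d) :=
    (memLp_two_iff_integrable_sq_norm hv.aestronglyMeasurable).2
      (hv.norm.pow 2).integrable_torus
  rw [hm.eLpNorm_eq_integral_rpow_norm two_ne_zero ENNReal.ofNat_ne_top]
  congr 1
  rw [Real.sqrt_eq_rpow, energySq]
  simp

/-- From `‖v‖³ ≤ A ‖v‖²`. Together with a sup bound that counts frequencies, this replaces the `L³`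
boundedness of Fourier multipliers. -/
theorem eLpNorm_three_le {d : ℕ} {v : Euc d → Euc d} (hv : Continuous v) {A : ℝ}
    (hA : ∀ x, ‖v x‖ ≤ A) :
    eLpNorm v 3 (torusMeasure d) ≤ ENNReal.ofReal ((A * energySq v) ^ (1 / 3 : ℝ)) := by
  have hA0 : 0 ≤ A := (norm_nonneg _).trans (hA 0)
  have hm : MemLp v 3 (torusMeasure d) :=
    MemLp.of_bound hv.aestronglyMeasurable A (ae_of_all _ hA)
  rw [hm.eLpNorm_eq_integral_rpow_norm (by simp) ENNReal.ofNat_ne_top]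
  refine ENNReal.ofReal_le_ofReal ?_
  have e : ((3 : ℝ≥0∞).toReal)⁻¹ = (1 / 3 : ℝ) := by norm_num
  rw [e]
  refine Real.rpow_le_rpow (integral_nonneg fun _ => by positivity) ?_ (by norm_num)
  rw [energySq, ← integral_const_mul]
  have e3 : ∀ x, ‖v x‖ ^ (3 : ℝ≥0∞).toReal = ‖v x‖ ^ 3 := fun x => by
    rw [← Real.rpow_natCast]; norm_num
  simp only [e3]
  refine integral_mono (hv.norm.pow 3).integrable_torus
    (continuous_const.mul (hv.norm.pow 2)).integrable_torus fun x => ?_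
  show ‖v x‖ ^ 3 ≤ A * ‖v x‖ ^ 2
  rw [pow_succ']
  exact mul_le_mul_of_nonneg_right (hA x) (by positivity)

theorem one_le_two_pi_pow (d : ℕ) : 1 ≤ (2 * Real.pi) ^ d :=
  one_le_pow₀ (by linarith [Real.pi_gt_three])

/-- A sup bound for trigonometric fields in terms of the number of frequencies. -/
theorem TrigField.norm_sq_le {d : ℕ} {S : Finset (Fin d → ℤ)} {v : Euc d → Euc d}
    (hv : TrigField S v) (x : Euc d) : ‖v x‖ ^ 2 ≤ S.card * energySq v := by
  have h1 : ∀ i, (v x i) ^ 2 ≤ S.card * ∑ k ∈ S, ‖torusCoeff v i k‖ ^ 2 := by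
    intro i
    have h2 : |v x i| ≤ ∑ k ∈ S, ‖torusCoeff v i k‖ := by
      have := (hv i).eq_sum x
      rw [← Real.norm_eq_abs, ← Complex.norm_real, this]
      refine (norm_sum_le _ _).trans (Finset.sum_le_sum fun k _ => ?_)
      rw [norm_mul, norm_expo, mul_one, torusCoeff_eq_fcoeff]
    rw [← sq_abs]
    exact (pow_le_pow_left₀ (abs_nonneg _) h2 2).trans sq_sum_le_card_mul_sum_sq
  rw [EuclideanSpace.norm_sq_eq, energySq_eq_sum hv]
  simp only [Real.norm_eq_abs, sq_abs]
  refine (Finset.sum_le_sum fun i _ => h1 i).trans ?_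
  rw [← Finset.mul_sum, Finset.sum_comm]
  refine mul_le_mul_of_nonneg_left ?_ (by positivity)
  exact le_mul_of_one_le_left (by positivity) (one_le_two_pi_pow d)

/-! ### Littlewood–Paley symbols -/

namespace IsLPCutoff

variable {d : ℕ} {χ : Euc d → ℝ}

/-- Monotonicity in the norm, used in both directions, makes the cutoff radial. -/
theorem neg (hχ : IsLPCutoff χ) (ξ : Euc d) : χ (-ξ) = χ ξ :=
  le_antisymm (hχ.radially_antitone _ _ (by simp)) (hχ.radially_antitone _ _ (by simp))

theorem le_one (hχ : IsLPCutoff χ) (ξ : Euc d) : χ ξ ≤ 1 := by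
  rw [← hχ.eq_one 0 (by simp)]
  exact hχ.radially_antitone _ _ (by simp)

theorem nonneg (hχ : IsLPCutoff χ) (ξ : Euc d) : 0 ≤ χ ξ := by
  by_cases h : 1 ≤ ‖ξ‖
  · rw [hχ.eq_zero ξ h]
  by_cases h0 : ξ = 0
  · rw [h0, hχ.eq_one 0 (by simp)]; exact zero_le_one
  · have h1 : ‖‖ξ‖⁻¹ • ξ‖ = 1 := by
      rw [norm_smul, norm_inv, norm_norm, inv_mul_cancel₀ (norm_ne_zero_iff.2 h0)]
    rw [← hχ.eq_zero _ h1.ge]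
    exact hχ.radially_antitone _ _ (by rw [h1]; exact (not_le.1 h).le)

end IsLPCutoff

/-- The symbol of the Littlewood–Paley block of index `n - 1`. -/
def lpSymbol {d : ℕ} (χ : Euc d → ℝ) : ℕ → Euc d → ℝ
  | 0, ξ => χ ξ
  | q + 1, ξ => χ (((2 : ℝ) ^ (q + 1))⁻¹ • ξ) - χ (((2 : ℝ) ^ q)⁻¹ • ξ)

theorem lpBlock_eq {d : ℕ} (χ : Euc d → ℝ) (n : ℕ) (v : Euc d → Euc d) :
    lpBlock χ n v = fourierMultiplier (lpSymbol χ n) v := by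
  cases n <;> rfl

namespace IsLPCutoff

variable {d : ℕ} {χ : Euc d → ℝ}

theorem lpSymbol_neg (hχ : IsLPCutoff χ) (n : ℕ) (ξ : Euc d) :
    lpSymbol χ n (-ξ) = lpSymbol χ n ξ := by
  cases n <;> simp [lpSymbol, smul_neg, hχ.neg]

theorem lpSymbol_sq_le_one (hχ : IsLPCutoff χ) (n : ℕ) (ξ : Euc d) : lpSymbol χ n ξ ^ 2 ≤ 1 := by
  rw [sq_le_one_iff_abs_le_one, abs_le]
  cases n with
  | zero => exact ⟨by linarith [hχ.nonneg ξ, show lpSymbol χ 0 ξ = χ ξ from rfl], hχ.le_one ξ⟩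
  | succ q =>
    have h1 := hχ.nonneg (((2 : ℝ) ^ (q + 1))⁻¹ • ξ)
    have h2 := hχ.nonneg (((2 : ℝ) ^ q)⁻¹ • ξ)
    have h3 := hχ.le_one (((2 : ℝ) ^ (q + 1))⁻¹ • ξ)
    have h4 := hχ.le_one (((2 : ℝ) ^ q)⁻¹ • ξ)
    have : lpSymbol χ (q + 1) ξ = χ (((2 : ℝ) ^ (q + 1))⁻¹ • ξ) - χ (((2 : ℝ) ^ q)⁻¹ • ξ) := rfl
    constructor <;> linarith

theorem scaled_eq_zero (hχ : IsLPCutoff χ) {q : ℕ} {ξ : Euc d} (h : (2 : ℝ) ^ q ≤ ‖ξ‖) :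
    χ (((2 : ℝ) ^ q)⁻¹ • ξ) = 0 := by
  apply hχ.eq_zero
  rw [norm_smul, norm_inv, norm_pow, Real.norm_ofNat, ← div_eq_inv_mul]
  exact (one_le_div (by positivity)).2 h

theorem scaled_eq_one (hχ : IsLPCutoff χ) {q : ℕ} {ξ : Euc d} (h : 2 * ‖ξ‖ ≤ (2 : ℝ) ^ q) :
    χ (((2 : ℝ) ^ q)⁻¹ • ξ) = 1 := by
  apply hχ.eq_one
  rw [norm_smul, norm_inv, norm_pow, Real.norm_ofNat, ← div_eq_inv_mul,
    div_le_div_iff₀ (by positivity) two_pos]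
  linarith

theorem lpSymbol_eq_zero_of_le (hχ : IsLPCutoff χ) {n : ℕ} {ξ : Euc d} (h : (2 : ℝ) ^ n ≤ ‖ξ‖) :
    lpSymbol χ n ξ = 0 := by
  cases n with
  | zero => exact hχ.eq_zero ξ (by simpa using h)
  | succ q =>
    have h' : (2 : ℝ) ^ q ≤ ‖ξ‖ := (pow_le_pow_right₀ one_le_two (Nat.le_succ q)).trans h
    simp only [lpSymbol]
    rw [hχ.scaled_eq_zero h, hχ.scaled_eq_zero h', sub_zero]

theorem lpSymbol_succ_eq_zero_of_ge (hχ : IsLPCutoff χ) {q : ℕ} {ξ : Euc d}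
    (h : 2 * ‖ξ‖ ≤ (2 : ℝ) ^ q) : lpSymbol χ (q + 1) ξ = 0 := by
  simp only [lpSymbol]
  rw [hχ.scaled_eq_one h, hχ.scaled_eq_one (h.trans (pow_le_pow_right₀ one_le_two (Nat.le_succ q))),
    sub_self]

end IsLPCutoff

theorem energySq_fourierMultiplier_le {d : ℕ} {S : Finset (Fin d → ℤ)} {v : Euc d → Euc d}
    (hv : TrigField S v) {m : Euc d → ℝ} (hm : ∀ ξ, m (-ξ) = m ξ) (h1 : ∀ ξ, m ξ ^ 2 ≤ 1) :
    energySq (fourierMultiplier m v) ≤ energySq v := by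
  rw [energySq_fourierMultiplier hv hm, energySq_eq_sum hv]
  refine mul_le_mul_of_nonneg_left (Finset.sum_le_sum fun k _ => ?_) (by positivity)
  exact mul_le_of_le_one_left (by positivity) (h1 _)

theorem fourierMultiplier_eq_zero {d : ℕ} {S : Finset (Fin d → ℤ)} {v : Euc d → Euc d}
    (hv : TrigField S v) {m : Euc d → ℝ} (hm : ∀ ξ, m (-ξ) = m ξ)
    (h0 : ∀ k ∈ S, m (waveVec k) = 0) : fourierMultiplier m v = 0 := by
  ext x i
  apply Complex.ofReal_injective
  rw [fourierMultiplier_apply hv hm]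
  simp only [PiLp.zero_apply, Pi.zero_apply, Complex.ofReal_zero]
  exact Finset.sum_eq_zero fun k hk => by rw [h0 k hk]; simp

/-- A block neither enlarges the set of frequencies nor increases the energy, and the sup norm is
bounded through the number of frequencies. For a field with about `N ^ d` frequencies concentrated
on a volume `N ^ (-d)` nothing but constants is lost. -/
theorem TrigField.eLpNorm_three_lpBlock_le {d : ℕ} {χ : Euc d → ℝ} (hχ : IsLPCutoff χ)
    {S : Finset (Fin d → ℤ)} {v : Euc d → Euc d} (hv : TrigField S v) (n : ℕ) :
    eLpNorm (lpBlock χ n v) 3 (torusMeasure d) ≤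
      ENNReal.ofReal ((Real.sqrt S.card * Real.sqrt (energySq v) ^ 3) ^ (1 / 3 : ℝ)) := by
  rw [lpBlock_eq]
  set w := _root_.fourierMultiplier (lpSymbol χ n) v
  have hw : TrigField S w := hv.fourierMultiplier (hχ.lpSymbol_neg n)
  have hwE : energySq w ≤ energySq v :=
    energySq_fourierMultiplier_le hv (hχ.lpSymbol_neg n) (hχ.lpSymbol_sq_le_one n)
  have hb : ∀ x, ‖w x‖ ≤ Real.sqrt (S.card * energySq w) := fun x =>
    Real.le_sqrt_of_sq_le (hw.norm_sq_le x)
  refine (eLpNorm_three_le hw.contDiff.continuous hb).trans (ENNReal.ofReal_le_ofReal ?_)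
  refine Real.rpow_le_rpow (mul_nonneg (Real.sqrt_nonneg _) (energySq_nonneg _)) ?_ (by norm_num)
  rw [pow_succ', Real.sq_sqrt (energySq_nonneg v), ← mul_assoc, ← Real.sqrt_mul (by positivity)]
  gcongr
  exact energySq_nonneg w

/-- A block that meets `S` has `2 ^ (n - 1) ≤ 2 R`, which bounds the weight for `s ≥ 0`. For `s < 0`
the largest weight is `2 ^ (-s)`, that of the block of index `-1`. All other blocks vanish. -/
theorem TrigField.besovNorm_three_top_le {d : ℕ} {χ : Euc d → ℝ} (hχ : IsLPCutoff χ)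
    {S : Finset (Fin d → ℤ)} {v : Euc d → Euc d} (hv : TrigField S v) {R : ℝ} (hR1 : 1 ≤ R)
    (hR : ∀ k ∈ S, ‖waveVec k‖ ≤ R) (s : ℝ) :
    besovNorm χ s 3 ⊤ v ≤ ENNReal.ofReal ((2 : ℝ) ^ |s| * (2 * R) ^ (max s 0)) *
      ENNReal.ofReal ((Real.sqrt S.card * Real.sqrt (energySq v) ^ 3) ^ (1 / 3 : ℝ)) := by
  rw [besovNorm, eLpNorm_exponent_top]
  refine essSup_le_of_ae_le _ (ae_of_all _ fun n => ?_)
  simp only [enorm_eq_self]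
  by_cases hn : ∃ k ∈ S, lpSymbol χ n (waveVec k) ≠ 0
  · refine mul_le_mul' (ENNReal.ofReal_le_ofReal ?_) (hv.eLpNorm_three_lpBlock_le hχ n)
    have hle : (2 : ℝ) ^ ((n : ℝ) - 1) ≤ 2 * R := by
      cases n with
      | zero =>
        have : (2 : ℝ) ^ (((0 : ℕ) : ℝ) - 1) ≤ 2 ^ (0 : ℝ) :=
          Real.rpow_le_rpow_of_exponent_le one_le_two (by simp)
        rw [Real.rpow_zero] at this
        linarith
      | succ q =>
        obtain ⟨k, hk, hne⟩ := hn
        have : ¬ (2 * ‖waveVec k‖ ≤ (2 : ℝ) ^ q) := fun h =>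
          hne (hχ.lpSymbol_succ_eq_zero_of_ge h)
        have hq : ((q + 1 : ℕ) : ℝ) - 1 = (q : ℝ) := by push_cast; ring
        rw [hq, Real.rpow_natCast]
        linarith [hR k hk]
    rcases le_total 0 s with hs | hs
    · rw [max_eq_left hs, Real.rpow_mul two_pos.le]
      calc ((2 : ℝ) ^ ((n : ℝ) - 1)) ^ s ≤ (2 * R) ^ s := Real.rpow_le_rpow (by positivity) hle hs
        _ ≤ _ := le_mul_of_one_le_left (by positivity) (Real.one_le_rpow one_le_two (abs_nonneg s))
    · rw [max_eq_right hs, Real.rpow_zero, mul_one]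
      refine Real.rpow_le_rpow_of_exponent_le one_le_two ?_
      rw [abs_of_nonpos hs]
      nlinarith [(Nat.cast_nonneg n : (0 : ℝ) ≤ n)]
  · push Not at hn
    rw [lpBlock_eq, fourierMultiplier_eq_zero hv (hχ.lpSymbol_neg n) hn]
    simp

/-- A geometric series that starts at the first power of two above `|r|`. It sums, for one
frequency, the contributions of all dyadic blocks to an `H^{-1}` norm. -/
theorem sum_range_dyadic_le (r : ℝ) (M : ℕ) :
    ∑ n ∈ Finset.range M, (if |r| < (2 : ℝ) ^ n then ((4 : ℝ) ^ n)⁻¹ * r ^ 2 else 0) ≤ 2 := by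
  -- Strengthened for the induction: when a term `x ≤ 1` is added, the subtracted quantity falls
  -- from `2 x` to `x / 2`, which pays for it.
  have key : ∀ M : ℕ,
      ∑ n ∈ Finset.range M, (if |r| < (2 : ℝ) ^ n then ((4 : ℝ) ^ n)⁻¹ * r ^ 2 else 0) ≤
        2 - 2 * min 1 (((4 : ℝ) ^ M)⁻¹ * r ^ 2) := by
    intro M
    induction M with
    | zero =>
      have := min_le_left (1 : ℝ) (((4 : ℝ) ^ 0)⁻¹ * r ^ 2)
      simp only [Finset.range_zero, Finset.sum_empty]
      linarith
    | succ M ih =>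
      rw [Finset.sum_range_succ]
      have h4 : ((4 : ℝ) ^ (M + 1))⁻¹ * r ^ 2 = (((4 : ℝ) ^ M)⁻¹ * r ^ 2) / 4 := by
        rw [pow_succ, mul_inv]; ring
      have hp : 0 ≤ ((4 : ℝ) ^ M)⁻¹ * r ^ 2 := by positivity
      rw [h4]
      have hm2 := min_le_right (1 : ℝ) (((4 : ℝ) ^ M)⁻¹ * r ^ 2 / 4)
      split_ifs with h
      · have h1 : ((4 : ℝ) ^ M)⁻¹ * r ^ 2 ≤ 1 := by
          rw [inv_mul_le_iff₀ (by positivity), mul_one, ← sq_abs]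
          calc |r| ^ 2 ≤ ((2 : ℝ) ^ M) ^ 2 := pow_le_pow_left₀ (abs_nonneg _) h.le 2
            _ = 4 ^ M := by rw [← pow_mul, mul_comm, pow_mul]; norm_num
        rw [min_eq_right h1] at ih
        linarith
      · have : min 1 (((4 : ℝ) ^ M)⁻¹ * r ^ 2 / 4) ≤ min 1 (((4 : ℝ) ^ M)⁻¹ * r ^ 2) :=
          min_le_min le_rfl (by linarith)
        linarith
  have h := key M
  have : 0 ≤ min 1 (((4 : ℝ) ^ M)⁻¹ * r ^ 2) := le_min zero_le_one (by positivity)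
  linarith

/-- The `H^{-1}` norm of a divergence is controlled by the `L²` norm. -/
theorem besovNorm_neg_one_divergence_le {d : ℕ} {χ : Euc d → ℝ} (hχ : IsLPCutoff χ)
    {S : Finset (Fin d → ℤ)} {G : Fin d → Euc d → Euc d} (hG : ∀ j, TrigField S (G j)) :
    besovNorm χ (-1) 2 2 (fun x => ∑ j, partialD j (G j) x) ≤
      ENNReal.ofReal (Real.sqrt (8 * ∑ j, energySq (G j))) := by
  set f : Euc d → Euc d := fun x => ∑ j, partialD j (G j) x with hf_def
  have hf : TrigField S f := TrigField.sum fun j _ => (hG j).partialD j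
  -- Cauchy–Schwarz in `j`, after the derivative has become the factor `k j`.
  have hcoeff : ∀ k i, ‖torusCoeff f i k‖ ^ 2 ≤
      ‖waveVec k‖ ^ 2 * ∑ j, ‖torusCoeff (G j) i k‖ ^ 2 := by
    intro k i
    rw [hf_def, torusCoeff_sum _ fun j _ => ((hG j).partialD j).contDiff.continuous]
    simp only [fun j => torusCoeff_partialD (hG j).contDiff (hG j).torusPeriodic i j k]
    have h1 : ‖∑ j, Complex.I * (k j : ℂ) * torusCoeff (G j) i k‖ ≤
        ∑ j, |(k j : ℝ)| * ‖torusCoeff (G j) i k‖ := by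
      refine (norm_sum_le _ _).trans (Finset.sum_le_sum fun j _ => ?_)
      rw [norm_mul, norm_mul, Complex.norm_I, one_mul, Complex.norm_intCast]
    refine (pow_le_pow_left₀ (norm_nonneg _) h1 2).trans ?_
    refine (Finset.sum_mul_sq_le_sq_mul_sq _ _ _).trans (le_of_eq ?_)
    simp only [sq_abs, norm_sq_waveVec]
  -- The block number `n` has index `n - 1`, whence the factor 4 in the squared weight `2 ^ (-2 (n -
  -- 1))`.
  have hterm : ∀ n : ℕ, (ENNReal.ofReal ((2 : ℝ) ^ (((n : ℝ) - 1) * (-1))) *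
      eLpNorm (lpBlock χ n f) 2 (torusMeasure d)) ^ (2 : ℝ) =
      ENNReal.ofReal (4 * ((4 : ℝ) ^ n)⁻¹ * energySq (lpBlock χ n f)) := by
    intro n
    have hb : Continuous (lpBlock χ n f) := by
      rw [lpBlock_eq]
      exact (hf.fourierMultiplier (hχ.lpSymbol_neg n)).contDiff.continuous
    rw [eLpNorm_two_torus hb, ← ENNReal.ofReal_mul (by positivity),
      ENNReal.ofReal_rpow_of_nonneg (by positivity) two_pos.le]
    congr 1
    rw [Real.rpow_two, mul_pow, Real.sq_sqrt (energySq_nonneg _)]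
    congr 1
    rw [show ((n : ℝ) - 1) * (-1) = 1 - n by ring, Real.rpow_sub two_pos, Real.rpow_one,
      Real.rpow_natCast, div_pow, ← pow_mul, mul_comm n 2, pow_mul]
    norm_num
    rfl
  -- The sums over blocks and frequencies are exchanged. For a fixed `k` the blocks with `2 ^ n ≤
  -- ‖waveVec k‖` vanish and the others add up to at most `4 * 2 = 8`.
  have hsum : ∀ M : ℕ, ∑ n ∈ Finset.range M, 4 * ((4 : ℝ) ^ n)⁻¹ * energySq (lpBlock χ n f) ≤
      8 * ∑ j, energySq (G j) := by
    intro M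
    have e1 : ∀ n, energySq (lpBlock χ n f) = (2 * Real.pi) ^ d *
        ∑ k ∈ S, lpSymbol χ n (waveVec k) ^ 2 * ∑ i, ‖torusCoeff f i k‖ ^ 2 := fun n => by
      rw [lpBlock_eq, energySq_fourierMultiplier hf (hχ.lpSymbol_neg n)]
    have e2 : ∑ j, energySq (G j) = (2 * Real.pi) ^ d *
        ∑ k ∈ S, ∑ i, ∑ j, ‖torusCoeff (G j) i k‖ ^ 2 := by
      simp only [energySq_eq_sum (hG _)]
      rw [← Finset.mul_sum, Finset.sum_comm]
      congr 1
      exact Finset.sum_congr rfl fun k _ => Finset.sum_comm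
    have e3 : ∑ n ∈ Finset.range M, 4 * ((4 : ℝ) ^ n)⁻¹ * energySq (lpBlock χ n f) =
        (2 * Real.pi) ^ d * ∑ k ∈ S, 4 * ∑ n ∈ Finset.range M,
          (((4 : ℝ) ^ n)⁻¹ * lpSymbol χ n (waveVec k) ^ 2) * ∑ i, ‖torusCoeff f i k‖ ^ 2 := by
      simp only [e1, Finset.mul_sum]
      rw [Finset.sum_comm]
      refine Finset.sum_congr rfl fun k _ => Finset.sum_congr rfl fun n _ =>
        Finset.sum_congr rfl fun i _ => by ring
    rw [e3, e2, mul_left_comm]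
    refine mul_le_mul_of_nonneg_left ?_ (by positivity)
    rw [Finset.mul_sum]
    refine Finset.sum_le_sum fun k _ => ?_
    have hA : ∑ i, ‖torusCoeff f i k‖ ^ 2 ≤
        ‖waveVec k‖ ^ 2 * ∑ i, ∑ j, ‖torusCoeff (G j) i k‖ ^ 2 := by
      rw [Finset.mul_sum]
      exact Finset.sum_le_sum fun i _ => hcoeff k i
    set A := ∑ i, ∑ j, ‖torusCoeff (G j) i k‖ ^ 2
    have hA0 : 0 ≤ A := by positivity
    have h2 := sum_range_dyadic_le ‖waveVec k‖ M
    have h3 : ∑ n ∈ Finset.range M, (((4 : ℝ) ^ n)⁻¹ * lpSymbol χ n (waveVec k) ^ 2) *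
        ∑ i, ‖torusCoeff f i k‖ ^ 2 ≤ ∑ n ∈ Finset.range M,
        (if |‖waveVec k‖| < (2 : ℝ) ^ n then ((4 : ℝ) ^ n)⁻¹ * ‖waveVec k‖ ^ 2 else 0) * A := by
      refine Finset.sum_le_sum fun n _ => ?_
      split_ifs with h
      · calc _ ≤ (((4 : ℝ) ^ n)⁻¹ * 1) * (‖waveVec k‖ ^ 2 * A) := by
              gcongr
              exact hχ.lpSymbol_sq_le_one n _
          _ = _ := by ring
      · rw [abs_of_nonneg (norm_nonneg _), not_lt] at h
        rw [hχ.lpSymbol_eq_zero_of_le h]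
        simp
    have h4 := mul_le_mul_of_nonneg_right h2 hA0
    rw [Finset.sum_mul] at h4
    linarith
  rw [besovNorm, eLpNorm_eq_lintegral_rpow_enorm_toReal two_ne_zero ENNReal.ofNat_ne_top,
    lintegral_count]
  simp only [enorm_eq_self, ENNReal.toReal_ofNat, hterm]
  rw [Real.sqrt_eq_rpow, ← ENNReal.ofReal_rpow_of_nonneg
    (mul_nonneg (by norm_num) (Finset.sum_nonneg fun j _ => energySq_nonneg _)) (by norm_num)]
  refine ENNReal.rpow_le_rpow ?_ (by norm_num)
  refine ENNReal.tsum_le_of_sum_range_le fun M => ?_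
  rw [← ENNReal.ofReal_sum_of_nonneg fun n _ =>
    mul_nonneg (by positivity) (energySq_nonneg _)]
  exact ENNReal.ofReal_le_ofReal (hsum M)

/-! ### Decay of Fourier coefficients of smooth fields -/

theorem norm_torusCoeff_le {d : ℕ} {v : Euc d → Euc d} (hv : Continuous v) (i : Fin d)
    (k : Fin d → ℤ) : ‖torusCoeff v i k‖ ≤ ∫ x, ‖v x‖ ∂(torusMeasure d) := by
  rw [torusCoeff_eq_fcoeff, fcoeff, norm_mul]
  have h1 : ‖((((2 * Real.pi) ^ d)⁻¹ : ℝ) : ℂ)‖ ≤ 1 := by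
    rw [Complex.norm_real, Real.norm_of_nonneg (by positivity)]
    exact inv_le_one_of_one_le₀ (one_le_two_pi_pow d)
  have h2 : ‖∫ x, (v x i : ℂ) * expo (-k) x ∂(torusMeasure d)‖ ≤
      ∫ x, ‖v x‖ ∂(torusMeasure d) := by
    refine norm_integral_le_of_norm_le hv.norm.integrable_torus (ae_of_all _ fun x => ?_)
    rw [norm_mul, norm_expo, mul_one, Complex.norm_real]
    exact PiLp.norm_apply_le (v x) i
  calc _ ≤ 1 * _ := mul_le_mul h1 h2 (norm_nonneg _) zero_le_one
    _ = _ := one_mul _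

/-- Differentiating `m` times in direction `j` multiplies the coefficient by `(i k_j) ^ m`, and
coefficients are bounded by the `L¹` norm. -/
theorem exists_torusCoeff_decay {d : ℕ} {v : Euc d → Euc d} (hv : ContDiff ℝ ∞ v)
    (pv : TorusPeriodic v) (m : ℕ) :
    ∃ C : ℝ, 0 ≤ C ∧ ∀ i j k, |(k j : ℝ)| ^ m * ‖torusCoeff v i k‖ ≤ C := by
  have key : ∀ j : Fin d, ∃ w : Euc d → Euc d, ContDiff ℝ ∞ w ∧ TorusPeriodic w ∧
      ∀ i k, |(k j : ℝ)| ^ m * ‖torusCoeff v i k‖ = ‖torusCoeff w i k‖ := by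
    intro j
    induction m with
    | zero => exact ⟨v, hv, pv, fun i k => by simp⟩
    | succ m ih =>
      obtain ⟨w, hw, pw, h⟩ := ih
      refine ⟨partialD j w, hw.partialD j, pw.partialD j, fun i k => ?_⟩
      rw [torusCoeff_partialD hw pw, norm_mul, norm_mul, Complex.norm_I, one_mul,
        Complex.norm_intCast, ← h, pow_succ']
      ring
  choose w hw _ h using key
  refine ⟨∑ j, ∫ x, ‖w j x‖ ∂(torusMeasure d), Finset.sum_nonneg fun j _ =>
    integral_nonneg fun _ => norm_nonneg _, fun i j k => ?_⟩
  rw [h]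
  refine (norm_torusCoeff_le (hw j).continuous i k).trans ?_
  exact Finset.single_le_sum (f := fun j => ∫ x, ‖w j x‖ ∂(torusMeasure d))
    (fun j _ => integral_nonneg fun _ => norm_nonneg _) (Finset.mem_univ j)

theorem torusInner_comm {d : ℕ} (v w : Euc d → Euc d) : torusInner v w = torusInner w v := by
  simp only [torusInner, real_inner_comm]

/-- Fields with high frequencies are almost orthogonal to a smooth field. -/
theorem abs_torusInner_le_of_high_freq {d : ℕ} {S : Finset (Fin d → ℤ)} {v φ : Euc d → Euc d}
    (hv : TrigField S v) (hφ : Continuous φ) {m : ℕ} {C R : ℝ} (hR : 0 < R)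
    (hC : ∀ i j k, |(k j : ℝ)| ^ m * ‖torusCoeff φ i k‖ ≤ C)
    (hS : ∀ k ∈ S, ∃ j, R ≤ |(k j : ℝ)|) :
    |torusInner v φ| ≤ (2 * Real.pi) ^ d * (S.card * d * C * Real.sqrt (energySq v)) / R ^ m := by
  rw [torusInner_comm, torusInner_eq_sum hφ hv, abs_mul, abs_of_nonneg (by positivity),
    mul_div_assoc]
  refine mul_le_mul_of_nonneg_left ?_ (by positivity)
  have h1 : ∀ k ∈ S, ∀ i, |(torusCoeff φ i k * star (torusCoeff v i k)).re| ≤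
      C / R ^ m * Real.sqrt (energySq v) := by
    intro k hk i
    refine (Complex.abs_re_le_norm _).trans ?_
    rw [norm_mul, norm_star]
    obtain ⟨j, hj⟩ := hS k hk
    have a1 : ‖torusCoeff φ i k‖ ≤ C / R ^ m := by
      rw [le_div_iff₀ (by positivity), mul_comm]
      exact (mul_le_mul_of_nonneg_right (pow_le_pow_left₀ hR.le hj m) (norm_nonneg _)).trans
        (hC i j k)
    have a2 : ‖torusCoeff v i k‖ ≤ Real.sqrt (energySq v) := by
      refine Real.le_sqrt_of_sq_le ?_
      rw [energySq_eq_sum hv]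
      refine le_trans ?_ (le_mul_of_one_le_left (by positivity) (one_le_two_pi_pow d))
      refine le_trans ?_ (Finset.single_le_sum (f := fun k => ∑ i, ‖torusCoeff v i k‖ ^ 2)
        (fun k _ => by positivity) hk)
      exact Finset.single_le_sum (f := fun i => ‖torusCoeff v i k‖ ^ 2)
        (fun i _ => by positivity) (Finset.mem_univ i)
    exact mul_le_mul a1 a2 (norm_nonneg _) ((norm_nonneg _).trans a1)
  calc _ ≤ ∑ k ∈ S, ∑ _i : Fin d, C / R ^ m * Real.sqrt (energySq v) := by
        refine (Finset.abs_sum_le_sum_abs _ _).trans (Finset.sum_le_sum fun k hk => ?_)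
        exact (Finset.abs_sum_le_sum_abs _ _).trans (Finset.sum_le_sum fun i _ => h1 k hk i)
    _ = _ := by
        simp only [Finset.sum_const, nsmul_eq_mul, Finset.card_univ, Fintype.card_fin]
        ring

/-! ### The Fejér kernel -/

/-- The Fejér kernel of order `N`, normalized to be `1` at the origin. -/
def fejer (N : ℕ) (s : ℝ) : ℝ :=
  ((∑ k ∈ Finset.range N, Real.cos (k * s)) ^ 2 +
    (∑ k ∈ Finset.range N, Real.sin (k * s)) ^ 2) / (N : ℝ) ^ 2

theorem fejer_eq_sum_cos (N : ℕ) (s : ℝ) :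
    fejer N s = (∑ k ∈ Finset.range N, ∑ l ∈ Finset.range N,
      Real.cos ((((k : ℤ) - (l : ℤ) : ℤ) : ℝ) * s)) / (N : ℝ) ^ 2 := by
  rw [fejer, sq, sq, Finset.sum_mul_sum, Finset.sum_mul_sum, ← Finset.sum_add_distrib]
  congr 1
  refine Finset.sum_congr rfl fun k _ => ?_
  rw [← Finset.sum_add_distrib]
  refine Finset.sum_congr rfl fun l _ => ?_
  push_cast
  rw [sub_mul, Real.cos_sub]

theorem fejer_nonneg (N : ℕ) (s : ℝ) : 0 ≤ fejer N s := by
  unfold fejer; positivity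

theorem fejer_le_one (N : ℕ) (s : ℝ) : fejer N s ≤ 1 := by
  rw [fejer_eq_sum_cos]
  refine div_le_one_of_le₀ ?_ (by positivity)
  calc _ ≤ ∑ _k ∈ Finset.range N, ∑ _l ∈ Finset.range N, (1 : ℝ) :=
        Finset.sum_le_sum fun k _ => Finset.sum_le_sum fun l _ => Real.cos_le_one _
    _ = (N : ℝ) ^ 2 := by simp [sq]

theorem fejer_zero {N : ℕ} (hN : 0 < N) : fejer N 0 = 1 := by
  have : (N : ℝ) ≠ 0 := by positivity
  simp [fejer, this]

theorem fejer_two_pi_sub (N : ℕ) (s : ℝ) : fejer N (2 * Real.pi - s) = fejer N s := by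
  rw [fejer_eq_sum_cos, fejer_eq_sum_cos]
  congr 1
  refine Finset.sum_congr rfl fun k _ => Finset.sum_congr rfl fun l _ => ?_
  rw [mul_sub, Real.cos_int_mul_two_pi_sub]

/-- The kernel is an average of `N ^ 2` cosines of frequencies at most `N`. -/
theorem exists_hasDerivAt_fejer {N : ℕ} (hN : 0 < N) (s : ℝ) :
    ∃ f' : ℝ, HasDerivAt (fejer N) f' s ∧ |f'| ≤ N := by
  have h : ∀ k ∈ Finset.range N, HasDerivAt (fun s => ∑ l ∈ Finset.range N,
      Real.cos ((((k : ℤ) - (l : ℤ) : ℤ) : ℝ) * s))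
      (∑ l ∈ Finset.range N, -Real.sin ((((k : ℤ) - (l : ℤ) : ℤ) : ℝ) * s) *
        ((((k : ℤ) - (l : ℤ) : ℤ) : ℝ) * 1)) s := fun k _ =>
    HasDerivAt.fun_sum fun l _ => ((hasDerivAt_id s).const_mul _).cos
  have h2 := (HasDerivAt.fun_sum h).div_const ((N : ℝ) ^ 2)
  rw [show (fun s => (∑ k ∈ Finset.range N, ∑ l ∈ Finset.range N,
      Real.cos ((((k : ℤ) - (l : ℤ) : ℤ) : ℝ) * s)) / (N : ℝ) ^ 2) = fejer N from
      funext fun s => (fejer_eq_sum_cos N s).symm] at h2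
  refine ⟨_, h2, ?_⟩
  have hN' : (0 : ℝ) < N := by exact_mod_cast hN
  rw [abs_div, abs_of_pos (by positivity : (0 : ℝ) < (N : ℝ) ^ 2), div_le_iff₀ (by positivity)]
  calc _ ≤ ∑ _k ∈ Finset.range N, ∑ _l ∈ Finset.range N, (N : ℝ) := by
        refine (Finset.abs_sum_le_sum_abs _ _).trans (Finset.sum_le_sum fun k hk => ?_)
        refine (Finset.abs_sum_le_sum_abs _ _).trans (Finset.sum_le_sum fun l hl => ?_)
        rw [abs_mul, abs_neg, mul_one]
        have hk' : (k : ℝ) < N := by exact_mod_cast Finset.mem_range.1 hk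
        have hl' : (l : ℝ) < N := by exact_mod_cast Finset.mem_range.1 hl
        have h3 : |(((k : ℤ) - (l : ℤ) : ℤ) : ℝ)| ≤ N := by
          push_cast
          rw [abs_le]
          constructor <;> linarith [(Nat.cast_nonneg k : (0 : ℝ) ≤ k), (Nat.cast_nonneg l : (0 : ℝ) ≤ l)]
        calc _ ≤ 1 * (N : ℝ) := mul_le_mul (Real.abs_sin_le_one _) h3 (abs_nonneg _) zero_le_one
          _ = N := one_mul _
    _ = (N : ℝ) * (N : ℝ) ^ 2 := by
        simp only [Finset.sum_const, Finset.card_range, nsmul_eq_mul]; ring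

theorem contDiff_fejer (N : ℕ) : ContDiff ℝ ∞ (fejer N) := by
  unfold fejer
  fun_prop

/-- Of the `N ^ 2` cosines only the `N` diagonal ones have nonzero mean. -/
theorem integral_fejer {N : ℕ} (hN : 0 < N) :
    ∫ s in (0 : ℝ)..(2 * Real.pi), fejer N s = 2 * Real.pi / N := by
  have hcos : ∀ m : ℤ, ∫ s in (0 : ℝ)..(2 * Real.pi), Real.cos ((m : ℝ) * s) =
      if m = 0 then 2 * Real.pi else 0 := by
    intro m
    split_ifs with h
    · simp [h]
    · have hm : (m : ℝ) ≠ 0 := by exact_mod_cast h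
      rw [intervalIntegral.integral_comp_mul_left _ hm, integral_cos, mul_zero, Real.sin_zero,
        mul_comm (m : ℝ), mul_comm 2 Real.pi, mul_assoc]
      have : Real.sin (Real.pi * (2 * (m : ℝ))) = 0 := by
        have := Real.sin_int_mul_pi (2 * m)
        push_cast at this
        rw [mul_comm]; exact this
      rw [this]; simp
  simp only [fejer_eq_sum_cos]
  rw [intervalIntegral.integral_div, intervalIntegral.integral_finsetSum fun k _ =>
    (Continuous.intervalIntegrable (by fun_prop) _ _)]
  have h1 : ∀ k ∈ Finset.range N, ∫ s in (0 : ℝ)..(2 * Real.pi), ∑ l ∈ Finset.range N,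
      Real.cos ((((k : ℤ) - (l : ℤ) : ℤ) : ℝ) * s) = 2 * Real.pi := by
    intro k hk
    rw [intervalIntegral.integral_finsetSum fun k _ =>
      (Continuous.intervalIntegrable (by fun_prop) _ _)]
    simp only [hcos, sub_eq_zero, Nat.cast_inj]
    rw [Finset.sum_ite_eq, if_pos hk]
  rw [Finset.sum_congr rfl h1]
  have : (N : ℝ) ≠ 0 := by positivity
  simp only [Finset.sum_const, Finset.card_range, nsmul_eq_mul]
  field_simp

/-- The kernel starts at 1 and its slope is at most `N`. -/
theorem half_le_fejer {N : ℕ} (hN : 0 < N) {s : ℝ} (h0 : 0 ≤ s) (h1 : s ≤ 1 / (2 * N)) :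
    1 / 2 ≤ fejer N s := by
  have hd : ∀ t, DifferentiableAt ℝ (fejer N) t := fun t =>
    (contDiff_fejer N).differentiable (by simp) t
  have hb : ∀ t ∈ (univ : Set ℝ), ‖deriv (fejer N) t‖ ≤ N := by
    intro t _
    obtain ⟨f', hf', hle⟩ := exists_hasDerivAt_fejer hN t
    rw [hf'.deriv]; exact hle
  have := convex_univ.norm_image_sub_le_of_norm_deriv_le (fun t _ => hd t) hb (mem_univ 0)
    (mem_univ s)
  rw [fejer_zero hN, sub_zero, Real.norm_eq_abs, Real.norm_eq_abs, abs_of_nonneg h0] at this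
  have hN' : (0 : ℝ) < N := by exact_mod_cast hN
  have h2 : (N : ℝ) * s ≤ 1 / 2 := by
    calc (N : ℝ) * s ≤ N * (1 / (2 * N)) := by gcongr
      _ = 1 / 2 := by field_simp
  linarith [(abs_le.1 this).1]

/-- The exponent 6 is what the transfer of energy requires: a cube of the envelope, which is the
square of the profile. The constant is `(1 / 2) ^ 6`, from the interval on which the kernel is at
least one half. -/
theorem integral_fejer_pow_mul_ge {N : ℕ} (hN : 0 < N) {g : ℝ → ℝ} (hg : Continuous g)
    (hg0 : ∀ s, 0 ≤ g s) :
    (1 / 64) * ∫ s in (0 : ℝ)..(1 / (2 * N)), g s ≤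
      ∫ s in (0 : ℝ)..(2 * Real.pi), fejer N s ^ 6 * g s := by
  have hN' : (1 : ℝ) ≤ N := by exact_mod_cast hN
  have hc : Continuous (fejer N) := (contDiff_fejer N).continuous
  have hL : 1 / (2 * (N : ℝ)) ≤ 2 * Real.pi := by
    have : 1 / (2 * (N : ℝ)) ≤ 1 := by
      rw [div_le_one (by positivity)]; linarith
    linarith [Real.pi_gt_three]
  calc _ = ∫ s in (0 : ℝ)..(1 / (2 * N)), (1 / 64) * g s :=
        (intervalIntegral.integral_const_mul _ _).symm
    _ ≤ ∫ s in (0 : ℝ)..(1 / (2 * N)), fejer N s ^ 6 * g s := by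
        refine intervalIntegral.integral_mono_on (by positivity)
          (Continuous.intervalIntegrable (by fun_prop) _ _)
          (Continuous.intervalIntegrable (by fun_prop) _ _) fun s hs => ?_
        refine mul_le_mul_of_nonneg_right ?_ (hg0 s)
        have := pow_le_pow_left₀ (by norm_num) (half_le_fejer hN hs.1 hs.2) 6
        norm_num at this ⊢
        exact this
    _ ≤ _ := by
        refine intervalIntegral.integral_mono_interval le_rfl (by positivity) hL
          (ae_of_all _ fun s => mul_nonneg (pow_nonneg (fejer_nonneg N s) 6) (hg0 s))
          (Continuous.intervalIntegrable (by fun_prop) _ _)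

theorem integral_fejer_pow_ge {N : ℕ} (hN : 0 < N) :
    (1 : ℝ) / (512 * N) ≤ ∫ s in (0 : ℝ)..(2 * Real.pi), fejer N s ^ 6 := by
  have h := integral_fejer_pow_mul_ge hN (g := fun _ => 1) continuous_const fun _ => zero_le_one
  simp only [mul_one, intervalIntegral.integral_const, smul_eq_mul, sub_zero] at h
  refine le_trans ?_ h
  have hN' : (0 : ℝ) < N := by exact_mod_cast hN
  rw [div_mul_div_comm, one_mul]
  exact one_div_le_one_div_of_le (by positivity) (by linarith)

/-- Over the interval of length `1 / (2 N)` the mean one half of `cos²` gives `1 / (4 N)`. The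
boundary term is at most `1 / (2 L) ≤ 1 / (8 N)`, so `1 / (8 N)` remains, to be multiplied by `1 /
64`. -/
theorem integral_fejer_pow_mul_cos_sq_ge {N L : ℕ} (hN : 0 < N) (hL : 4 * N ≤ L) :
    (1 : ℝ) / (512 * N) ≤ ∫ s in (0 : ℝ)..(2 * Real.pi), fejer N s ^ 6 * Real.cos (L * s) ^ 2 := by
  refine le_trans ?_ (integral_fejer_pow_mul_ge hN (g := fun s => Real.cos (L * s) ^ 2)
    (by fun_prop) fun _ => sq_nonneg _)
  have hN' : (0 : ℝ) < N := by exact_mod_cast hN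
  have hL' : 4 * (N : ℝ) ≤ L := by exact_mod_cast hL
  have hL0 : (0 : ℝ) < L := by linarith
  rw [intervalIntegral.integral_comp_mul_left (fun s => Real.cos s ^ 2) hL0.ne', integral_cos_sq]
  simp only [mul_zero, Real.sin_zero, sub_zero, smul_eq_mul]
  set b := (L : ℝ) * (1 / (2 * N))
  have hcs : -1 ≤ Real.cos b * Real.sin b := by
    have := Real.abs_cos_le_one b
    have h2 := Real.abs_sin_le_one b
    have : |Real.cos b * Real.sin b| ≤ 1 := by
      rw [abs_mul]; exact mul_le_one₀ this (abs_nonneg _) h2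
    exact (abs_le.1 this).1
  have h1 : (L : ℝ)⁻¹ * ((-1 + b) / 2) ≤ (L : ℝ)⁻¹ * ((Real.cos b * Real.sin b + b) / 2) := by
    gcongr
  have h2 : (L : ℝ)⁻¹ * ((-1 + b) / 2) = 1 / (4 * N) - 1 / (2 * L) := by
    simp only [b]; field_simp; ring
  have h3 : 1 / (2 * (L : ℝ)) ≤ 1 / (8 * N) := one_div_le_one_div_of_le (by positivity) (by linarith)
  have h4 : 1 / (4 * (N : ℝ)) - 1 / (8 * N) = 1 / (8 * N) := by field_simp; norm_num
  have h5 : 1 / (512 * (N : ℝ)) = 1 / 64 * (1 / (8 * N)) := by field_simp; norm_num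
  rw [h5]
  linarith

/-- Expanding, `(1 + s)² s = (s + s³) + 2 s²`. The reflection of the period preserves the kernel and
changes the sign of the sine, which kills the odd part. The cross term `2 s²` is positive, and it is
the reason for the summand 1 in the high-frequency field. -/
theorem integral_fejer_pow_mul_sin_ge {N L : ℕ} (hN : 0 < N) (hL : 4 * N ≤ L) :
    (1 : ℝ) / (512 * N) ≤ ∫ s in (0 : ℝ)..(2 * Real.pi),
      fejer N s ^ 6 * ((1 + Real.sin (L * s)) ^ 2 * Real.sin (L * s)) := by
  have hc : Continuous (fejer N) := (contDiff_fejer N).continuous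
  have hN' : (0 : ℝ) < N := by exact_mod_cast hN
  have hL' : 4 * (N : ℝ) ≤ L := by exact_mod_cast hL
  have hL0 : (0 : ℝ) < L := by linarith
  have hodd : ∫ s in (0 : ℝ)..(2 * Real.pi),
      fejer N s ^ 6 * (Real.sin (L * s) + Real.sin (L * s) ^ 3) = 0 := by
    have h := intervalIntegral.integral_comp_sub_left (a := 0) (b := 2 * Real.pi)
      (fun s => fejer N s ^ 6 * (Real.sin (L * s) + Real.sin (L * s) ^ 3)) (2 * Real.pi)
    have e : ∀ s : ℝ, Real.sin (L * (2 * Real.pi - s)) = -Real.sin (L * s) := fun s => by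
      rw [mul_sub, Real.sin_nat_mul_two_pi_sub]
    simp only [e, fejer_two_pi_sub, sub_self, sub_zero] at h
    have e2 : ∀ s : ℝ, fejer N s ^ 6 * (-Real.sin (L * s) + (-Real.sin (L * s)) ^ 3) =
        -(fejer N s ^ 6 * (Real.sin (L * s) + Real.sin (L * s) ^ 3)) := fun s => by ring
    simp only [e2, intervalIntegral.integral_neg] at h
    linarith
  have e : ∀ s : ℝ, fejer N s ^ 6 * ((1 + Real.sin (L * s)) ^ 2 * Real.sin (L * s)) =
      fejer N s ^ 6 * (Real.sin (L * s) + Real.sin (L * s) ^ 3) +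
        fejer N s ^ 6 * (2 * Real.sin (L * s) ^ 2) := fun s => by ring
  simp only [e]
  rw [intervalIntegral.integral_add (Continuous.intervalIntegrable (by fun_prop) _ _)
    (Continuous.intervalIntegrable (by fun_prop) _ _), hodd, zero_add]
  refine le_trans ?_ (integral_fejer_pow_mul_ge hN (g := fun s => 2 * Real.sin (L * s) ^ 2)
    (by fun_prop) fun _ => by positivity)
  rw [intervalIntegral.integral_const_mul,
    intervalIntegral.integral_comp_mul_left (fun s => Real.sin s ^ 2) hL0.ne', integral_sin_sq]
  simp only [mul_zero, Real.sin_zero, sub_zero, smul_eq_mul, zero_mul, zero_sub]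
  set b := (L : ℝ) * (1 / (2 * N))
  have hcs : Real.sin b * Real.cos b ≤ 1 := by
    have := Real.abs_cos_le_one b
    have h2 := Real.abs_sin_le_one b
    have : |Real.sin b * Real.cos b| ≤ 1 := by
      rw [abs_mul]; exact mul_le_one₀ h2 (abs_nonneg _) this
    exact (abs_le.1 this).2
  have h1 : (L : ℝ)⁻¹ * ((-1 + b) / 2) ≤ (L : ℝ)⁻¹ * ((-(Real.sin b * Real.cos b) + b) / 2) := by
    gcongr
  have h2 : (L : ℝ)⁻¹ * ((-1 + b) / 2) = 1 / (4 * N) - 1 / (2 * L) := by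
    simp only [b]; field_simp; ring
  have h3 : 1 / (2 * (L : ℝ)) ≤ 1 / (8 * N) := one_div_le_one_div_of_le (by positivity) (by linarith)
  have h4 : 1 / (4 * (N : ℝ)) - 1 / (8 * N) = 1 / (8 * N) := by field_simp; norm_num
  have h5 : 1 / (512 * (N : ℝ)) = 1 / 64 * (1 / (8 * N)) := by field_simp; norm_num
  have h6 : 0 < 1 / (8 * (N : ℝ)) := by positivity
  rw [h5]
  refine mul_le_mul_of_nonneg_left ?_ (by norm_num)
  have h7 : -(Real.sin b * Real.cos b) + b = b - Real.sin b * Real.cos b := by ring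
  linarith

/-! ### The envelope -/

/-- Lattice points whose coordinates are at most `R` in absolute value. -/
def freqBox (d : ℕ) (R : ℕ) : Finset (Fin d → ℤ) :=
  Fintype.piFinset fun _ => Finset.Icc (-(R : ℤ)) R

theorem mem_freqBox {d R : ℕ} {k : Fin d → ℤ} : k ∈ freqBox d R ↔ ∀ j, |k j| ≤ R := by
  simp [freqBox, abs_le]

theorem card_freqBox (d R : ℕ) : (freqBox d R).card = (2 * R + 1) ^ d := by
  rw [freqBox, Fintype.card_piFinset]
  simp only [Int.card_Icc, Finset.prod_const, Finset.card_univ, Fintype.card_fin]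
  congr 1
  omega

open scoped Pointwise in
theorem freqBox_add_subset (d R R' : ℕ) : freqBox d R + freqBox d R' ⊆ freqBox d (R + R') := by
  intro k hk
  obtain ⟨a, ha, b, hb, rfl⟩ := Finset.mem_add.1 hk
  rw [mem_freqBox] at *
  intro j
  have := abs_add_le (a j) (b j)
  have h1 := ha j
  have h2 := hb j
  push_cast
  exact this.trans (add_le_add h1 h2)

theorem norm_le_sum_abs {d : ℕ} (v : Euc d) : ‖v‖ ≤ ∑ j, |v j| := by
  conv_lhs => rw [← Euc.sum_basisVec v]
  refine (norm_sum_le _ _).trans (Finset.sum_le_sum fun j _ => ?_)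
  rw [norm_smul, basisVec, PiLp.norm_single]
  simp

theorem norm_waveVec_le_of_mem_freqBox {d R : ℕ} {k : Fin d → ℤ} (h : k ∈ freqBox d R) :
    ‖waveVec k‖ ≤ d * R := by
  refine (norm_le_sum_abs _).trans ?_
  calc _ ≤ ∑ _j : Fin d, (R : ℝ) := Finset.sum_le_sum fun j _ => by
        have := mem_freqBox.1 h j
        simp only [waveVec]
        exact_mod_cast this
    _ = _ := by simp

theorem isTrig_cos {d : ℕ} {S : Finset (Fin d → ℤ)} {k : Fin d → ℤ} (hk : k ∈ S) (hk' : -k ∈ S) :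
    IsTrig S fun x => ((Real.cos (inner ℝ (waveVec k) x) : ℝ) : ℂ) := by
  have h := ((IsTrig.expo hk).add (IsTrig.expo hk')).const_mul (1 / 2)
  refine h.congr fun x => ?_
  rw [expo_neg, expo, Complex.ofReal_cos, Complex.cos, Complex.star_def, ← Complex.exp_conj]
  simp only [map_mul, Complex.conj_I, Complex.conj_ofReal]
  ring_nf

theorem isTrig_sin {d : ℕ} {S : Finset (Fin d → ℤ)} {k : Fin d → ℤ} (hk : k ∈ S) (hk' : -k ∈ S) :
    IsTrig S fun x => ((Real.sin (inner ℝ (waveVec k) x) : ℝ) : ℂ) := by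
  have h := ((IsTrig.expo hk').sub (IsTrig.expo hk)).const_mul (Complex.I / 2)
  refine h.congr fun x => ?_
  rw [expo_neg, expo, Complex.ofReal_sin, Complex.sin, Complex.star_def, ← Complex.exp_conj]
  simp only [map_mul, Complex.conj_I, Complex.conj_ofReal]
  ring_nf

theorem inner_waveVec_single {d : ℕ} (j : Fin d) (m : ℤ) (x : Euc d) :
    inner ℝ (waveVec (Pi.single j m)) x = (m : ℝ) * x j := by
  rw [inner_waveVec, Finset.sum_eq_single j]
  · simp
  · intro i _ hi; simp [hi]
  · simp

theorem isTrig_fejer {d : ℕ} (N : ℕ) (j : Fin d) :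
    IsTrig (freqBox d N) fun x => ((fejer N (x j) : ℝ) : ℂ) := by
  have hmem : ∀ m : ℤ, |m| ≤ N → (Pi.single j m : Fin d → ℤ) ∈ freqBox d N := by
    intro m hm
    rw [mem_freqBox]
    intro i
    by_cases h : i = j
    · subst h; simpa using hm
    · simp [h]
  have h : IsTrig (freqBox d N) fun x => (((N : ℝ) ^ 2)⁻¹ : ℂ) * ∑ k ∈ Finset.range N,
      ∑ l ∈ Finset.range N, ((Real.cos ((((k : ℤ) - (l : ℤ) : ℤ) : ℝ) * x j) : ℝ) : ℂ) := by
    refine (IsTrig.sum fun k hk => IsTrig.sum fun l hl => ?_).const_mul _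
    have hk' := Finset.mem_range.1 hk
    have hl' := Finset.mem_range.1 hl
    simp only [← inner_waveVec_single]
    refine isTrig_cos (hmem _ ?_) ?_
    · rw [abs_le]; constructor <;> omega
    · rw [← Pi.single_neg]
      exact hmem _ (by rw [abs_le]; constructor <;> omega)
  refine h.congr fun x => ?_
  rw [fejer_eq_sum_cos]
  push_cast
  rw [div_eq_inv_mul]

/-- The intensity profile of the envelope. -/
def profile {d : ℕ} (N : ℕ) (x : Euc d) : ℝ := ∏ j, fejer N (x j)

/-- The envelope, a trigonometric polynomial concentrated near the origin at scale `1 / N`. -/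
def envelope {d : ℕ} (N : ℕ) (x : Euc d) : ℝ := profile N x ^ 2

theorem isTrig_profile (d N : ℕ) :
    IsTrig (freqBox d (d * N)) fun x => ((profile N x : ℝ) : ℂ) := by
  have key : ∀ s : Finset (Fin d), IsTrig (freqBox d (s.card * N))
      fun x => ((∏ j ∈ s, fejer N (x j) : ℝ) : ℂ) := by
    intro s
    induction s using Finset.induction_on with
    | empty =>
      have : (0 : Fin d → ℤ) ∈ freqBox d ((∅ : Finset (Fin d)).card * N) := by
        rw [mem_freqBox]; simp
      exact (IsTrig.expo this).congr fun x => by simp [expo_zero]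
    | insert a s ha ih =>
      simp only [Finset.prod_insert ha, Complex.ofReal_mul]
      refine ((isTrig_fejer N a).mul ih).mono ((freqBox_add_subset _ _ _).trans ?_)
      rw [Finset.card_insert_of_notMem ha, add_mul, one_mul, add_comm]
  simpa [profile] using key Finset.univ

theorem isTrig_envelope (d N : ℕ) :
    IsTrig (freqBox d (2 * d * N)) fun x => ((envelope N x : ℝ) : ℂ) := by
  have h := ((isTrig_profile d N).mul (isTrig_profile d N)).mono (freqBox_add_subset _ _ _)
  rw [show d * N + d * N = 2 * d * N by ring] at h
  simpa [envelope, sq] using h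

theorem profile_nonneg {d : ℕ} (N : ℕ) (x : Euc d) : 0 ≤ profile N x :=
  Finset.prod_nonneg fun _ _ => fejer_nonneg N _

theorem profile_le_one {d : ℕ} (N : ℕ) (x : Euc d) : profile N x ≤ 1 :=
  Finset.prod_le_one (fun _ _ => fejer_nonneg N _) fun _ _ => fejer_le_one N _

theorem abs_partialD_profile_le {d : ℕ} {N : ℕ} (hN : 0 < N) (i : Fin d) (x : Euc d) :
    |partialD i (profile N) x| ≤ N := by
  have hf : ∀ j ∈ (Finset.univ : Finset (Fin d)), HasFDerivAt (fun x : Euc d => fejer N (x j))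
      ((deriv (fejer N) (x j)) • (EuclideanSpace.proj (𝕜 := ℝ) j : Euc d →L[ℝ] ℝ)) x := by
    intro j _
    have h1 : HasDerivAt (fejer N) (deriv (fejer N) (x j)) (x j) :=
      ((contDiff_fejer N).differentiable (by simp) _).hasDerivAt
    exact h1.comp_hasFDerivAt x (EuclideanSpace.proj (𝕜 := ℝ) j : Euc d →L[ℝ] ℝ).hasFDerivAt
  have h := HasFDerivAt.finsetProd hf
  have h2 : HasFDerivAt (profile N) _ x := h
  rw [partialD, h2.fderiv, sum_apply, Finset.sum_eq_single i]
  · obtain ⟨f', hf', hle⟩ := exists_hasDerivAt_fejer hN (x i)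
    rw [hf'.deriv]
    simp only [smul_apply, smul_eq_mul]
    have : (EuclideanSpace.proj (𝕜 := ℝ) i) (basisVec i) = (1 : ℝ) := by simp [basisVec]
    rw [this, mul_one, abs_mul, abs_of_nonneg (Finset.prod_nonneg fun _ _ => fejer_nonneg N _)]
    calc _ ≤ 1 * (N : ℝ) := mul_le_mul
          (Finset.prod_le_one (fun _ _ => fejer_nonneg N _) fun _ _ => fejer_le_one N _) hle
          (abs_nonneg _) zero_le_one
      _ = N := one_mul _
  · intro j _ hj
    simp [basisVec, hj]
  · simp

theorem envelope_nonneg {d : ℕ} (N : ℕ) (x : Euc d) : 0 ≤ envelope N x := sq_nonneg _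

theorem envelope_le_profile {d : ℕ} (N : ℕ) (x : Euc d) : envelope N x ≤ profile N x := by
  rw [envelope, sq]
  exact mul_le_of_le_one_left (profile_nonneg N x) (profile_le_one N x)

theorem contDiff_profile (d N : ℕ) : ContDiff ℝ ∞ (profile N : Euc d → ℝ) :=
  (isTrig_profile d N).contDiff_real

/-- This is why the envelope is the square of the profile: its derivative keeps one factor
`profile`, so that it is as concentrated as the envelope and its integral is under control. -/
theorem abs_partialD_envelope_le {d : ℕ} {N : ℕ} (hN : 0 < N) (i : Fin d) (x : Euc d) :
    |partialD i (envelope N) x| ≤ 2 * N * profile N x := by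
  have h : partialD i (envelope N) x = 2 * profile N x * partialD i (profile N) x := by
    have h1 := ((contDiff_profile d N).differentiable (by simp) x).hasFDerivAt.pow 2
    have h2 : HasFDerivAt (envelope N) _ x := h1
    rw [partialD, h2.fderiv]
    simp [partialD]
  rw [h, abs_mul, abs_of_nonneg (mul_nonneg zero_le_two (profile_nonneg N x))]
  calc _ ≤ 2 * profile N x * N := mul_le_mul_of_nonneg_left (abs_partialD_profile_le hN i x)
        (mul_nonneg zero_le_two (profile_nonneg N x))
    _ = _ := by ring

theorem integral_profile {d N : ℕ} (hN : 0 < N) :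
    ∫ x, profile N x ∂(torusMeasure d) = (2 * Real.pi / N) ^ d := by
  simp only [profile]
  rw [integral_torus_prod fun _ => fejer N]
  simp [integral_fejer hN, div_pow]

/-! ### Divergence-free fields from stream functions -/

theorem partialD_comm {d : ℕ} {F : Type*} [NormedAddCommGroup F] [NormedSpace ℝ F]
    {φ : Euc d → F} (h : ContDiff ℝ ∞ φ) (p q : Fin d) (x : Euc d) :
    partialD p (partialD q φ) x = partialD q (partialD p φ) x := by
  have h1 : DifferentiableAt ℝ (fderiv ℝ φ) x :=
    (h.fderiv_right (m := ∞) (by simp)).differentiable (by simp) x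
  have e : ∀ p q : Fin d, partialD p (partialD q φ) x =
      fderiv ℝ (fderiv ℝ φ) x (basisVec p) (basisVec q) := by
    intro p q
    have := fderiv_clm_apply h1 (differentiableAt_const (basisVec q))
    have e : partialD p (partialD q φ) x = _ := congrArg (fun A => A (basisVec p)) this
    rw [e]
    simp
  rw [e, e]
  exact (h.contDiffAt.isSymmSndFDerivAt (by
    rw [minSmoothness_of_isRCLikeNormedField]; exact ENat.LEInfty.out)) _ _

theorem partialD_add {d : ℕ} {F : Type*} [NormedAddCommGroup F] [NormedSpace ℝ F]
    {v w : Euc d → F} (hv : Differentiable ℝ v) (hw : Differentiable ℝ w) (j : Fin d) (x : Euc d) :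
    partialD j (fun y => v y + w y) x = partialD j v x + partialD j w x := by
  rw [partialD, fderiv_fun_add (hv x) (hw x)]; rfl

theorem partialD_smul_const {d : ℕ} {F : Type*} [NormedAddCommGroup F] [NormedSpace ℝ F]
    {a : Euc d → ℝ} (ha : Differentiable ℝ a) (z : F) (j : Fin d) (x : Euc d) :
    partialD j (fun y => a y • z) x = partialD j a x • z := by
  rw [partialD, fderiv_smul_const (ha x)]; rfl

theorem partialD_mul {d : ℕ} {a b : Euc d → ℝ} (ha : Differentiable ℝ a)
    (hb : Differentiable ℝ b) (j : Fin d) (x : Euc d) :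
    partialD j (fun y => a y * b y) x = a x * partialD j b x + b x * partialD j a x := by
  rw [partialD, fderiv_fun_mul (ha x) (hb x)]; rfl

theorem partialD_const_mul {d : ℕ} {a : Euc d → ℝ} (ha : Differentiable ℝ a) (c : ℝ)
    (j : Fin d) (x : Euc d) : partialD j (fun y => c * a y) x = c * partialD j a x := by
  rw [partialD, fderiv_const_mul (ha x)]; rfl

/-- The divergence-free field with stream function `φ` in the plane of directions `p, q`. -/
def curlField {d : ℕ} (p q : Fin d) (φ : Euc d → ℝ) (x : Euc d) : Euc d :=
  partialD p φ x • basisVec q + (-partialD q φ x) • basisVec p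

/-- A potential of which `curlField p q φ` is the divergence. -/
def curlPotential {d : ℕ} (p q : Fin d) (φ : Euc d → ℝ) (j : Fin d) (x : Euc d) : Euc d :=
  φ x • ((if j = p then basisVec q else 0) - (if j = q then basisVec p else 0))

theorem basisVec_apply {d : ℕ} (i j : Fin d) : basisVec i j = if j = i then (1 : ℝ) else 0 := by
  simp [basisVec]

theorem norm_basisVec {d : ℕ} (j : Fin d) : ‖(basisVec j : Euc d)‖ = 1 := by
  rw [basisVec, PiLp.norm_single]; simp

theorem contDiff_curlField {d : ℕ} {p q : Fin d} {φ : Euc d → ℝ} (h : ContDiff ℝ ∞ φ) :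
    ContDiff ℝ ∞ (curlField p q φ) :=
  ((h.partialD p).smul contDiff_const).add ((h.partialD q).neg.smul contDiff_const)

theorem divergence_add {d : ℕ} {v w : Euc d → Euc d} (hv : Differentiable ℝ v)
    (hw : Differentiable ℝ w) (x : Euc d) :
    divergence (fun y => v y + w y) x = divergence v x + divergence w x := by
  simp only [divergence, fderiv_fun_add (hv x) (hw x), ← Finset.sum_add_distrib]
  rfl

theorem divergence_smul_basisVec {d : ℕ} {a : Euc d → ℝ} (ha : Differentiable ℝ a) (q : Fin d)
    (x : Euc d) : divergence (fun y => a y • basisVec q) x = partialD q a x := by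
  have h : ∀ j, fderiv ℝ (fun y => a y • (basisVec q : Euc d)) x (basisVec j) =
    partialD j a x • basisVec q := fun j => partialD_smul_const ha _ j x
  simp only [divergence, h, PiLp.smul_apply, basisVec_apply, smul_eq_mul, mul_ite, mul_one,
    mul_zero]
  simp

theorem divergence_curlField {d : ℕ} {p q : Fin d} {φ : Euc d → ℝ} (h : ContDiff ℝ ∞ φ)
    (x : Euc d) : divergence (curlField p q φ) x = 0 := by
  have hp := (h.partialD p).differentiable (by simp)
  have hq := (h.partialD q).differentiable (by simp)
  have e := divergence_add (v := fun x => partialD p φ x • basisVec q)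
    (w := fun x => (-partialD q φ x) • basisVec p) (hp.smul_const _) (hq.neg.smul_const _) x
  rw [show curlField p q φ = fun x => partialD p φ x • basisVec q +
    (-partialD q φ x) • basisVec p from rfl, e, divergence_smul_basisVec hp,
    divergence_smul_basisVec (a := fun x => -partialD q φ x) hq.neg]
  have : partialD p (fun x => -partialD q φ x) x = -partialD p (partialD q φ) x := by
    rw [partialD, fderiv_fun_neg]; rfl
  rw [this, partialD_comm h p q]
  ring

theorem isTrig_const_of_zero_mem {d : ℕ} {S : Finset (Fin d → ℤ)} (h : 0 ∈ S) (c : ℂ) :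
    IsTrig S fun _ => c :=
  ((IsTrig.expo h).const_mul c).congr fun x => by simp [expo_zero]

theorem trigField_smul_const {d : ℕ} {S : Finset (Fin d → ℤ)} {a : Euc d → ℝ}
    (h : IsTrig S fun x => (a x : ℂ)) (z : Euc d) : TrigField S fun x => a x • z := fun i =>
  (h.const_mul (z i : ℂ)).congr fun x => by simp [mul_comm]

theorem trigField_curlField {d : ℕ} {p q : Fin d} {φ : Euc d → ℝ} {S : Finset (Fin d → ℤ)}
    (h : IsTrig S fun x => (φ x : ℂ)) : TrigField S (curlField p q φ) := by
  refine (trigField_smul_const (h.partialD_real p) _).add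
    (trigField_smul_const (a := fun x => -partialD q φ x) ?_ _)
  exact (h.partialD_real q).neg.congr fun x => by simp

theorem trigField_curlPotential {d : ℕ} {p q : Fin d} {φ : Euc d → ℝ} {S : Finset (Fin d → ℤ)}
    (h : IsTrig S fun x => (φ x : ℂ)) (j : Fin d) : TrigField S (curlPotential p q φ j) :=
  trigField_smul_const h _

/-- The potential has the size of the stream function, smaller than the field by one power of the
frequency. This is the gain in `H^{-1}` for the time derivative in the force. -/
theorem curlField_eq_sum {d : ℕ} {p q : Fin d} {φ : Euc d → ℝ} (h : Differentiable ℝ φ)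
    (x : Euc d) : curlField p q φ x = ∑ j, partialD j (curlPotential p q φ j) x := by
  have e : ∀ j, partialD j (curlPotential p q φ j) x =
      (if j = p then partialD j φ x • basisVec q else 0) -
        (if j = q then partialD j φ x • basisVec p else 0) := by
    intro j
    have := partialD_smul_const h
      ((if j = p then basisVec q else 0) - (if j = q then basisVec p else 0) : Euc d) j x
    rw [show curlPotential p q φ j = _ from rfl]
    refine this.trans ?_
    rw [smul_sub, smul_ite, smul_ite, smul_zero]
  simp only [e, Finset.sum_sub_distrib, Finset.sum_ite_eq', Finset.mem_univ, if_true]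
  rw [curlField, neg_smul, sub_eq_add_neg]

theorem norm_curlPotential_le {d : ℕ} (p q : Fin d) (φ : Euc d → ℝ) (j : Fin d) (x : Euc d) :
    ‖curlPotential p q φ j x‖ ≤ 2 * |φ x| := by
  rw [curlPotential, norm_smul, Real.norm_eq_abs, mul_comm]
  refine mul_le_mul_of_nonneg_right ?_ (abs_nonneg _)
  refine (norm_sub_le _ _).trans ?_
  have : ∀ (P : Prop) [Decidable P] (i : Fin d), ‖(if P then basisVec i else 0 : Euc d)‖ ≤ 1 := by
    intro P _ i
    split_ifs
    · rw [norm_basisVec]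
    · simp
  linarith [this (j = p) q, this (j = q) p]

theorem norm_curlField_le {d : ℕ} (p q : Fin d) (φ : Euc d → ℝ) (x : Euc d) :
    ‖curlField p q φ x‖ ≤ |partialD p φ x| + |partialD q φ x| := by
  refine (norm_add_le _ _).trans ?_
  simp [norm_smul, norm_basisVec]

/-! ### The two stream functions -/

/-- The stream function of the low-frequency field. -/
def streamLow {d : ℕ} (N L : ℕ) (i₁ : Fin d) (x : Euc d) : ℝ :=
  (L : ℝ)⁻¹ * (envelope N x * Real.sin (L * x i₁))

/-- The stream function of the high-frequency field. -/
def streamHigh {d : ℕ} (N L L' : ℕ) (i₀ i₁ : Fin d) (x : Euc d) : ℝ :=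
  (L' : ℝ)⁻¹ * (envelope N x * (Real.sin (L' * x i₀) * (1 + Real.sin (L * x i₁))))

open scoped Pointwise in
/-- The frequencies of the low-frequency field. -/
def freqLow (d N L : ℕ) (i₁ : Fin d) : Finset (Fin d → ℤ) :=
  freqBox d (2 * d * N) + {Pi.single i₁ (L : ℤ), -Pi.single i₁ (L : ℤ)}

open scoped Pointwise in
/-- The frequencies of the high-frequency field. -/
def freqHigh (d N L L' : ℕ) (i₀ i₁ : Fin d) : Finset (Fin d → ℤ) :=
  freqBox d (2 * d * N) + ({Pi.single i₀ (L' : ℤ), -Pi.single i₀ (L' : ℤ)} +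
    {0, Pi.single i₁ (L : ℤ), -Pi.single i₁ (L : ℤ)})

theorem isTrig_sin_coord {d : ℕ} {S : Finset (Fin d → ℤ)} {L : ℕ} {i : Fin d}
    (h : Pi.single i (L : ℤ) ∈ S) (h' : -Pi.single i (L : ℤ) ∈ S) :
    IsTrig S fun x => ((Real.sin (L * x i) : ℝ) : ℂ) :=
  (isTrig_sin h h').congr fun x => by rw [inner_waveVec_single]; simp

theorem isTrig_streamLow (d N L : ℕ) (i₁ : Fin d) :
    IsTrig (freqLow d N L i₁) fun x => ((streamLow N L i₁ x : ℝ) : ℂ) := by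
  have h := ((isTrig_envelope d N).mul (isTrig_sin_coord (L := L) (i := i₁)
    (S := {Pi.single i₁ (L : ℤ), -Pi.single i₁ (L : ℤ)}) (by simp) (by simp))).const_mul (L : ℂ)⁻¹
  exact h.congr fun x => by simp [streamLow]

theorem isTrig_streamHigh (d N L L' : ℕ) (i₀ i₁ : Fin d) :
    IsTrig (freqHigh d N L L' i₀ i₁) fun x => ((streamHigh N L L' i₀ i₁ x : ℝ) : ℂ) := by
  have h1 : IsTrig ({0, Pi.single i₁ (L : ℤ), -Pi.single i₁ (L : ℤ)} : Finset (Fin d → ℤ))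
      fun x => ((1 + Real.sin (L * x i₁) : ℝ) : ℂ) :=
    ((isTrig_const_of_zero_mem (by simp) 1).add (isTrig_sin_coord (L := L) (i := i₁)
      (by simp) (by simp))).congr fun x => by simp
  have h := ((isTrig_envelope d N).mul ((isTrig_sin_coord (L := L') (i := i₀)
    (S := {Pi.single i₀ (L' : ℤ), -Pi.single i₀ (L' : ℤ)}) (by simp) (by simp)).mul
    h1)).const_mul (L' : ℂ)⁻¹
  exact h.congr fun x => by simp [streamHigh]

/-- The spectrum consists of translates of the box of the envelope, so the count depends on `N` and
not on the frequency `L`. -/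
theorem card_freqLow_le (d N L : ℕ) (i₁ : Fin d) :
    (freqLow d N L i₁).card ≤ (4 * d * N + 1) ^ d * 2 := by
  refine Finset.card_add_le.trans ?_
  rw [card_freqBox, show 2 * (2 * d * N) = 4 * d * N by ring]
  exact Nat.mul_le_mul_left _ Finset.card_le_two

theorem card_freqHigh_le (d N L L' : ℕ) (i₀ i₁ : Fin d) :
    (freqHigh d N L L' i₀ i₁).card ≤ (4 * d * N + 1) ^ d * 6 := by
  refine Finset.card_add_le.trans ?_
  rw [card_freqBox, show 2 * (2 * d * N) = 4 * d * N by ring]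
  refine Nat.mul_le_mul_left _ (Finset.card_add_le.trans ?_)
  exact Nat.mul_le_mul Finset.card_le_two Finset.card_le_three

theorem norm_waveVec_single {d : ℕ} (i : Fin d) (L : ℕ) :
    ‖waveVec (Pi.single i (L : ℤ))‖ = L := by
  rw [← sq_eq_sq₀ (norm_nonneg _) (Nat.cast_nonneg _), norm_sq_waveVec,
    Finset.sum_eq_single i (fun j _ hj => by simp [hj]) (by simp)]
  simp

/-- The box of the envelope is translated by `± L` along one axis. The bound for the single
coordinate serves the coordinatewise decay of the coefficients of test functions. -/
theorem freqLow_bounds {d N L : ℕ} {i₁ : Fin d} {k : Fin d → ℤ} (hk : k ∈ freqLow d N L i₁) :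
    ‖waveVec k‖ ≤ L + 2 * d ^ 2 * N ∧ (L : ℝ) - 2 * d ^ 2 * N ≤ ‖waveVec k‖ ∧
      (L : ℝ) - 2 * d * N ≤ |(k i₁ : ℝ)| := by
  obtain ⟨b, hb, c, hc, rfl⟩ := Finset.mem_add.1 hk
  have h1 := norm_waveVec_le_of_mem_freqBox hb
  push_cast at h1
  have h1' : ‖waveVec b‖ ≤ 2 * (d : ℝ) ^ 2 * N := h1.trans (le_of_eq (by ring))
  have h2 : ‖waveVec c‖ = L ∧ |(c i₁ : ℝ)| = L := by
    rcases Finset.mem_insert.1 hc with rfl | hc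
    · exact ⟨norm_waveVec_single _ _, by simp⟩
    · rw [Finset.mem_singleton.1 hc, waveVec_neg, norm_neg]
      exact ⟨norm_waveVec_single _ _, by simp⟩
  have h3 : |(b i₁ : ℝ)| ≤ 2 * d * N := by
    have := mem_freqBox.1 hb i₁
    exact_mod_cast this
  rw [waveVec_add]
  refine ⟨(norm_add_le _ _).trans (by linarith [h2.1]), ?_, ?_⟩
  · have := norm_sub_le (waveVec b + waveVec c) (waveVec b)
    rw [add_sub_cancel_left] at this
    linarith [h2.1]
  · rw [Pi.add_apply, Int.cast_add]
    have := abs_sub ((b i₁ : ℝ) + c i₁) (b i₁)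
    rw [add_sub_cancel_left] at this
    linarith [h2.2]

/-- The slow modulation moves the frequencies along the axis `i₁` only and leaves the coordinate
`i₀` as it is. -/
theorem freqHigh_bounds {d N L L' : ℕ} {i₀ i₁ : Fin d} (h01 : i₀ ≠ i₁) {k : Fin d → ℤ}
    (hk : k ∈ freqHigh d N L L' i₀ i₁) :
    ‖waveVec k‖ ≤ L' + L + 2 * d ^ 2 * N ∧ (L' : ℝ) - L - 2 * d ^ 2 * N ≤ ‖waveVec k‖ ∧
      (L' : ℝ) - 2 * d * N ≤ |(k i₀ : ℝ)| := by
  obtain ⟨b, hb, c', hc', rfl⟩ := Finset.mem_add.1 hk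
  obtain ⟨c, hc, e, he, rfl⟩ := Finset.mem_add.1 hc'
  have h1 := norm_waveVec_le_of_mem_freqBox hb
  push_cast at h1
  have h1' : ‖waveVec b‖ ≤ 2 * (d : ℝ) ^ 2 * N := h1.trans (le_of_eq (by ring))
  have h2 : ‖waveVec c‖ = L' ∧ |(c i₀ : ℝ)| = L' := by
    rcases Finset.mem_insert.1 hc with rfl | hc
    · exact ⟨norm_waveVec_single _ _, by simp⟩
    · rw [Finset.mem_singleton.1 hc, waveVec_neg, norm_neg]
      exact ⟨norm_waveVec_single _ _, by simp⟩
  have h4 : ‖waveVec e‖ ≤ L ∧ e i₀ = 0 := by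
    rcases Finset.mem_insert.1 he with rfl | he
    · exact ⟨by
        have : waveVec (0 : Fin d → ℤ) = 0 := by ext j; simp [waveVec]
        rw [this, norm_zero]; exact Nat.cast_nonneg L, rfl⟩
    rcases Finset.mem_insert.1 he with rfl | he
    · exact ⟨(norm_waveVec_single _ _).le, by simp [h01]⟩
    · rw [Finset.mem_singleton.1 he, waveVec_neg, norm_neg]
      exact ⟨(norm_waveVec_single _ _).le, by simp [h01]⟩
  have h3 : |(b i₀ : ℝ)| ≤ 2 * d * N := by
    have := mem_freqBox.1 hb i₀
    exact_mod_cast this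
  rw [waveVec_add, waveVec_add]
  refine ⟨?_, ?_, ?_⟩
  · have := norm_add_le (waveVec b) (waveVec c + waveVec e)
    have := norm_add_le (waveVec c) (waveVec e)
    linarith [h2.1]
  · have a1 := norm_sub_le (waveVec b + (waveVec c + waveVec e)) (waveVec b + waveVec e)
    have a2 := norm_add_le (waveVec b) (waveVec e)
    rw [show waveVec b + (waveVec c + waveVec e) - (waveVec b + waveVec e) = waveVec c by abel] at a1
    linarith [h2.1]
  · rw [Pi.add_apply, Pi.add_apply, h4.2, add_zero, Int.cast_add]
    have := abs_sub ((b i₀ : ℝ) + c i₀) (b i₀)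
    rw [add_sub_cancel_left] at this
    linarith [h2.2]

/-! ### Derivatives of the stream functions and pointwise bounds of the two fields. -/

theorem hasFDerivAt_coord {d : ℕ} (i : Fin d) (x : Euc d) :
    HasFDerivAt (fun y : Euc d => y i) (EuclideanSpace.proj (𝕜 := ℝ) i : Euc d →L[ℝ] ℝ) x :=
  (EuclideanSpace.proj (𝕜 := ℝ) i : Euc d →L[ℝ] ℝ).hasFDerivAt

theorem partialD_sin_coord {d : ℕ} (L : ℝ) (i j : Fin d) (x : Euc d) :
    partialD j (fun y : Euc d => Real.sin (L * y i)) x =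
      if j = i then L * Real.cos (L * x i) else 0 := by
  have h := ((hasFDerivAt_coord i x).const_mul L).sin
  rw [partialD, h.fderiv]
  by_cases hj : j = i
  · subst hj; simp [basisVec]; ring
  · simp [basisVec, hj, Ne.symm hj]

theorem partialD_cos_coord {d : ℕ} (L : ℝ) (i j : Fin d) (x : Euc d) :
    partialD j (fun y : Euc d => Real.cos (L * y i)) x =
      if j = i then -(L * Real.sin (L * x i)) else 0 := by
  have h := ((hasFDerivAt_coord i x).const_mul L).cos
  rw [partialD, h.fderiv]
  by_cases hj : j = i
  · subst hj; simp [basisVec]; ring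
  · simp [basisVec, hj, Ne.symm hj]

theorem differentiable_sin_coord {d : ℕ} (L : ℝ) (i : Fin d) :
    Differentiable ℝ fun y : Euc d => Real.sin (L * y i) := by fun_prop

theorem differentiable_envelope (d N : ℕ) : Differentiable ℝ (envelope N : Euc d → ℝ) :=
  (isTrig_envelope d N).contDiff_real.differentiable (by simp)

/-- A derivative that falls on the sine cancels the factor `1 / L`; one that falls on the envelope
leaves an error of relative size `N / L`. -/
theorem partialD_streamLow {d : ℕ} (N : ℕ) {L : ℕ} (hL : 0 < L) (i₁ j : Fin d) (x : Euc d) :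
    partialD j (streamLow N L i₁) x =
      (if j = i₁ then envelope N x * Real.cos (L * x i₁) else 0) +
        (L : ℝ)⁻¹ * (Real.sin (L * x i₁) * partialD j (envelope N) x) := by
  have hL' : (L : ℝ) ≠ 0 := by positivity
  have hs := differentiable_sin_coord (d := d) L i₁
  have ha := differentiable_envelope d N
  rw [show streamLow N L i₁ = fun x : Euc d => (L : ℝ)⁻¹ * (envelope N x * Real.sin (L * x i₁))
    from rfl, partialD_const_mul (ha.fun_mul hs), partialD_mul ha hs, partialD_sin_coord]
  split_ifs
  · field_simp
  · ring

theorem partialD_streamHigh {d : ℕ} (N L : ℕ) {L' : ℕ} (hL' : 0 < L') {i₀ i₁ : Fin d}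
    (j : Fin d) (x : Euc d) :
    partialD j (streamHigh N L L' i₀ i₁) x =
      (if j = i₀ then envelope N x * (Real.cos (L' * x i₀) * (1 + Real.sin (L * x i₁))) else 0) +
      (L' : ℝ)⁻¹ * ((if j = i₁ then
          envelope N x * (Real.sin (L' * x i₀) * (L * Real.cos (L * x i₁))) else 0) +
        Real.sin (L' * x i₀) * (1 + Real.sin (L * x i₁)) * partialD j (envelope N) x) := by
  have hL0 : (L' : ℝ) ≠ 0 := by positivity
  have hs := differentiable_sin_coord (d := d) L i₁
  have hs' := differentiable_sin_coord (d := d) L' i₀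
  have ha := differentiable_envelope d N
  have hs1 : Differentiable ℝ fun y : Euc d => 1 + Real.sin (L * y i₁) := hs.const_add 1
  have e1 : partialD j (fun y : Euc d => 1 + Real.sin (L * y i₁)) x =
      if j = i₁ then L * Real.cos (L * x i₁) else 0 := by
    rw [← partialD_sin_coord, partialD, partialD, fderiv_const_add]
  rw [show streamHigh N L L' i₀ i₁ = fun x : Euc d => (L' : ℝ)⁻¹ *
    (envelope N x * (Real.sin (L' * x i₀) * (1 + Real.sin (L * x i₁)))) from rfl,
    partialD_const_mul (ha.fun_mul (hs'.fun_mul hs1)), partialD_mul ha (hs'.fun_mul hs1),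
    partialD_mul hs' hs1, e1, partialD_sin_coord]
  split_ifs <;> field_simp <;> ring

/-- The low-frequency field. -/
def fieldLow {d : ℕ} (N L : ℕ) (i₁ i₂ : Fin d) : Euc d → Euc d :=
  curlField i₁ i₂ (streamLow N L i₁)

/-- The high-frequency field. -/
def fieldHigh {d : ℕ} (N L L' : ℕ) (i₀ i₁ i₂ : Fin d) (x : Euc d) : Euc d :=
  curlField i₀ i₁ (streamHigh N L L' i₀ i₁) x + curlField i₀ i₂ (streamHigh N L L' i₀ i₁) x

theorem trigField_fieldLow {d : ℕ} (N L : ℕ) (i₁ i₂ : Fin d) :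
    TrigField (freqLow d N L i₁) (fieldLow N L i₁ i₂) :=
  trigField_curlField (isTrig_streamLow d N L i₁)

theorem trigField_fieldHigh {d : ℕ} (N L L' : ℕ) (i₀ i₁ i₂ : Fin d) :
    TrigField (freqHigh d N L L' i₀ i₁) (fieldHigh N L L' i₀ i₁ i₂) :=
  (trigField_curlField (isTrig_streamHigh d N L L' i₀ i₁)).add
    (trigField_curlField (isTrig_streamHigh d N L L' i₀ i₁))

theorem divergence_fieldLow {d : ℕ} (N L : ℕ) (i₁ i₂ : Fin d) (x : Euc d) :
    divergence (fieldLow N L i₁ i₂) x = 0 :=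
  divergence_curlField (isTrig_streamLow d N L i₁).contDiff_real x

theorem divergence_fieldHigh {d : ℕ} (N L L' : ℕ) (i₀ i₁ i₂ : Fin d) (x : Euc d) :
    divergence (fieldHigh N L L' i₀ i₁ i₂) x = 0 := by
  have h := (isTrig_streamHigh d N L L' i₀ i₁).contDiff_real
  have := divergence_add ((contDiff_curlField (p := i₀) (q := i₁) h).differentiable (by simp))
    ((contDiff_curlField (p := i₀) (q := i₂) h).differentiable (by simp)) x
  rw [divergence_curlField h, divergence_curlField h, add_zero] at this
  exact this

theorem abs_sin_mul_le {s t c A : ℝ} (hA : |t| ≤ A) (hs : |s| ≤ c) : |s * t| ≤ c * A := by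
  rw [abs_mul]
  exact mul_le_mul hs hA (abs_nonneg _) ((abs_nonneg _).trans hs)

theorem abs_one_add_sin_le (s : ℝ) : |1 + Real.sin s| ≤ 2 := by
  rw [abs_le]
  constructor <;> linarith [Real.neg_one_le_sin s, Real.sin_le_one s]

theorem abs_inv_mul_sin_le {d N L : ℕ} (hN : 0 < N) (hL : 0 < L) (i j : Fin d) (x : Euc d) :
    |(L : ℝ)⁻¹ * (Real.sin (L * x i) * partialD j (envelope N) x)| ≤
      2 * N / L * profile N x := by
  have hL' : (0 : ℝ) < L := by exact_mod_cast hL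
  rw [abs_mul, abs_of_pos (by positivity : (0 : ℝ) < (L : ℝ)⁻¹)]
  calc _ ≤ (L : ℝ)⁻¹ * (1 * (2 * N * profile N x)) := mul_le_mul_of_nonneg_left
        (abs_sin_mul_le (abs_partialD_envelope_le hN j x) (Real.abs_sin_le_one _)) (by positivity)
    _ = _ := by field_simp

theorem abs_inv_mul_sin_mul_le {d N L L' : ℕ} (hN : 0 < N) (hL : 0 < L') (i i₁ j : Fin d)
    (x : Euc d) :
    |(L' : ℝ)⁻¹ * (Real.sin (L' * x i) * (1 + Real.sin (L * x i₁)) *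
      partialD j (envelope N) x)| ≤ 4 * N / L' * profile N x := by
  have hL' : (0 : ℝ) < L' := by exact_mod_cast hL
  rw [abs_mul, abs_of_pos (by positivity : (0 : ℝ) < (L' : ℝ)⁻¹)]
  calc _ ≤ (L' : ℝ)⁻¹ * ((1 * 2) * (2 * N * profile N x)) := mul_le_mul_of_nonneg_left
        (abs_sin_mul_le (abs_partialD_envelope_le hN j x)
          (abs_sin_mul_le (abs_one_add_sin_le _) (Real.abs_sin_le_one _))) (by positivity)
    _ = _ := by field_simp; ring

theorem ratio_mul_le {N L : ℕ} {c : ℝ} (hL : 0 < L) (h : c * N ≤ L) {H : ℝ} (hH : 0 ≤ H) :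
    c * N / L * H ≤ H := by
  have hL' : (0 : ℝ) < L := by exact_mod_cast hL
  exact mul_le_of_le_one_left hH ((div_le_one hL').2 h)

theorem norm_fieldLow_le {d N L : ℕ} (hN : 0 < N) (hL : 4 * N ≤ L) {i₁ i₂ : Fin d}
    (h12 : i₁ ≠ i₂) (x : Euc d) : ‖fieldLow N L i₁ i₂ x‖ ≤ 3 * profile N x := by
  have hL0 : 0 < L := by omega
  have hLR : 4 * (N : ℝ) ≤ L := by exact_mod_cast hL
  have hNR : (0 : ℝ) < N := by exact_mod_cast hN
  have hH := profile_nonneg N x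
  have hr := ratio_mul_le (c := 2) (N := N) hL0 (by linarith) hH
  refine (norm_curlField_le _ _ _ _).trans ?_
  rw [partialD_streamLow N hL0, partialD_streamLow N hL0, if_pos rfl, if_neg h12.symm, zero_add]
  have h1 := abs_inv_mul_sin_le hN hL0 i₁ i₁ x
  have h2 := abs_inv_mul_sin_le hN hL0 i₁ i₂ x
  have h3 : |envelope N x * Real.cos (L * x i₁)| ≤ profile N x := by
    rw [mul_comm]
    have := abs_sin_mul_le (s := Real.cos (L * x i₁)) (c := 1) (t := envelope N x)
      (A := profile N x) (by rw [abs_of_nonneg (envelope_nonneg N x)]; exact envelope_le_profile N x)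
      (Real.abs_cos_le_one _)
    linarith
  have h4 := abs_add_le (envelope N x * Real.cos (L * x i₁))
    ((L : ℝ)⁻¹ * (Real.sin (L * x i₁) * partialD i₁ (envelope N) x))
  linarith

theorem abs_envelope_mul_le {d N : ℕ} (x : Euc d) {s c : ℝ} (hs : |s| ≤ c) :
    |envelope N x * s| ≤ c * profile N x := by
  rw [mul_comm]
  exact abs_sin_mul_le (by
    rw [abs_of_nonneg (envelope_nonneg N x)]; exact envelope_le_profile N x) hs

/-- The fast sine contributes 2, the slow one `L / L' ≤ 1` and the envelope `4 N / L' ≤ 1`, each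
times the profile; the third is present in all directions. -/
theorem abs_partialD_streamHigh_le {d N L L' : ℕ} (hN : 0 < N) (hL : 4 * N ≤ L) (hLL : L ≤ L')
    {i₀ i₁ : Fin d} (h01 : i₀ ≠ i₁) (j : Fin d) (x : Euc d) :
    |partialD j (streamHigh N L L' i₀ i₁) x| ≤
      (if j = i₀ then 3 else if j = i₁ then 2 else 1) * profile N x := by
  have hL0 : 0 < L' := by omega
  have hLR : 4 * (N : ℝ) ≤ L' := by exact_mod_cast hL.trans hLL
  have hLL' : (L : ℝ) ≤ L' := by exact_mod_cast hLL
  have hL0' : (0 : ℝ) < L' := by exact_mod_cast hL0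
  have hH := profile_nonneg N x
  have hr := ratio_mul_le (c := 4) hL0 hLR hH
  have h1 := abs_inv_mul_sin_mul_le (L := L) hN hL0 i₀ i₁ j x
  rw [partialD_streamHigh N L hL0, mul_add (L' : ℝ)⁻¹]
  have h2 : |envelope N x * (Real.cos (L' * x i₀) * (1 + Real.sin (L * x i₁)))| ≤
      2 * profile N x := abs_envelope_mul_le x (by
    have := abs_sin_mul_le (abs_one_add_sin_le (L * x i₁)) (Real.abs_cos_le_one (L' * x i₀))
    linarith)
  have h3 : |(L' : ℝ)⁻¹ * (envelope N x * (Real.sin (L' * x i₀) * (L * Real.cos (L * x i₁))))| ≤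
      profile N x := by
    rw [show (L' : ℝ)⁻¹ * (envelope N x * (Real.sin (L' * x i₀) * (L * Real.cos (L * x i₁)))) =
      envelope N x * (L / L' * (Real.sin (L' * x i₀) * Real.cos (L * x i₁))) by ring]
    have h5 := abs_sin_mul_le (Real.abs_cos_le_one (L * x i₁)) (Real.abs_sin_le_one (L' * x i₀))
    have h4 : |(L : ℝ) / L' * (Real.sin (L' * x i₀) * Real.cos (L * x i₁))| ≤ 1 * (1 * 1) :=
      abs_sin_mul_le h5 (by
        rw [abs_of_nonneg (by positivity)]; exact (div_le_one hL0').2 hLL')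
    have := abs_envelope_mul_le (N := N) x h4
    linarith
  by_cases hj0 : j = i₀
  · have hj1 : j ≠ i₁ := hj0 ▸ h01
    rw [if_pos hj0, if_pos hj0, if_neg hj1, mul_zero, zero_add]
    refine (abs_add_le _ _).trans ?_
    linarith
  · by_cases hj1 : j = i₁
    · rw [if_neg hj0, if_neg hj0, if_pos hj1, if_pos hj1, zero_add]
      refine (abs_add_le _ _).trans ?_
      linarith
    · rw [if_neg hj0, if_neg hj0, if_neg hj1, if_neg hj1, mul_zero, zero_add, zero_add]
      linarith

/-- The two curl fields contribute `3 + 2` and `3 + 1`. -/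
theorem norm_fieldHigh_le {d N L L' : ℕ} (hN : 0 < N) (hL : 4 * N ≤ L) (hLL : L ≤ L')
    {i₀ i₁ i₂ : Fin d} (h01 : i₀ ≠ i₁) (h02 : i₀ ≠ i₂) (h12 : i₁ ≠ i₂) (x : Euc d) :
    ‖fieldHigh N L L' i₀ i₁ i₂ x‖ ≤ 9 * profile N x := by
  have a0 := abs_partialD_streamHigh_le hN hL hLL h01 i₀ x
  have a1 := abs_partialD_streamHigh_le hN hL hLL h01 i₁ x
  have a2 := abs_partialD_streamHigh_le hN hL hLL h01 i₂ x
  rw [if_pos rfl] at a0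
  rw [if_neg h01.symm, if_pos rfl] at a1
  rw [if_neg h02.symm, if_neg h12.symm] at a2
  have b1 := norm_curlField_le i₀ i₁ (streamHigh N L L' i₀ i₁) x
  have b2 := norm_curlField_le i₀ i₂ (streamHigh N L L' i₀ i₁) x
  refine (norm_add_le _ _).trans ?_
  linarith

/-! ### The energy flux from the low- to the high-frequency field -/

/-- The integrand is a product of functions of single coordinates, so the integral factorizes, and
each of the `d` factors is at least `1 / (512 N)`. -/
theorem integral_envelope_cube_ge {d N L L' : ℕ} (hN : 0 < N) (hL : 4 * N ≤ L) (hL' : 4 * N ≤ L')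
    {i₀ i₁ : Fin d} (h01 : i₀ ≠ i₁) :
    (1 / (512 * N : ℝ)) ^ d ≤ ∫ x, envelope N x ^ 3 * (Real.cos (L' * x i₀) ^ 2 *
      ((1 + Real.sin (L * x i₁)) ^ 2 * Real.sin (L * x i₁))) ∂(torusMeasure d) := by
  let c : Fin d → ℝ → ℝ := fun j s => if j = i₀ then Real.cos (L' * s) ^ 2 else
    if j = i₁ then (1 + Real.sin (L * s)) ^ 2 * Real.sin (L * s) else 1
  have hprod : ∀ x : Euc d, envelope N x ^ 3 * (Real.cos (L' * x i₀) ^ 2 *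
      ((1 + Real.sin (L * x i₁)) ^ 2 * Real.sin (L * x i₁))) =
      ∏ j, (fejer N (x j) ^ 6 * c j (x j)) := by
    intro x
    have hc : ∏ j, c j (x j) = c i₀ (x i₀) * c i₁ (x i₁) :=
      Finset.prod_eq_mul i₀ i₁ h01 (fun j _ hj => by simp [c, hj.1, hj.2]) (by simp) (by simp)
    rw [Finset.prod_mul_distrib, Finset.prod_pow, hc]
    simp only [c, if_true, if_neg h01.symm, envelope, profile]
    ring
  simp only [hprod]
  rw [integral_torus_prod fun j s => fejer N s ^ 6 * c j s]
  have hle : ∀ j, (1 : ℝ) / (512 * N) ≤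
      ∫ s in (0 : ℝ)..(2 * Real.pi), fejer N s ^ 6 * c j s := by
    intro j
    by_cases h0 : j = i₀
    · simp only [c, if_pos h0]
      exact integral_fejer_pow_mul_cos_sq_ge hN hL'
    · by_cases h1 : j = i₁
      · simp only [c, if_neg h0, if_pos h1]
        exact integral_fejer_pow_mul_sin_ge hN hL
      · simp only [c, if_neg h0, if_neg h1, mul_one]
        exact integral_fejer_pow_ge hN
  calc (1 / (512 * N : ℝ)) ^ d = ∏ _j : Fin d, (1 / (512 * N : ℝ)) := by simp
    _ ≤ _ := Finset.prod_le_prod (fun j _ => by positivity) fun j _ => hle j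

theorem isTrig_cos_coord {d : ℕ} {S : Finset (Fin d → ℤ)} {L : ℕ} {i : Fin d}
    (h : Pi.single i (L : ℤ) ∈ S) (h' : -Pi.single i (L : ℤ) ∈ S) :
    IsTrig S fun x => ((Real.cos (L * x i) : ℝ) : ℂ) :=
  (isTrig_cos h h').congr fun x => by rw [inner_waveVec_single]; simp

/-- The leading part of the low-frequency field. -/
def fieldLowMain {d : ℕ} (N L : ℕ) (i₁ i₂ : Fin d) (x : Euc d) : Euc d :=
  (envelope N x * Real.cos (L * x i₁)) • basisVec i₂

theorem trigField_fieldLowMain {d : ℕ} (N L : ℕ) (i₁ i₂ : Fin d) :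
    TrigField (freqLow d N L i₁) (fieldLowMain N L i₁ i₂) := by
  have h := (isTrig_envelope d N).mul (isTrig_cos_coord (L := L) (i := i₁)
    (S := {Pi.single i₁ (L : ℤ), -Pi.single i₁ (L : ℤ)}) (by simp) (by simp))
  have h2 : IsTrig (freqLow d N L i₁)
      fun x => ((envelope N x * Real.cos (L * x i₁) : ℝ) : ℂ) := h.congr fun x => by
    rw [Complex.ofReal_mul]
  exact trigField_smul_const h2 _

/-- The remaining part of the low-frequency field. -/
def fieldLowRest {d : ℕ} (N L : ℕ) (i₁ i₂ : Fin d) (x : Euc d) : Euc d :=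
  fieldLow N L i₁ i₂ x + (-1 : ℝ) • fieldLowMain N L i₁ i₂ x

theorem trigField_fieldLowRest {d : ℕ} (N L : ℕ) (i₁ i₂ : Fin d) :
    TrigField (freqLow d N L i₁) (fieldLowRest N L i₁ i₂) :=
  (trigField_fieldLow N L i₁ i₂).add ((trigField_fieldLowMain N L i₁ i₂).const_smul (-1))

theorem norm_fieldLowRest_le {d N L : ℕ} (hN : 0 < N) (hL : 0 < L) {i₁ i₂ : Fin d}
    (h12 : i₁ ≠ i₂) (x : Euc d) :
    ‖fieldLowRest N L i₁ i₂ x‖ ≤ 4 * N / L * profile N x := by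
  have e : fieldLowRest N L i₁ i₂ x =
      ((L : ℝ)⁻¹ * (Real.sin (L * x i₁) * partialD i₁ (envelope N) x)) • basisVec i₂ +
      (-((L : ℝ)⁻¹ * (Real.sin (L * x i₁) * partialD i₂ (envelope N) x))) • basisVec i₁ := by
    rw [fieldLowRest, fieldLow, curlField, fieldLowMain, partialD_streamLow N hL,
      partialD_streamLow N hL, if_pos rfl, if_neg h12.symm, zero_add, add_smul]
    module
  rw [e]
  have h1 := abs_inv_mul_sin_le hN hL i₁ i₁ x
  have h2 := abs_inv_mul_sin_le hN hL i₁ i₂ x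
  refine (norm_add_le _ _).trans ?_
  rw [norm_smul, norm_smul, norm_basisVec, norm_basisVec, mul_one, mul_one, norm_neg,
    Real.norm_eq_abs, Real.norm_eq_abs]
  refine (add_le_add h1 h2).trans (le_of_eq ?_)
  ring

theorem energySq_le_of_norm_le {d N : ℕ} {v : Euc d → Euc d} (hv : Continuous v) {c : ℝ}
    (h : ∀ x, ‖v x‖ ≤ c * profile N x) :
    energySq v ≤ c ^ 2 * ∫ x, profile N x ∂(torusMeasure d) := by
  have hc : Continuous (profile N : Euc d → ℝ) := (contDiff_profile d N).continuous
  rw [energySq, ← integral_const_mul]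
  refine integral_mono (hv.norm.pow 2).integrable_torus
    (continuous_const.mul hc).integrable_torus fun x => ?_
  show ‖v x‖ ^ 2 ≤ c ^ 2 * profile N x
  calc ‖v x‖ ^ 2 ≤ (c * profile N x) ^ 2 := pow_le_pow_left₀ (norm_nonneg _) (h x) 2
    _ = c ^ 2 * profile N x ^ 2 := mul_pow _ _ _
    _ ≤ c ^ 2 * profile N x := mul_le_mul_of_nonneg_left
        (pow_le_of_le_one (profile_nonneg N x) (profile_le_one N x) two_ne_zero) (sq_nonneg c)

/-- The remainder has relative size `N / L`, and by Bernstein a derivative costs at most `2 L`. Its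
gradient is thus of order `N` rather than `L`, and second derivatives of the envelope never appear.
-/
theorem dissipationSq_fieldLowRest_le {d N L : ℕ} (hN : 0 < N) (hL : 0 < L)
    (hL2 : 2 * d ^ 2 * N ≤ L) {i₁ i₂ : Fin d} (h12 : i₁ ≠ i₂) :
    dissipationSq (fieldLowRest N L i₁ i₂) ≤
      64 * N ^ 2 * ∫ x, profile N x ∂(torusMeasure d) := by
  have hL0 : (0 : ℝ) < L := by exact_mod_cast hL
  have hL2' : 2 * (d : ℝ) ^ 2 * N ≤ L := by exact_mod_cast hL2
  have ht := trigField_fieldLowRest (d := d) N L i₁ i₂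
  have h1 := ht.dissipationSq_le (R := 2 * L) fun k hk => by
    linarith [(freqLow_bounds hk).1]
  have h2 := energySq_le_of_norm_le ht.contDiff.continuous (norm_fieldLowRest_le hN hL h12)
  calc _ ≤ (2 * (L : ℝ)) ^ 2 * ((4 * N / L) ^ 2 * ∫ x, profile N x ∂(torusMeasure d)) :=
        h1.trans (mul_le_mul_of_nonneg_left h2 (by positivity))
    _ = _ := by field_simp; ring

theorem fieldHigh_apply_one {d : ℕ} (N L L' : ℕ) {i₀ i₁ i₂ : Fin d} (h01 : i₀ ≠ i₁)
    (h12 : i₁ ≠ i₂) (x : Euc d) :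
    fieldHigh N L L' i₀ i₁ i₂ x i₁ = partialD i₀ (streamHigh N L L' i₀ i₁) x := by
  simp [fieldHigh, curlField, basisVec_apply, h01.symm, h12]

theorem fieldHigh_apply_two {d : ℕ} (N L L' : ℕ) {i₀ i₁ i₂ : Fin d} (h02 : i₀ ≠ i₂)
    (h12 : i₁ ≠ i₂) (x : Euc d) :
    fieldHigh N L L' i₀ i₁ i₂ x i₂ = partialD i₀ (streamHigh N L L' i₀ i₁) x := by
  simp [fieldHigh, curlField, basisVec_apply, h02.symm, h12.symm]

theorem fderiv_fieldLowMain {d : ℕ} (N L : ℕ) (i₁ i₂ : Fin d) (x y : Euc d) :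
    fderiv ℝ (fieldLowMain N L i₁ i₂) x y =
      (-(L * Real.sin (L * x i₁) * envelope N x * y i₁) +
        Real.cos (L * x i₁) * ∑ j, y j * partialD j (envelope N) x) • basisVec i₂ := by
  have ha := differentiable_envelope d N
  have hc : Differentiable ℝ fun y : Euc d => Real.cos (L * y i₁) := by fun_prop
  have e : ∀ j, partialD j (fieldLowMain N L i₁ i₂) x =
      (envelope N x * (if j = i₁ then -(L * Real.sin (L * x i₁)) else 0) +
        Real.cos (L * x i₁) * partialD j (envelope N) x) • basisVec i₂ := by
    intro j
    have := partialD_smul_const (ha.fun_mul hc) (basisVec i₂ : Euc d) j x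
    rw [partialD_mul ha hc, partialD_cos_coord] at this
    exact this
  rw [fderiv_apply_eq_sum]
  simp only [e, smul_smul, ← Finset.sum_smul]
  congr 1
  simp only [mul_add, Finset.sum_add_distrib, mul_ite, mul_zero, Finset.sum_ite_eq',
    Finset.mem_univ, if_true, Finset.mul_sum]
  congr 1
  · ring
  · exact Finset.sum_congr rfl fun j _ => by ring

/-- The only term of order `L` is the one in which the derivative hits `cos (L x₁)`. The derivative
of the envelope gives an error of order `N`. So does the lower-order part `R` of `W`, because its
relative size `N / L'` meets the factor `L ≤ L'`. -/
theorem inner_fieldLowMain_le {d N L L' : ℕ} (hN : 0 < N) (hL : 4 * N ≤ L) (hLL : L ≤ L')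
    {i₀ i₁ i₂ : Fin d} (h01 : i₀ ≠ i₁) (h02 : i₀ ≠ i₂) (h12 : i₁ ≠ i₂) (x : Euc d) :
    inner ℝ (fieldHigh N L L' i₀ i₁ i₂ x)
      (fderiv ℝ (fieldLowMain N L i₁ i₂) x (fieldHigh N L L' i₀ i₁ i₂ x)) ≤
      -(L * (envelope N x ^ 3 * (Real.cos (L' * x i₀) ^ 2 *
        ((1 + Real.sin (L * x i₁)) ^ 2 * Real.sin (L * x i₁))))) +
      (162 * d + 20) * N * profile N x := by
  set W := fieldHigh N L L' i₀ i₁ i₂ x with hW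
  set H := profile N x with hH
  have hH0 : 0 ≤ H := profile_nonneg N x
  have hH1 : H ≤ 1 := profile_le_one N x
  have hL0 : 0 < L' := by omega
  have hLR : 4 * (N : ℝ) ≤ L' := by exact_mod_cast hL.trans hLL
  have hLL' : (L : ℝ) ≤ L' := by exact_mod_cast hLL
  have hL0' : (0 : ℝ) < L' := by exact_mod_cast hL0
  have hNR : (0 : ℝ) < N := by exact_mod_cast hN
  have hWn : ‖W‖ ≤ 9 * H := norm_fieldHigh_le hN hL hLL h01 h02 h12 x
  have hWj : ∀ j, |W j| ≤ 9 * H := fun j => (PiLp.norm_apply_le W j).trans hWn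
  have hi : ∀ (c : ℝ), inner ℝ W (c • basisVec i₂) = c * W i₂ := by
    intro c
    rw [inner_smul_right, basisVec, EuclideanSpace.inner_single_right]
    simp
  rw [fderiv_fieldLowMain, hi]
  -- The high-frequency field is a sum of two curl fields precisely to make these components equal:
  -- the leading term then contains a square and has the sign of the sine.
  have hW1 : W i₁ = W i₂ := by
    rw [hW, fieldHigh_apply_one N L L' h01 h12, fieldHigh_apply_two N L L' h02 h12]
  set a := envelope N x with ha
  have ha0 : 0 ≤ a := envelope_nonneg N x
  have haH : a ≤ H := envelope_le_profile N x
  set s := Real.sin (L * x i₁) with hs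
  have hs1 : |s| ≤ 1 := Real.abs_sin_le_one _
  set P := a * (Real.cos (L' * x i₀) * (1 + s)) with hP
  set R := (L' : ℝ)⁻¹ * (Real.sin (L' * x i₀) * (1 + s) * partialD i₀ (envelope N) x) with hR
  have hW2 : W i₂ = P + R := by
    rw [hW, fieldHigh_apply_two N L L' h02 h12, partialD_streamHigh N L hL0, if_pos rfl,
      if_neg h01, zero_add]
  have hPb : |P| ≤ 2 * H := abs_envelope_mul_le x (by
    have := abs_sin_mul_le (abs_one_add_sin_le (L * x i₁)) (Real.abs_cos_le_one (L' * x i₀))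
    linarith)
  have hRb : |R| ≤ 4 * N / L' * H := abs_inv_mul_sin_mul_le hN hL0 i₀ i₁ i₀ x
  have hRb2 : |R| ≤ H := hRb.trans (ratio_mul_le hL0 hLR hH0)
  have hT : |Real.cos (L * x i₁) * ∑ j, W j * partialD j (envelope N) x| ≤
      1 * (d * (18 * N)) := by
    refine abs_sin_mul_le ?_ (Real.abs_cos_le_one _)
    refine (Finset.abs_sum_le_sum_abs _ _).trans ?_
    calc _ ≤ ∑ _j : Fin d, (18 * N : ℝ) := Finset.sum_le_sum fun j _ => by
          have h1 := abs_sin_mul_le (abs_partialD_envelope_le hN j x) ((hWj j).trans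
            (by linarith : 9 * H ≤ 9))
          refine h1.trans ?_
          nlinarith
      _ = _ := by simp
  have hT2 : |Real.cos (L * x i₁) * ∑ j, W j * partialD j (envelope N) x| * |W i₂| ≤
      162 * d * N * H := by
    calc _ ≤ (1 * (d * (18 * N))) * (9 * H) := mul_le_mul hT (hWj i₂) (abs_nonneg _) (by positivity)
      _ = _ := by ring
  rw [← abs_mul] at hT2
  have hM : |L * s * a * (2 * P * R + R ^ 2)| ≤ 20 * N * H := by
    have b1 : |2 * P * R + R ^ 2| ≤ 5 * H * (4 * N / L' * H) := by
      rw [show 2 * P * R + R ^ 2 = (2 * P + R) * R by ring, abs_mul]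
      refine mul_le_mul ?_ hRb (abs_nonneg _) (by positivity)
      refine (abs_add_le _ _).trans ?_
      rw [abs_mul, abs_two]
      linarith
    have b2 : |L * s * a| ≤ L * 1 * 1 := by
      rw [abs_mul, abs_mul, abs_of_nonneg (Nat.cast_nonneg L : (0 : ℝ) ≤ L), abs_of_nonneg ha0]
      gcongr
      exact haH.trans hH1
    rw [abs_mul]
    calc _ ≤ (L * 1 * 1) * (5 * H * (4 * N / L' * H)) :=
          mul_le_mul b2 b1 (abs_nonneg _) (by positivity)
      _ = 20 * N * (H * H) * (L / L') := by field_simp; ring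
      _ ≤ 20 * N * (H * 1) * 1 := by
          gcongr
          exact (div_le_one hL0').2 hLL'
      _ = _ := by ring
  have e : (-(L * s * a * W i₁) + Real.cos (L * x i₁) * ∑ j, W j * partialD j (envelope N) x) *
      W i₂ = -(L * (a ^ 3 * (Real.cos (L' * x i₀) ^ 2 * ((1 + s) ^ 2 * s)))) -
        L * s * a * (2 * P * R + R ^ 2) +
        (Real.cos (L * x i₁) * ∑ j, W j * partialD j (envelope N) x) * W i₂ := by
    rw [hW1, add_mul]
    congr 1
    rw [hW2, hP]
    ring
  rw [e]
  linarith [(abs_le.1 hT2).2, (abs_le.1 hM).1]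

/-- The gradient of the remainder is controlled in `L²` only, with norm of order `N`. Young's
inequality with weight `N` turns this into an error of order `N` times the mass of the profile. -/
theorem inner_fieldLowRest_le {d N L L' : ℕ} (hN : 0 < N) (hL : 4 * N ≤ L) (hLL : L ≤ L')
    {i₀ i₁ i₂ : Fin d} (h01 : i₀ ≠ i₁) (h02 : i₀ ≠ i₂) (h12 : i₁ ≠ i₂) (x : Euc d) :
    inner ℝ (fieldHigh N L L' i₀ i₁ i₂ x)
      (fderiv ℝ (fieldLowRest N L i₁ i₂) x (fieldHigh N L L' i₀ i₁ i₂ x)) ≤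
      41 * (d * N * profile N x +
        (N : ℝ)⁻¹ * ∑ j, ‖partialD j (fieldLowRest N L i₁ i₂) x‖ ^ 2) := by
  set W := fieldHigh N L L' i₀ i₁ i₂ x with hW
  set H := profile N x with hH
  have hH0 : 0 ≤ H := profile_nonneg N x
  have hH1 : H ≤ 1 := profile_le_one N x
  have hNR : (0 : ℝ) < N := by exact_mod_cast hN
  have hWn : ‖W‖ ≤ 9 * H := norm_fieldHigh_le hN hL hLL h01 h02 h12 x
  have hWj : ∀ j, |W j| ≤ 9 * H := fun j => (PiLp.norm_apply_le W j).trans hWn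
  rw [fderiv_apply_eq_sum, inner_sum]
  have e : 41 * (d * N * H + (N : ℝ)⁻¹ * ∑ j, ‖partialD j (fieldLowRest N L i₁ i₂) x‖ ^ 2) =
      ∑ j, 41 * (N * H + (N : ℝ)⁻¹ * ‖partialD j (fieldLowRest N L i₁ i₂) x‖ ^ 2) := by
    rw [← Finset.mul_sum, Finset.sum_add_distrib, ← Finset.mul_sum]
    rw [← Finset.mul_sum _ _ (N : ℝ)⁻¹]
    simp only [Finset.sum_const, Finset.card_univ, Fintype.card_fin, nsmul_eq_mul]
    ring
  rw [e]
  refine Finset.sum_le_sum fun j _ => ?_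
  set D := partialD j (fieldLowRest N L i₁ i₂) x
  rw [inner_smul_right]
  have h1 : W j * inner ℝ W D ≤ (9 * H) * ((9 * H) * ‖D‖) := by
    refine (le_abs_self _).trans ?_
    rw [abs_mul]
    refine mul_le_mul (hWj j) ((abs_real_inner_le_norm _ _).trans ?_) (abs_nonneg _) (by positivity)
    exact mul_le_mul_of_nonneg_right hWn (norm_nonneg _)
  have h2 : H ^ 2 * ‖D‖ ≤ (1 / 2) * (N * H + (N : ℝ)⁻¹ * ‖D‖ ^ 2) := by
    have h3 : 0 ≤ (N : ℝ)⁻¹ * (N * H ^ 2 - ‖D‖) ^ 2 := by positivity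
    have h4 : (N : ℝ)⁻¹ * (N * H ^ 2 - ‖D‖) ^ 2 =
        N * H ^ 4 - 2 * (H ^ 2 * ‖D‖) + (N : ℝ)⁻¹ * ‖D‖ ^ 2 := by field_simp; ring
    have h5 : (N : ℝ) * H ^ 4 ≤ N * H :=
      mul_le_mul_of_nonneg_left (pow_le_of_le_one hH0 hH1 (by norm_num)) hNR.le
    linarith
  have h6 : 0 ≤ N * H + (N : ℝ)⁻¹ * ‖D‖ ^ 2 := by positivity
  calc _ ≤ 81 * (H ^ 2 * ‖D‖) := h1.trans (le_of_eq (by ring))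
    _ ≤ _ := by linarith

/-- Skew-symmetry moves the derivative from the high- to the low-frequency field, so that `L'` does
not enter. The main term is `L` and the errors are `N`, both times `N ^ (-d)` up to constants. -/
theorem integral_transport_high_ge {d N L L' : ℕ} (hN : 0 < N) (hL : 4 * N ≤ L)
    (hL2 : 2 * d ^ 2 * N ≤ L) (hLL : L ≤ L') {i₀ i₁ i₂ : Fin d} (h01 : i₀ ≠ i₁) (h02 : i₀ ≠ i₂)
    (h12 : i₁ ≠ i₂) :
    L * (1 / (512 * N : ℝ)) ^ d - (300 * d + 3000) * N * (2 * Real.pi / N) ^ d ≤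
      ∫ x, inner ℝ (fderiv ℝ (fieldHigh N L L' i₀ i₁ i₂) x (fieldHigh N L L' i₀ i₁ i₂ x))
        (fieldLow N L i₁ i₂ x) ∂(torusMeasure d) := by
  have hNR : (0 : ℝ) < N := by exact_mod_cast hN
  have hWt := trigField_fieldHigh (d := d) N L L' i₀ i₁ i₂
  have hVt := trigField_fieldLow (d := d) N L i₁ i₂
  have hV0t := trigField_fieldLowMain (d := d) N L i₁ i₂
  have hV1t := trigField_fieldLowRest (d := d) N L i₁ i₂
  rw [integral_inner_transport hWt.contDiff hWt.contDiff hVt.contDiff hWt.torusPeriodic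
    hWt.torusPeriodic hVt.torusPeriodic (divergence_fieldHigh N L L' i₀ i₁ i₂), ← integral_neg]
  have hVe : fieldLow N L i₁ i₂ = fun x => fieldLowMain N L i₁ i₂ x + fieldLowRest N L i₁ i₂ x := by
    funext x
    rw [fieldLowRest]
    module
  have hf : ∀ x y, fderiv ℝ (fieldLow N L i₁ i₂) x y =
      fderiv ℝ (fieldLowMain N L i₁ i₂) x y + fderiv ℝ (fieldLowRest N L i₁ i₂) x y := by
    intro x y
    rw [hVe, fderiv_fun_add (hV0t.contDiff.differentiable (by simp) x)
      (hV1t.contDiff.differentiable (by simp) x)]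
    rfl
  have hcH : Continuous (profile N : Euc d → ℝ) := (contDiff_profile d N).continuous
  have hca : Continuous (envelope N : Euc d → ℝ) := (differentiable_envelope d N).continuous
  set G : Euc d → ℝ := fun x => envelope N x ^ 3 * (Real.cos (L' * x i₀) ^ 2 *
    ((1 + Real.sin (L * x i₁)) ^ 2 * Real.sin (L * x i₁))) with hG
  have hcG : Continuous G := by fun_prop
  set D : Euc d → ℝ := fun x => ∑ j, ‖partialD j (fieldLowRest N L i₁ i₂) x‖ ^ 2 with hD
  have hcD : Continuous D := continuous_finsetSum _ fun j _ =>
    (hV1t.partialD j).contDiff.continuous.norm.pow 2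
  have hlow : ∀ x, L * G x - (162 * d + 20) * N * profile N x -
      41 * (d * N * profile N x + (N : ℝ)⁻¹ * D x) ≤
      -inner ℝ (fieldHigh N L L' i₀ i₁ i₂ x)
        (fderiv ℝ (fieldLow N L i₁ i₂) x (fieldHigh N L L' i₀ i₁ i₂ x)) := by
    intro x
    rw [hf, inner_add_right]
    have h1 := inner_fieldLowMain_le hN hL hLL h01 h02 h12 x
    have h2 := inner_fieldLowRest_le hN hL hLL h01 h02 h12 x
    simp only [hG, hD]
    linarith
  have hcI : Continuous fun x => -inner ℝ (fieldHigh N L L' i₀ i₁ i₂ x)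
        (fderiv ℝ (fieldLow N L i₁ i₂) x (fieldHigh N L L' i₀ i₁ i₂ x)) :=
    (hWt.contDiff.continuous.inner (hWt.convective hVt).contDiff.continuous).neg
  have hmono := integral_mono (μ := torusMeasure d) (f := fun x => L * G x -
      (162 * d + 20) * N * profile N x - 41 * (d * N * profile N x + (N : ℝ)⁻¹ * D x))
    (Continuous.integrable_torus (by fun_prop)) hcI.integrable_torus hlow
  refine le_trans ?_ hmono
  have i1 : Integrable (fun x => L * G x) (torusMeasure d) :=
    Continuous.integrable_torus (by fun_prop)
  have i2 : Integrable (fun x => (162 * d + 20) * N * profile N x) (torusMeasure d) :=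
    Continuous.integrable_torus (by fun_prop)
  have i3 : Integrable (fun x => 41 * (d * N * profile N x + (N : ℝ)⁻¹ * D x)) (torusMeasure d) :=
    Continuous.integrable_torus (by fun_prop)
  have i4 : Integrable (fun x => d * N * profile N x) (torusMeasure d) :=
    Continuous.integrable_torus (by fun_prop)
  have i5 : Integrable (fun x => (N : ℝ)⁻¹ * D x) (torusMeasure d) :=
    Continuous.integrable_torus (by fun_prop)
  rw [integral_sub (i1.sub' i2) i3, integral_sub i1 i2, integral_const_mul, integral_const_mul,
    integral_const_mul, integral_add i4 i5, integral_const_mul, integral_const_mul]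
  have hM := integral_envelope_cube_ge hN hL (hL.trans hLL) h01
  have hDi := dissipationSq_fieldLowRest_le hN (by omega) hL2 h12
  have hDe : ∫ x, D x ∂(torusMeasure d) = dissipationSq (fieldLowRest N L i₁ i₂) := rfl
  rw [hDe, ← integral_profile hN]
  set I := ∫ x, profile N x ∂(torusMeasure d)
  have hI : 0 ≤ I := integral_nonneg fun x => profile_nonneg N x
  have h3 : (N : ℝ)⁻¹ * dissipationSq (fieldLowRest N L i₁ i₂) ≤ 64 * N * I := by
    calc _ ≤ (N : ℝ)⁻¹ * (64 * N ^ 2 * I) := mul_le_mul_of_nonneg_left hDi (by positivity)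
      _ = _ := by field_simp
  have h4 : L * (1 / (512 * N : ℝ)) ^ d ≤ L * ∫ x, G x ∂(torusMeasure d) :=
    mul_le_mul_of_nonneg_left hM (by positivity)
  have h5 : 0 ≤ N * I := by positivity
  have h6 : 0 ≤ d * (N * I) := by positivity
  nlinarith

/-! ### The flux of a two-scale field through dyadic frequencies -/

/-- The cutoff is Lipschitz and vanishes on the unit sphere, here compared with the radial
projection of `ξ`. -/
theorem IsLPCutoff.exists_le_mul {d : ℕ} {χ : Euc d → ℝ} (hχ : IsLPCutoff χ) :
    ∃ K : ℝ, 0 ≤ K ∧ ∀ (ξ : Euc d) (η : ℝ), 0 ≤ η → ξ ≠ 0 → 1 - η ≤ ‖ξ‖ → χ ξ ≤ K * η := by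
  have hc : HasCompactSupport χ := by
    refine HasCompactSupport.intro (isCompact_closedBall (0 : Euc d) 1) fun ξ hξ => ?_
    refine hχ.eq_zero ξ ?_
    rw [mem_closedBall_zero_iff, not_le] at hξ
    exact hξ.le
  have h1 : ContDiff ℝ 1 χ := hχ.smooth.of_le (by simp)
  obtain ⟨K, hK⟩ := ContDiff.lipschitzWith_of_hasCompactSupport hc h1 one_ne_zero
  refine ⟨K, K.2, fun ξ η hη h0 h => ?_⟩
  by_cases h1 : 1 ≤ ‖ξ‖
  · rw [hχ.eq_zero ξ h1]; positivity
  · have hn : ‖ξ‖ ≠ 0 := norm_ne_zero_iff.2 h0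
    have hz : χ (‖ξ‖⁻¹ • ξ) = 0 := hχ.eq_zero _ (by
      rw [norm_smul, norm_inv, norm_norm, inv_mul_cancel₀ hn])
    have := hK.dist_le_mul ξ (‖ξ‖⁻¹ • ξ)
    rw [Real.dist_eq, hz, sub_zero, dist_eq_norm] at this
    have e : ‖ξ - ‖ξ‖⁻¹ • ξ‖ = 1 - ‖ξ‖ := by
      have : ξ - ‖ξ‖⁻¹ • ξ = (1 - ‖ξ‖⁻¹) • ξ := by rw [sub_smul, one_smul]
      rw [this, norm_smul, Real.norm_eq_abs, abs_of_nonpos, neg_sub, sub_mul, one_mul,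
        inv_mul_cancel₀ hn]
      rw [sub_nonpos]
      exact (one_le_inv₀ (lt_of_le_of_ne (norm_nonneg _) hn.symm)).2 (not_le.1 h1).le
    rw [e] at this
    refine (le_abs_self _).trans (this.trans ?_)
    exact mul_le_mul_of_nonneg_left (by linarith) K.2

theorem TrigField.sum_torusCoeff_le {d : ℕ} {S T : Finset (Fin d → ℤ)} {v : Euc d → Euc d}
    (hv : TrigField S v) :
    (2 * Real.pi) ^ d * ∑ k ∈ T, ∑ i, ‖torusCoeff v i k‖ ^ 2 ≤ energySq v := by
  rw [energySq_eq_sum (hv.mono (Finset.subset_union_left (s₂ := T)))]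
  refine mul_le_mul_of_nonneg_left ?_ (by positivity)
  exact Finset.sum_le_sum_of_subset_of_nonneg Finset.subset_union_right
    fun k _ _ => by positivity

/-- The contribution of the frequencies in `T` to a filtered inner product. -/
theorem abs_sum_filtered_le {d : ℕ} {S S' T : Finset (Fin d → ℤ)} {v w : Euc d → Euc d}
    (hv : TrigField S v) (hw : TrigField S' w) {m : (Fin d → ℤ) → ℝ} {η : ℝ}
    (hm : ∀ k ∈ T, |m k| ≤ η) :
    |(2 * Real.pi) ^ d * ∑ k ∈ T, m k ^ 2 *
      ∑ i, (torusCoeff v i k * star (torusCoeff w i k)).re| ≤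
      η ^ 2 * (Real.sqrt (energySq v) * Real.sqrt (energySq w)) := by
  have h1 : |∑ k ∈ T, m k ^ 2 * ∑ i, (torusCoeff v i k * star (torusCoeff w i k)).re| ≤
      η ^ 2 * ∑ p ∈ T ×ˢ (Finset.univ : Finset (Fin d)),
        ‖torusCoeff v p.2 p.1‖ * ‖torusCoeff w p.2 p.1‖ := by
    rw [Finset.sum_product, Finset.mul_sum]
    refine (Finset.abs_sum_le_sum_abs _ _).trans (Finset.sum_le_sum fun k hk => ?_)
    rw [abs_mul, abs_of_nonneg (sq_nonneg _)]
    refine mul_le_mul ?_ ?_ (abs_nonneg _) (sq_nonneg _)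
    · rw [← sq_abs]
      exact pow_le_pow_left₀ (abs_nonneg _) (hm k hk) 2
    · refine (Finset.abs_sum_le_sum_abs _ _).trans (Finset.sum_le_sum fun i _ => ?_)
      refine (Complex.abs_re_le_norm _).trans ?_
      rw [norm_mul, norm_star]
  have h2 := Real.sum_mul_le_sqrt_mul_sqrt (T ×ˢ (Finset.univ : Finset (Fin d)))
    (fun p => ‖torusCoeff v p.2 p.1‖) (fun p => ‖torusCoeff w p.2 p.1‖)
  rw [Finset.sum_product (f := fun p : (Fin d → ℤ) × Fin d => ‖torusCoeff v p.2 p.1‖ ^ 2),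
    Finset.sum_product (f := fun p : (Fin d → ℤ) × Fin d => ‖torusCoeff w p.2 p.1‖ ^ 2)] at h2
  have hv1 := hv.sum_torusCoeff_le (T := T)
  have hw1 := hw.sum_torusCoeff_le (T := T)
  set A := ∑ k ∈ T, ∑ i, ‖torusCoeff v i k‖ ^ 2
  set B := ∑ k ∈ T, ∑ i, ‖torusCoeff w i k‖ ^ 2
  have hp : (0 : ℝ) ≤ (2 * Real.pi) ^ d := by positivity
  have h3 : (2 * Real.pi) ^ d * (Real.sqrt A * Real.sqrt B) ≤
      Real.sqrt (energySq v) * Real.sqrt (energySq w) := by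
    calc (2 * Real.pi) ^ d * (Real.sqrt A * Real.sqrt B) =
        (Real.sqrt ((2 * Real.pi) ^ d) * Real.sqrt A) *
          (Real.sqrt ((2 * Real.pi) ^ d) * Real.sqrt B) := by
          rw [mul_mul_mul_comm, Real.mul_self_sqrt hp]
      _ ≤ _ := by
          rw [← Real.sqrt_mul hp, ← Real.sqrt_mul hp]
          gcongr
  rw [abs_mul, abs_of_nonneg hp]
  calc _ ≤ (2 * Real.pi) ^ d * (η ^ 2 * (Real.sqrt A * Real.sqrt B)) :=
        mul_le_mul_of_nonneg_left (h1.trans (mul_le_mul_of_nonneg_left h2 (sq_nonneg _))) hp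
    _ = η ^ 2 * ((2 * Real.pi) ^ d * (Real.sqrt A * Real.sqrt B)) := by ring
    _ ≤ _ := mul_le_mul_of_nonneg_left h3 (sq_nonneg _)

/-- The sum of the low- and the high-frequency field. -/
def stageField {d : ℕ} (N L L' : ℕ) (i₀ i₁ i₂ : Fin d) (x : Euc d) : Euc d :=
  fieldLow N L i₁ i₂ x + fieldHigh N L L' i₀ i₁ i₂ x

/-- Admissible parameters of a two-scale field: the concentration `N` and the two frequencies
`2 ^ Q` and `2 ^ Q'`. -/
structure StageParams (d N L L' Q Q' : ℕ) (i₀ i₁ i₂ : Fin d) : Prop where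
  N_pos : 0 < N
  ne01 : i₀ ≠ i₁
  ne02 : i₀ ≠ i₂
  ne12 : i₁ ≠ i₂
  -- With these two equations each spectrum lies in a thin layer inside the sphere of radius `2 ^
  -- Q`, respectively `2 ^ Q'`. The cutoff of that very scale is nearly zero there, and the cutoff
  -- of the next scale is one.
  low : L + 2 * d ^ 2 * N = 2 ^ Q
  high : L' + 2 ^ Q = 2 ^ Q'
  separated : 8 * d ^ 2 * N ≤ 2 ^ Q
  gap : Q + 3 ≤ Q'

namespace StageParams

variable {d N L L' Q Q' : ℕ} {i₀ i₁ i₂ : Fin d}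

theorem dim_pos (_ : StageParams d N L L' Q Q' i₀ i₁ i₂) : 1 ≤ d ^ 2 :=
  Nat.one_le_pow _ _ (Nat.zero_lt_of_lt i₀.2)

theorem N_le (h : StageParams d N L L' Q Q' i₀ i₁ i₂) : N ≤ d ^ 2 * N :=
  Nat.le_mul_of_pos_left _ h.dim_pos

theorem four_N_le (h : StageParams d N L L' Q Q' i₀ i₁ i₂) : 4 * N ≤ L := by
  have h1 := h.low
  have h2 := h.separated
  have h3 := h.N_le
  rw [mul_assoc] at h1 h2
  omega

theorem sq_N_le (h : StageParams d N L L' Q Q' i₀ i₁ i₂) : 2 * d ^ 2 * N ≤ L := by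
  have h1 := h.low
  have h2 := h.separated
  rw [mul_assoc] at h1 h2 ⊢
  omega

theorem pow_gap (h : StageParams d N L L' Q Q' i₀ i₁ i₂) : 8 * 2 ^ Q ≤ 2 ^ Q' := by
  calc 8 * 2 ^ Q = 2 ^ (Q + 3) := by ring
    _ ≤ 2 ^ Q' := Nat.pow_le_pow_right two_pos h.gap

theorem L_le (h : StageParams d N L L' Q Q' i₀ i₁ i₂) : L ≤ L' := by
  have h1 := h.low
  have h2 := h.high
  have h3 := h.pow_gap
  omega

theorem low_freq (h : StageParams d N L L' Q Q' i₀ i₁ i₂) {k : Fin d → ℤ}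
    (hk : k ∈ freqLow d N L i₁) :
    ‖waveVec k‖ ≤ 2 ^ Q ∧ (2 : ℝ) ^ Q - 4 * d ^ 2 * N ≤ ‖waveVec k‖ := by
  have h1 : (L : ℝ) + 2 * d ^ 2 * N = 2 ^ Q := by exact_mod_cast h.low
  have := freqLow_bounds hk
  constructor <;> linarith [this.1, this.2.1]

theorem high_freq (h : StageParams d N L L' Q Q' i₀ i₁ i₂) {k : Fin d → ℤ}
    (hk : k ∈ freqHigh d N L L' i₀ i₁) :
    ‖waveVec k‖ ≤ 2 ^ Q' ∧ (2 : ℝ) ^ Q' - 2 * 2 ^ Q ≤ ‖waveVec k‖ := by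
  have h1 : (L : ℝ) + 2 * d ^ 2 * N = 2 ^ Q := by exact_mod_cast h.low
  have h2 : (L' : ℝ) + 2 ^ Q = 2 ^ Q' := by exact_mod_cast h.high
  have := freqHigh_bounds h.ne01 hk
  constructor <;> linarith [this.1, this.2.1]

theorem gap_real (h : StageParams d N L L' Q Q' i₀ i₁ i₂) : 8 * (2 : ℝ) ^ Q ≤ 2 ^ Q' := by
  exact_mod_cast h.pow_gap

theorem sep_real (h : StageParams d N L L' Q Q' i₀ i₁ i₂) : 8 * (d : ℝ) ^ 2 * N ≤ 2 ^ Q := by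
  exact_mod_cast h.separated

theorem disjoint_freq (h : StageParams d N L L' Q Q' i₀ i₁ i₂) :
    Disjoint (freqLow d N L i₁) (freqHigh d N L L' i₀ i₁) := by
  rw [Finset.disjoint_left]
  intro k hk hk'
  have h1 := (h.low_freq hk).1
  have h2 := (h.high_freq hk').2
  have h3 := h.gap_real
  have : (0 : ℝ) < 2 ^ Q := by positivity
  linarith

theorem trigField (N L L' : ℕ) (i₀ i₁ i₂ : Fin d) :
    TrigField (freqLow d N L i₁ ∪ freqHigh d N L L' i₀ i₁) (stageField N L L' i₀ i₁ i₂) :=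
  ((trigField_fieldLow N L i₁ i₂).mono Finset.subset_union_left).add
    ((trigField_fieldHigh N L L' i₀ i₁ i₂).mono Finset.subset_union_right)

theorem divergence_eq_zero (N L L' : ℕ) (i₀ i₁ i₂ : Fin d) (x : Euc d) :
    divergence (stageField N L L' i₀ i₁ i₂) x = 0 := by
  have := divergence_add ((trigField_fieldLow N L i₁ i₂).contDiff.differentiable (by simp))
    ((trigField_fieldHigh N L L' i₀ i₁ i₂).contDiff.differentiable (by simp)) x
  rw [divergence_fieldLow, divergence_fieldHigh, add_zero] at this
  exact this

theorem norm_le (h : StageParams d N L L' Q Q' i₀ i₁ i₂) (x : Euc d) :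
    ‖stageField N L L' i₀ i₁ i₂ x‖ ≤ 12 * profile N x := by
  have h1 := norm_fieldLow_le h.N_pos h.four_N_le h.ne12 x
  have h2 := norm_fieldHigh_le h.N_pos h.four_N_le h.L_le h.ne01 h.ne02 h.ne12 x
  exact (norm_add_le _ _).trans (by linarith)

theorem freq_le (h : StageParams d N L L' Q Q' i₀ i₁ i₂) {k : Fin d → ℤ}
    (hk : k ∈ freqLow d N L i₁ ∪ freqHigh d N L L' i₀ i₁) : ‖waveVec k‖ ≤ 2 ^ Q' := by
  have h3 := h.gap_real
  have : (0 : ℝ) < 2 ^ Q := by positivity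
  rcases Finset.mem_union.1 hk with hk | hk
  · linarith [(h.low_freq hk).1]
  · exact (h.high_freq hk).1

theorem energySq_le (h : StageParams d N L L' Q Q' i₀ i₁ i₂) :
    energySq (stageField N L L' i₀ i₁ i₂) ≤ 144 * (2 * Real.pi / N) ^ d := by
  rw [← integral_profile h.N_pos]
  refine (energySq_le_of_norm_le (trigField N L L' i₀ i₁ i₂).contDiff.continuous h.norm_le).trans
    (le_of_eq (by norm_num))

theorem dissipationSq_le (h : StageParams d N L L' Q Q' i₀ i₁ i₂) :
    dissipationSq (stageField N L L' i₀ i₁ i₂) ≤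
      ((2 : ℝ) ^ Q') ^ 2 * (144 * (2 * Real.pi / N) ^ d) :=
  ((trigField N L L' i₀ i₁ i₂).dissipationSq_le fun _ hk => h.freq_le hk).trans
    (mul_le_mul_of_nonneg_left h.energySq_le (by positivity))

/-- The field is bounded by 12, so the convective term is controlled by the gradient; the factor `d`
is Cauchy–Schwarz over the directions. -/
theorem energySq_convective_le (h : StageParams d N L L' Q Q' i₀ i₁ i₂) :
    energySq (convective (stageField N L L' i₀ i₁ i₂)) ≤
      144 * d * (((2 : ℝ) ^ Q') ^ 2 * (144 * (2 * Real.pi / N) ^ d)) := by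
  have ht := trigField N L L' i₀ i₁ i₂
  refine le_trans ?_ (mul_le_mul_of_nonneg_left h.dissipationSq_le (by positivity))
  set U := stageField N L L' i₀ i₁ i₂
  rw [energySq, dissipationSq, ← integral_const_mul]
  refine integral_mono ((ht.convective ht).contDiff.continuous.norm.pow 2).integrable_torus
    ((continuous_const.mul (continuous_finsetSum _ fun j _ =>
      (ht.partialD j).contDiff.continuous.norm.pow 2)).integrable_torus) fun x => ?_
  show ‖fderiv ℝ U x (U x)‖ ^ 2 ≤ 144 * d * ∑ j, ‖partialD j U x‖ ^ 2
  have h12 : ‖U x‖ ≤ 12 := (h.norm_le x).trans (by linarith [profile_le_one N x])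
  have h1 : ‖fderiv ℝ U x (U x)‖ ≤ ∑ j, 12 * ‖partialD j U x‖ := by
    rw [fderiv_apply_eq_sum]
    refine (norm_sum_le _ _).trans (Finset.sum_le_sum fun j _ => ?_)
    rw [norm_smul]
    exact mul_le_mul_of_nonneg_right ((PiLp.norm_apply_le _ j).trans h12) (norm_nonneg _)
  calc _ ≤ (∑ j, 12 * ‖partialD j U x‖) ^ 2 := pow_le_pow_left₀ (norm_nonneg _) h1 2
    _ = 144 * (∑ j, ‖partialD j U x‖) ^ 2 := by rw [← Finset.mul_sum]; ring
    _ ≤ 144 * (d * ∑ j, ‖partialD j U x‖ ^ 2) := by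
        gcongr
        have := sq_sum_le_card_mul_sum_sq (s := Finset.univ) (f := fun j => ‖partialD j U x‖)
        simpa using this
    _ = _ := by ring

/-- The rate of energy transfer from the low- to the high-frequency field. -/
def transfer {d : ℕ} (N L L' : ℕ) (i₀ i₁ i₂ : Fin d) : ℝ :=
  torusInner (convective (stageField N L L' i₀ i₁ i₂)) (fieldLow N L i₁ i₂)

open scoped Pointwise in
-- Of the four parts of the nonlinearity tested against `V`, the two that differentiate `V` vanish
-- by skew-symmetry. In `(V·∇)W` the derivative moves to `V`, and `(V·∇)V` has frequencies at most
-- `2 * 2 ^ Q`, below those of `W`. Only `(W·∇)W` remains.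
theorem transfer_ge (h : StageParams d N L L' Q Q' i₀ i₁ i₂) :
    L * (1 / (512 * N : ℝ)) ^ d - (300 * d + 3000) * N * (2 * Real.pi / N) ^ d ≤
      transfer N L L' i₀ i₁ i₂ := by
  refine (integral_transport_high_ge h.N_pos h.four_N_le h.sq_N_le h.L_le h.ne01 h.ne02
    h.ne12).trans (le_of_eq ?_)
  have hV := trigField_fieldLow (d := d) N L i₁ i₂
  have hW := trigField_fieldHigh (d := d) N L L' i₀ i₁ i₂
  set V := fieldLow N L i₁ i₂
  set W := fieldHigh N L L' i₀ i₁ i₂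
  have e : ∀ x, inner ℝ (convective (stageField N L L' i₀ i₁ i₂) x) (V x) =
      inner ℝ (fderiv ℝ V x (V x)) (V x) + inner ℝ (fderiv ℝ V x (W x)) (V x) +
      (inner ℝ (fderiv ℝ W x (V x)) (V x) + inner ℝ (fderiv ℝ W x (W x)) (V x)) := by
    intro x
    have : convective (stageField N L L' i₀ i₁ i₂) x =
        fderiv ℝ (fun x => V x + W x) x (V x + W x) := rfl
    rw [this, fderiv_fun_add (hV.contDiff.differentiable (by simp) x)
      (hW.contDiff.differentiable (by simp) x), add_apply, map_add, map_add, inner_add_left,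
      inner_add_left, inner_add_left]
  have hc : ∀ {S T : Finset (Fin d → ℤ)} {v w : Euc d → Euc d}, TrigField S v → TrigField T w →
      Integrable (fun x => inner ℝ (fderiv ℝ w x (v x)) (V x)) (torusMeasure d) := fun hv hw =>
    ((hv.convective hw).contDiff.continuous.inner hV.contDiff.continuous).integrable_torus
  have z1 : ∫ x, inner ℝ (fderiv ℝ V x (V x)) (V x) ∂(torusMeasure d) = 0 :=
    integral_inner_transport_self hV.contDiff hV.contDiff hV.torusPeriodic hV.torusPeriodic
      (divergence_fieldLow N L i₁ i₂)
  have z2 : ∫ x, inner ℝ (fderiv ℝ V x (W x)) (V x) ∂(torusMeasure d) = 0 :=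
    integral_inner_transport_self hW.contDiff hV.contDiff hW.torusPeriodic hV.torusPeriodic
      (divergence_fieldHigh N L L' i₀ i₁ i₂)
  have z3 : ∫ x, inner ℝ (fderiv ℝ W x (V x)) (V x) ∂(torusMeasure d) = 0 := by
    rw [integral_inner_transport hV.contDiff hW.contDiff hV.contDiff hV.torusPeriodic
      hW.torusPeriodic hV.torusPeriodic (divergence_fieldLow N L i₁ i₂), neg_eq_zero]
    simp only [real_inner_comm _ (W _)]
    have hVV := hV.convective hV
    have := torusInner_eq_sum hVV.contDiff.continuous hW
    rw [torusInner] at this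
    rw [this]
    refine mul_eq_zero_of_right _ (Finset.sum_eq_zero fun k hk => Finset.sum_eq_zero fun i _ => ?_)
    have hk' : k ∉ freqLow d N L i₁ + freqLow d N L i₁ := by
      intro hmem
      obtain ⟨a, ha, b, hb, rfl⟩ := Finset.mem_add.1 hmem
      have h1 := (h.low_freq ha).1
      have h2 := (h.low_freq hb).1
      have h3 := (h.high_freq hk).2
      have h4 := h.gap_real
      have h5 : (0 : ℝ) < 2 ^ Q := by positivity
      have h6 := norm_add_le (waveVec a) (waveVec b)
      rw [waveVec_add] at h3
      linarith
    rw [hVV.torusCoeff_of_notMem i hk']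
    simp
  have e2 : transfer N L L' i₀ i₁ i₂ =
      ∫ x, inner ℝ (convective (stageField N L L' i₀ i₁ i₂) x) (V x) ∂(torusMeasure d) := rfl
  rw [e2]
  simp only [e]
  have i1 : Integrable (fun x => inner ℝ (fderiv ℝ V x (V x)) (V x) +
      inner ℝ (fderiv ℝ V x (W x)) (V x)) (torusMeasure d) := (hc hV hV).add (hc hW hV)
  have i2 : Integrable (fun x => inner ℝ (fderiv ℝ W x (V x)) (V x) +
      inner ℝ (fderiv ℝ W x (W x)) (V x)) (torusMeasure d) := (hc hV hW).add (hc hW hW)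
  rw [integral_add i1 i2,
    integral_add (hc hV hV) (hc hW hV), integral_add (hc hV hW) (hc hW hW), z1, z2, z3]
  ring

variable {χ : Euc d → ℝ}

/-- The flux of the two-scale field through the frequency `2 ^ q`. -/
def dyadicFlux {d : ℕ} (χ : Euc d → ℝ) (N L L' : ℕ) (i₀ i₁ i₂ : Fin d) (q : ℕ) : ℝ :=
  torusInner (lpLow χ q (convective (stageField N L L' i₀ i₁ i₂)))
    (lpLow χ q (stageField N L L' i₀ i₁ i₂))

/-- The bound for the fluxes through frequencies close to the two shells. -/
def fluxError (d N Q Q' : ℕ) (K : ℝ) : ℝ :=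
  ((K * (4 * d ^ 2 * N / 2 ^ Q)) ^ 2 + (K * (2 * 2 ^ Q / 2 ^ Q')) ^ 2) *
    (1728 * d * 2 ^ Q' * (2 * Real.pi / N) ^ d)

theorem sqrt_mul_sqrt_le (h : StageParams d N L L' Q Q' i₀ i₁ i₂) :
    Real.sqrt (energySq (convective (stageField N L L' i₀ i₁ i₂))) *
      Real.sqrt (energySq (stageField N L L' i₀ i₁ i₂)) ≤
      1728 * d * 2 ^ Q' * (2 * Real.pi / N) ^ d := by
  have h1 := h.energySq_convective_le
  have h2 := h.energySq_le
  have hd : (1 : ℝ) ≤ d := by exact_mod_cast Nat.one_le_of_lt i₀.2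
  set I := (2 * Real.pi / N) ^ d
  have hI : 0 ≤ I := by positivity
  rw [← Real.sqrt_mul (energySq_nonneg _)]
  refine Real.sqrt_le_iff.2 ⟨by positivity, ?_⟩
  calc _ ≤ (144 * d * (((2 : ℝ) ^ Q') ^ 2 * (144 * I))) * (144 * I) :=
        mul_le_mul h1 h2 (energySq_nonneg _) (by positivity)
    _ = (1728 * 2 ^ Q' * I) ^ 2 * d := by ring
    _ ≤ (1728 * 2 ^ Q' * I) ^ 2 * (d * d) := by
        gcongr
        nlinarith
    _ = _ := by ring

theorem dyadicFlux_eq (hχ : IsLPCutoff χ) (h : StageParams d N L L' Q Q' i₀ i₁ i₂) (q : ℕ) :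
    dyadicFlux χ N L L' i₀ i₁ i₂ q =
      (2 * Real.pi) ^ d * ∑ k ∈ freqLow d N L i₁, χ (((2 : ℝ) ^ (q + 1))⁻¹ • waveVec k) ^ 2 *
        ∑ i, (torusCoeff (convective (stageField N L L' i₀ i₁ i₂)) i k *
          star (torusCoeff (stageField N L L' i₀ i₁ i₂) i k)).re +
      (2 * Real.pi) ^ d * ∑ k ∈ freqHigh d N L L' i₀ i₁,
        χ (((2 : ℝ) ^ (q + 1))⁻¹ • waveVec k) ^ 2 *
        ∑ i, (torusCoeff (convective (stageField N L L' i₀ i₁ i₂)) i k *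
          star (torusCoeff (stageField N L L' i₀ i₁ i₂) i k)).re := by
  have ht := trigField N L L' i₀ i₁ i₂
  rw [dyadicFlux, lpLow, lpLow, torusInner_fourierMultiplier
    (v := convective (stageField N L L' i₀ i₁ i₂)) (ht.convective ht) ht
    (fun ξ => by rw [smul_neg, hχ.neg]), Finset.sum_union h.disjoint_freq, mul_add]

theorem sum_low_eq_transfer (h : StageParams d N L L' Q Q' i₀ i₁ i₂) :
    (2 * Real.pi) ^ d * ∑ k ∈ freqLow d N L i₁,
        ∑ i, (torusCoeff (convective (stageField N L L' i₀ i₁ i₂)) i k *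
          star (torusCoeff (stageField N L L' i₀ i₁ i₂) i k)).re = transfer N L L' i₀ i₁ i₂ := by
  have ht := trigField N L L' i₀ i₁ i₂
  have hV := trigField_fieldLow (d := d) N L i₁ i₂
  have hW := trigField_fieldHigh (d := d) N L L' i₀ i₁ i₂
  rw [transfer, torusInner_eq_sum (v := convective (stageField N L L' i₀ i₁ i₂))
    (ht.convective ht).contDiff.continuous hV]
  congr 1
  refine Finset.sum_congr rfl fun k hk => Finset.sum_congr rfl fun i _ => ?_
  have : torusCoeff (stageField N L L' i₀ i₁ i₂) i k = torusCoeff (fieldLow N L i₁ i₂) i k := by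
    rw [show stageField N L L' i₀ i₁ i₂ = fun x => fieldLow N L i₁ i₂ x +
      fieldHigh N L L' i₀ i₁ i₂ x from rfl, torusCoeff_add hV.contDiff.continuous
      hW.contDiff.continuous, hW.torusCoeff_of_notMem i
      (Finset.disjoint_left.1 h.disjoint_freq hk), add_zero]
  rw [this]

/-- The nonlinearity does no work in total, so the high frequencies gain what the low ones lose. -/
theorem sum_high_eq_neg_transfer (h : StageParams d N L L' Q Q' i₀ i₁ i₂) :
    (2 * Real.pi) ^ d * ∑ k ∈ freqHigh d N L L' i₀ i₁,
        ∑ i, (torusCoeff (convective (stageField N L L' i₀ i₁ i₂)) i k *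
          star (torusCoeff (stageField N L L' i₀ i₁ i₂) i k)).re = -transfer N L L' i₀ i₁ i₂ := by
  have ht := trigField N L L' i₀ i₁ i₂
  have h0 : torusInner (convective (stageField N L L' i₀ i₁ i₂)) (stageField N L L' i₀ i₁ i₂) = 0 :=
    integral_inner_transport_self ht.contDiff ht.contDiff ht.torusPeriodic ht.torusPeriodic
      (divergence_eq_zero N L L' i₀ i₁ i₂)
  rw [torusInner_eq_sum (v := convective (stageField N L L' i₀ i₁ i₂))
    (ht.convective ht).contDiff.continuous ht, Finset.sum_union h.disjoint_freq, mul_add,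
    h.sum_low_eq_transfer] at h0
  linarith

theorem scaled_le (hχ : IsLPCutoff χ) {K : ℝ}
    (hK : ∀ (ξ : Euc d) (η : ℝ), 0 ≤ η → ξ ≠ 0 → 1 - η ≤ ‖ξ‖ → χ ξ ≤ K * η) {p : ℕ} {ξ : Euc d}
    {δ : ℝ} (hδ : 0 ≤ δ) (h0 : ξ ≠ 0) (h : (2 : ℝ) ^ p - δ ≤ ‖ξ‖) :
    |χ (((2 : ℝ) ^ p)⁻¹ • ξ)| ≤ K * (δ / 2 ^ p) := by
  rw [abs_of_nonneg (hχ.nonneg _)]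
  have hp : (0 : ℝ) < 2 ^ p := by positivity
  refine hK _ _ (by positivity) (smul_ne_zero (inv_ne_zero hp.ne') h0) ?_
  rw [norm_smul, norm_inv, norm_pow, Real.norm_ofNat, one_sub_div hp.ne', ← div_eq_inv_mul]
  gcongr

theorem ne_zero_of_norm_ge {ξ : Euc d} {c : ℝ} (hc : 0 < c) (h : c ≤ ‖ξ‖) : ξ ≠ 0 :=
  norm_pos_iff.1 (hc.trans_le h)

/-- The filter is the identity on both spectra, and the gain and the loss cancel. -/
theorem dyadicFlux_of_ge (hχ : IsLPCutoff χ) (h : StageParams d N L L' Q Q' i₀ i₁ i₂) {q : ℕ}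
    (hq : Q' ≤ q) : dyadicFlux χ N L L' i₀ i₁ i₂ q = 0 := by
  have h1 : ∀ k ∈ freqLow d N L i₁ ∪ freqHigh d N L L' i₀ i₁,
      χ (((2 : ℝ) ^ (q + 1))⁻¹ • waveVec k) = 1 := by
    intro k hk
    refine hχ.scaled_eq_one ?_
    rw [pow_succ']
    exact mul_le_mul_of_nonneg_left ((h.freq_le hk).trans (pow_le_pow_right₀ one_le_two hq))
      two_pos.le
  rw [h.dyadicFlux_eq hχ,
    Finset.sum_congr rfl fun k hk => by rw [h1 k (Finset.mem_union_left _ hk), one_pow, one_mul],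
    h.sum_low_eq_transfer,
    Finset.sum_congr rfl fun k hk => by rw [h1 k (Finset.mem_union_right _ hk), one_pow, one_mul],
    h.sum_high_eq_neg_transfer, add_neg_cancel]

theorem fluxError_nonneg (K : ℝ) : 0 ≤ fluxError d N Q Q' K := by
  unfold fluxError; positivity

/-- The low spectrum passes unchanged. The high one is removed completely, except at the edge `q + 1
= Q'`, where the symbol is small of order `2 ^ Q / 2 ^ Q'`. -/
theorem abs_dyadicFlux_sub_le (hχ : IsLPCutoff χ) {K : ℝ}
    (hK : ∀ (ξ : Euc d) (η : ℝ), 0 ≤ η → ξ ≠ 0 → 1 - η ≤ ‖ξ‖ → χ ξ ≤ K * η)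
    (h : StageParams d N L L' Q Q' i₀ i₁ i₂) {q : ℕ} (hq : Q ≤ q) (hq' : q < Q') :
    |dyadicFlux χ N L L' i₀ i₁ i₂ q - transfer N L L' i₀ i₁ i₂| ≤ fluxError d N Q Q' K := by
  have ht := trigField N L L' i₀ i₁ i₂
  have h1 : ∀ k ∈ freqLow d N L i₁, χ (((2 : ℝ) ^ (q + 1))⁻¹ • waveVec k) = 1 := by
    intro k hk
    refine hχ.scaled_eq_one ?_
    rw [pow_succ']
    exact mul_le_mul_of_nonneg_left ((h.low_freq hk).1.trans (pow_le_pow_right₀ one_le_two hq))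
      two_pos.le
  rw [h.dyadicFlux_eq hχ,
    Finset.sum_congr rfl fun k hk => by rw [h1 k hk, one_pow, one_mul],
    h.sum_low_eq_transfer, add_sub_cancel_left]
  have h5 : (0 : ℝ) < 2 ^ Q := by positivity
  have hgap := h.gap_real
  rcases Nat.lt_or_ge (q + 1) Q' with hq1 | hq1
  · have h0 : ∀ k ∈ freqHigh d N L L' i₀ i₁, χ (((2 : ℝ) ^ (q + 1))⁻¹ • waveVec k) = 0 := by
      intro k hk
      refine hχ.scaled_eq_zero ?_
      have h2 : (2 : ℝ) * 2 ^ (q + 1) ≤ 2 ^ Q' := by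
        rw [← pow_succ']; exact pow_le_pow_right₀ one_le_two hq1
      linarith [(h.high_freq hk).2]
    rw [Finset.sum_congr rfl fun k hk => by
      rw [h0 k hk, zero_pow two_ne_zero, zero_mul], Finset.sum_const_zero, mul_zero, abs_zero]
    exact fluxError_nonneg K
  · obtain rfl : Q' = q + 1 := by omega
    have hb : ∀ k ∈ freqHigh d N L L' i₀ i₁, |χ (((2 : ℝ) ^ (q + 1))⁻¹ • waveVec k)| ≤
        K * (2 * 2 ^ Q / 2 ^ (q + 1)) := by
      intro k hk
      have h2 := (h.high_freq hk).2
      exact scaled_le hχ hK (by positivity)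
        (ne_zero_of_norm_ge (by linarith : (0 : ℝ) < 2 ^ (q + 1) - 2 * 2 ^ Q) h2) h2
    refine (abs_sum_filtered_le (ht.convective ht) ht hb).trans ?_
    rw [fluxError, add_mul]
    exact le_add_of_nonneg_of_le (by positivity)
      (mul_le_mul_of_nonneg_left h.sqrt_mul_sqrt_le (sq_nonneg _))

/-- The high spectrum is removed, and so is the low one except at the edge `q + 1 = Q`, where the
symbol is small of order `N / 2 ^ Q`. -/
theorem abs_dyadicFlux_le (hχ : IsLPCutoff χ) {K : ℝ}
    (hK : ∀ (ξ : Euc d) (η : ℝ), 0 ≤ η → ξ ≠ 0 → 1 - η ≤ ‖ξ‖ → χ ξ ≤ K * η)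
    (h : StageParams d N L L' Q Q' i₀ i₁ i₂) {q : ℕ} (hq : q < Q) :
    |dyadicFlux χ N L L' i₀ i₁ i₂ q| ≤ fluxError d N Q Q' K := by
  have ht := trigField N L L' i₀ i₁ i₂
  have h5 : (0 : ℝ) < 2 ^ Q := by positivity
  have hgap := h.gap_real
  have hsep := h.sep_real
  have h2 : (2 : ℝ) ^ (q + 1) ≤ 2 ^ Q := pow_le_pow_right₀ one_le_two hq
  have h0 : ∀ k ∈ freqHigh d N L L' i₀ i₁, χ (((2 : ℝ) ^ (q + 1))⁻¹ • waveVec k) = 0 := by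
    intro k hk
    refine hχ.scaled_eq_zero ?_
    linarith [(h.high_freq hk).2]
  rw [h.dyadicFlux_eq hχ, Finset.sum_congr (s₁ := freqHigh d N L L' i₀ i₁) rfl fun k hk => by
      rw [h0 k hk, zero_pow two_ne_zero, zero_mul], Finset.sum_const_zero, mul_zero, add_zero]
  have hb : ∀ k ∈ freqLow d N L i₁, |χ (((2 : ℝ) ^ (q + 1))⁻¹ • waveVec k)| ≤
      |K| * (4 * d ^ 2 * N / 2 ^ Q) := by
    intro k hk
    have h3 := (h.low_freq hk).2
    have h4 : waveVec k ≠ 0 := ne_zero_of_norm_ge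
      (by linarith : (0 : ℝ) < 2 ^ Q - 4 * d ^ 2 * N) h3
    rcases Nat.lt_or_ge (q + 1) Q with hq1 | hq1
    · have h6 : (2 : ℝ) * 2 ^ (q + 1) ≤ 2 ^ Q := by
        rw [← pow_succ']; exact pow_le_pow_right₀ one_le_two hq1
      rw [hχ.scaled_eq_zero (by linarith), abs_zero]
      positivity
    · obtain rfl : Q = q + 1 := by omega
      exact (scaled_le hχ hK (by positivity) h4 h3).trans
        (mul_le_mul_of_nonneg_right (le_abs_self K) (by positivity))
  refine (abs_sum_filtered_le (ht.convective ht) ht hb).trans ?_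
  rw [fluxError, add_mul, mul_pow |K|, sq_abs, ← mul_pow]
  exact le_add_of_le_of_nonneg
    (mul_le_mul_of_nonneg_left h.sqrt_mul_sqrt_le (sq_nonneg _)) (by positivity)

end StageParams

/-! ### Gluing stages in time -/

/-- A smooth bump function supported in the unit interval. -/
def unitBump : ContDiffBump (1 / 2 : ℝ) := ⟨1 / 8, 1 / 4, by norm_num, by norm_num⟩

/-- The beginning of the time interval with index `m`. -/
def stageStart (T : ℝ) (m : ℕ) : ℝ := T * (1 - (1 / 2) ^ (m + 1))

/-- The time interval with index `m`. -/
def stageTime (T : ℝ) (τ : ℕ → ℝ) (m : ℕ) : Set ℝ := Ioo (stageStart T m) (stageStart T m + τ m)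

/-- The rescaled bump function supported in the time interval with index `m`. -/
def timeBump (T : ℝ) (τ : ℕ → ℝ) (m : ℕ) (t : ℝ) : ℝ := unitBump ((t - stageStart T m) / τ m)

/-- The closed support lies strictly inside the unit interval, so the derivative vanishes outside as
well. -/
theorem unitBump_eq_zero {t : ℝ} (ht : t ∉ Ioo (0 : ℝ) 1) : unitBump t = 0 ∧ deriv unitBump t = 0 := by
  have h : t ∉ tsupport (unitBump : ℝ → ℝ) := by
    rw [ContDiffBump.tsupport_eq, Metric.mem_closedBall, Real.dist_eq]
    intro h
    have h2 : |t - 1 / 2| ≤ 1 / 4 := h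
    rw [abs_le] at h2
    exact ht ⟨by linarith, by linarith⟩
  exact ⟨image_eq_zero_of_notMem_tsupport h, by
    by_contra h0
    exact h (support_deriv_subset (Function.mem_support.2 h0))⟩

theorem exists_abs_deriv_unitBump_le : ∃ C : ℝ, 0 < C ∧ ∀ t, |deriv unitBump t| ≤ C := by
  have hc : Continuous (deriv (unitBump : ℝ → ℝ)) :=
    (unitBump.contDiff (n := 1)).continuous_deriv le_rfl
  obtain ⟨C, hC⟩ := hc.bounded_above_of_compact_support unitBump.hasCompactSupport.deriv
  exact ⟨|C| + 1, by positivity, fun t => (hC t).trans ((le_abs_self C).trans (by linarith))⟩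

theorem integral_unitBump_cube_pos : 0 < ∫ t, unitBump t ^ 3 := by
  refine Continuous.integral_pos_of_hasCompactSupport_nonneg_nonzero (x := 1 / 2)
    (unitBump.continuous.pow 3) ?_ (fun t => pow_nonneg unitBump.nonneg 3) ?_
  · exact unitBump.hasCompactSupport.comp_left (g := fun y : ℝ => y ^ 3) (by norm_num)
  · have : unitBump (1 / 2 : ℝ) = 1 := unitBump.one_of_mem_closedBall (by
      rw [Metric.mem_closedBall, dist_self]; exact unitBump.rIn_pos.le)
    simp only [this]
    norm_num

/-- Durations of successive stages, and divergence-free trigonometric fields to be used in them. -/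
structure StageFamily {d : ℕ} (T : ℝ) (τ : ℕ → ℝ) (S : ℕ → Finset (Fin d → ℤ))
    (U : ℕ → Euc d → Euc d) : Prop where
  T_pos : 0 < T
  τ_pos : ∀ m, 0 < τ m
  -- The right-hand side is the distance between consecutive values of `stageStart`, so the stages
  -- do not overlap.
  τ_le : ∀ m, τ m ≤ T * (1 / 2) ^ (m + 2)
  trig : ∀ m, TrigField (S m) (U m)
  div_free : ∀ m x, divergence (U m) x = 0

/-- The force that drives a stage. -/
def stageForce {d : ℕ} (T : ℝ) (τ : ℕ → ℝ) (U : ℕ → Euc d → Euc d) (m : ℕ) (t : ℝ) (x : Euc d) :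
    Euc d :=
  deriv (timeBump T τ m) t • U m x - timeBump T τ m t • Laplacian.laplacian (U m) x +
    timeBump T τ m t ^ 2 • divTensor (U m) x

/-- The velocity that runs through all stages. -/
def gluedField {d : ℕ} (T : ℝ) (τ : ℕ → ℝ) (U : ℕ → Euc d → Euc d) (t : ℝ) (x : Euc d) : Euc d :=
  ∑' m, timeBump T τ m t • U m x

/-- The force that drives the velocity through all stages. -/
def gluedForce {d : ℕ} (T : ℝ) (τ : ℕ → ℝ) (U : ℕ → Euc d → Euc d) (t : ℝ) (x : Euc d) : Euc d :=
  ∑' m, stageForce T τ U m t x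

theorem contDiff_timeBump (T : ℝ) (τ : ℕ → ℝ) (m : ℕ) : ContDiff ℝ ∞ (timeBump T τ m) :=
  unitBump.contDiff.comp ((contDiff_id.sub contDiff_const).div_const _)

theorem deriv_timeBump (T : ℝ) (τ : ℕ → ℝ) (m : ℕ) (t : ℝ) :
    deriv (timeBump T τ m) t = deriv unitBump ((t - stageStart T m) / τ m) * (τ m)⁻¹ := by
  have h1 : HasDerivAt (fun t => (t - stageStart T m) / τ m) (1 / τ m) t :=
    ((hasDerivAt_id t).sub_const _).div_const _
  have h2 : DifferentiableAt ℝ unitBump ((t - stageStart T m) / τ m) :=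
    (unitBump.contDiff (n := 1)).differentiable one_ne_zero _
  rw [← one_div]
  exact (h2.hasDerivAt.comp t h1).deriv

theorem timeBump_nonneg (T : ℝ) (τ : ℕ → ℝ) (m : ℕ) (t : ℝ) : 0 ≤ timeBump T τ m t :=
  unitBump.nonneg

theorem timeBump_le_one (T : ℝ) (τ : ℕ → ℝ) (m : ℕ) (t : ℝ) : timeBump T τ m t ≤ 1 :=
  unitBump.le_one

theorem stageStart_succ (T : ℝ) (m : ℕ) :
    stageStart T (m + 1) = stageStart T m + T * (1 / 2) ^ (m + 2) := by
  unfold stageStart; ring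

theorem stageStart_zero (T : ℝ) : stageStart T 0 = T / 2 := by
  unfold stageStart; ring

namespace StageFamily

variable {d : ℕ} {T : ℝ} {τ : ℕ → ℝ} {S : ℕ → Finset (Fin d → ℤ)} {U : ℕ → Euc d → Euc d}

theorem timeBump_eq_zero (h : StageFamily T τ S U) {m : ℕ} {t : ℝ} (ht : t ∉ stageTime T τ m) :
    timeBump T τ m t = 0 ∧ deriv (timeBump T τ m) t = 0 := by
  have h1 : (t - stageStart T m) / τ m ∉ Ioo (0 : ℝ) 1 := by
    intro ⟨h1, h2⟩
    have h3 := h.τ_pos m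
    rw [div_pos_iff_of_pos_right h3] at h1
    rw [div_lt_one h3] at h2
    exact ht ⟨by linarith, by linarith⟩
  obtain ⟨h2, h3⟩ := unitBump_eq_zero h1
  exact ⟨h2, by rw [deriv_timeBump, h3, zero_mul]⟩

theorem integral_timeBump_cube (h : StageFamily T τ S U) (m : ℕ) :
    ∫ t, timeBump T τ m t ^ 3 = τ m * ∫ t, unitBump t ^ 3 := by
  have h1 := integral_sub_right_eq_self (μ := volume) (fun t => unitBump (t / τ m) ^ 3)
    (stageStart T m)
  have h2 := Measure.integral_comp_div (fun t => unitBump t ^ 3) (τ m)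
  rw [abs_of_pos (h.τ_pos m), smul_eq_mul] at h2
  rw [← h2, ← h1]
  rfl

theorem stageStart_mono (h : StageFamily T τ S U) : Monotone (stageStart T) :=
  monotone_nat_of_le_succ fun m => by
    rw [stageStart_succ]
    have := h.T_pos
    have : 0 ≤ T * (1 / 2) ^ (m + 2) := by positivity
    linarith

theorem stageStart_add_le (h : StageFamily T τ S U) (m : ℕ) :
    stageStart T m + τ m ≤ stageStart T (m + 1) := by
  rw [stageStart_succ]
  linarith [h.τ_le m]

theorem stageStart_lt (h : StageFamily T τ S U) (m : ℕ) : stageStart T m < T := by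
  have := h.T_pos
  have : 0 < T * (1 / 2) ^ (m + 1) := by positivity
  unfold stageStart
  linarith

theorem exists_lt_stageStart (_ : StageFamily T τ S U) {t : ℝ} (ht : t < T) :
    ∃ m, t < stageStart T m := by
  have h1 : Tendsto (stageStart T) atTop (𝓝 (T * (1 - 0))) :=
    ((tendsto_const_nhds.sub ((tendsto_add_atTop_iff_nat 1).2
      (tendsto_pow_atTop_nhds_zero_of_lt_one (by norm_num) (by norm_num)))).const_mul T)
  rw [sub_zero, mul_one] at h1
  exact (h1.eventually (lt_mem_nhds ht)).exists

theorem stageTime_subset (h : StageFamily T τ S U) (m : ℕ) : stageTime T τ m ⊆ Ioo (T / 2) T := by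
  intro t ht
  have h1 := h.stageStart_mono (Nat.zero_le m)
  rw [stageStart_zero] at h1
  exact ⟨h1.trans_lt ht.1, ht.2.trans ((h.stageStart_add_le m).trans_lt (h.stageStart_lt _))⟩

theorem disjoint_stageTime (h : StageFamily T τ S U) {k m : ℕ} (hkm : k ≠ m) {t : ℝ}
    (ht : t ∈ stageTime T τ m) : t ∉ stageTime T τ k := by
  intro hk
  rcases hkm.lt_or_gt with hlt | hlt
  · exact lt_irrefl t ((hk.2.trans_le ((h.stageStart_add_le k).trans (h.stageStart_mono hlt))).trans
      ht.1)
  · exact lt_irrefl t ((ht.2.trans_le ((h.stageStart_add_le m).trans (h.stageStart_mono hlt))).trans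
      hk.1)

/-- At each time at most one stage is active. -/
theorem exists_stage (h : StageFamily T τ S U) (t : ℝ) :
    ∃ m, ∀ k ≠ m, timeBump T τ k t = 0 ∧ deriv (timeBump T τ k) t = 0 := by
  by_cases ht : ∃ m, t ∈ stageTime T τ m
  · obtain ⟨m, hm⟩ := ht
    exact ⟨m, fun k hk => h.timeBump_eq_zero (h.disjoint_stageTime hk hm)⟩
  · push Not at ht
    exact ⟨0, fun k _ => h.timeBump_eq_zero (ht k)⟩

theorem stageForce_eq_zero {m : ℕ} {t : ℝ}
    (hm : timeBump T τ m t = 0 ∧ deriv (timeBump T τ m) t = 0) : stageForce T τ U m t = 0 := by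
  funext x
  simp [stageForce, hm.1, hm.2]

theorem glued_eq {m : ℕ} {t : ℝ}
    (hm : ∀ k ≠ m, timeBump T τ k t = 0 ∧ deriv (timeBump T τ k) t = 0) :
    gluedField T τ U t = timeBump T τ m t • U m ∧
      gluedForce T τ U t = stageForce T τ U m t := by
  constructor
  · funext x
    exact tsum_eq_single m fun k hk => by rw [(hm k hk).1, zero_smul]
  · funext x
    exact tsum_eq_single m fun k hk => by rw [stageForce_eq_zero (hm k hk)]; rfl

theorem glued_of_mem (h : StageFamily T τ S U) {m : ℕ} {t : ℝ} (hm : t ∈ stageTime T τ m) :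
    gluedField T τ U t = timeBump T τ m t • U m ∧
      gluedForce T τ U t = stageForce T τ U m t :=
  glued_eq fun _ hk => h.timeBump_eq_zero (h.disjoint_stageTime hk hm)

theorem glued_of_notMem (h : StageFamily T τ S U) {t : ℝ} (ht : ∀ m, t ∉ stageTime T τ m) :
    gluedField T τ U t = 0 ∧ gluedForce T τ U t = 0 := by
  have h1 := glued_eq (U := U) (m := 0) fun k _ => h.timeBump_eq_zero (ht k)
  rw [(h.timeBump_eq_zero (ht 0)).1, zero_smul, stageForce_eq_zero (h.timeBump_eq_zero (ht 0))] at h1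
  exact h1

theorem glued_of_le (h : StageFamily T τ S U) {t : ℝ} (ht : t ≤ T / 2) :
    gluedField T τ U t = 0 ∧ gluedForce T τ U t = 0 :=
  h.glued_of_notMem fun m hm => (h.stageTime_subset m hm).1.not_ge ht

theorem glued_of_ge (h : StageFamily T τ S U) {t : ℝ} (ht : T ≤ t) :
    gluedField T τ U t = 0 ∧ gluedForce T τ U t = 0 :=
  h.glued_of_notMem fun m hm => (h.stageTime_subset m hm).2.not_ge ht

theorem notMem_stageTime (h : StageFamily T τ S U) {M m : ℕ} (hm : m ∉ Finset.range M) {t : ℝ}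
    (ht : t < stageStart T M) : t ∉ stageTime T τ m := fun hmem => by
  have h1 := h.stageStart_mono (not_lt.1 fun hlt => hm (Finset.mem_range.2 hlt))
  linarith [hmem.1]

theorem gluedField_eq_sum (h : StageFamily T τ S U) {M : ℕ} {t : ℝ} (ht : t < stageStart T M)
    (x : Euc d) : gluedField T τ U t x = ∑ m ∈ Finset.range M, timeBump T τ m t • U m x :=
  tsum_eq_sum fun m hm => by
    rw [(h.timeBump_eq_zero (h.notMem_stageTime hm ht)).1, zero_smul]

theorem gluedForce_eq_sum (h : StageFamily T τ S U) {M : ℕ} {t : ℝ} (ht : t < stageStart T M)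
    (x : Euc d) : gluedForce T τ U t x = ∑ m ∈ Finset.range M, stageForce T τ U m t x :=
  tsum_eq_sum fun m hm => by
    rw [stageForce_eq_zero (h.timeBump_eq_zero (h.notMem_stageTime hm ht))]; rfl

/-- Near a time before `T` the series reduces to one fixed finite sum, because the starting times of
the stages converge to `T`. -/
theorem contDiffOn_of_eq_sum (h : StageFamily T τ S U) {g : ℝ → Euc d → Euc d}
    {G : ℕ → ℝ → Euc d → Euc d} (hG : ∀ m, ContDiff ℝ ∞ fun z : ℝ × Euc d => G m z.1 z.2)
    (hg : ∀ M t, t < stageStart T M → ∀ x, g t x = ∑ m ∈ Finset.range M, G m t x) :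
    ContDiffOn ℝ ∞ (fun z : ℝ × Euc d => g z.1 z.2) (Ioo 0 T ×ˢ univ) := by
  intro z hz
  obtain ⟨M, hM⟩ := h.exists_lt_stageStart hz.1.2
  refine ContDiffAt.contDiffWithinAt ?_
  have h1 : ContDiff ℝ ∞ fun z : ℝ × Euc d => ∑ m ∈ Finset.range M, G m z.1 z.2 :=
    ContDiff.sum fun m _ => hG m
  refine h1.contDiffAt.congr_of_eventuallyEq ?_
  filter_upwards [continuous_fst.continuousAt.eventually (gt_mem_nhds hM)] with w hw
  exact hg M w.1 hw w.2

theorem smoothOnQ_gluedField (h : StageFamily T τ S U) : SmoothOnQ T (gluedField T τ U) := by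
  refine ⟨h.contDiffOn_of_eq_sum (G := fun m t x => timeBump T τ m t • U m x) (fun m => ?_)
    fun M t ht x => h.gluedField_eq_sum ht x, fun t _ x j => ?_⟩
  · exact ((contDiff_timeBump T τ m).comp contDiff_fst).smul ((h.trig m).contDiff.comp contDiff_snd)
  · unfold gluedField
    simp only [(h.trig _).torusPeriodic x j]

theorem smoothOnQ_gluedForce (h : StageFamily T τ S U) : SmoothOnQ T (gluedForce T τ U) := by
  refine ⟨h.contDiffOn_of_eq_sum (G := fun m t x => stageForce T τ U m t x) (fun m => ?_)
    fun M t ht x => h.gluedForce_eq_sum ht x, fun t _ x j => ?_⟩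
  · have h1 : ContDiff ℝ ∞ (deriv (timeBump T τ m)) :=
      (contDiff_infty_iff_deriv.1 (contDiff_timeBump T τ m)).2
    have h2 := (h.trig m).contDiff
    exact (((h1.comp contDiff_fst).smul (h2.comp contDiff_snd)).sub
      (((contDiff_timeBump T τ m).comp contDiff_fst).smul
        ((contDiff_laplacian h2).comp contDiff_snd))).add
      ((((contDiff_timeBump T τ m).comp contDiff_fst).pow 2).smul
        ((contDiff_divTensor h2).comp contDiff_snd))
  · unfold gluedForce stageForce
    simp only [(h.trig _).torusPeriodic x j,
      torusPeriodic_laplacian (h.trig _).contDiff (h.trig _).torusPeriodic x j,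
      torusPeriodic_divTensor (h.trig _).torusPeriodic x j]

end StageFamily

/-! ### Homogeneity -/

theorem energySq_smul {d : ℕ} (c : ℝ) (v : Euc d → Euc d) : energySq (c • v) = c ^ 2 * energySq v := by
  simp [energySq, norm_smul, mul_pow, integral_const_mul]

theorem fderiv_smul_field {d : ℕ} (c : ℝ) (v : Euc d → Euc d) (x : Euc d) :
    fderiv ℝ (c • v) x = c • fderiv ℝ v x := by
  rw [fderiv_const_smul_field]; rfl

theorem dissipationSq_smul {d : ℕ} (c : ℝ) (v : Euc d → Euc d) :
    dissipationSq (c • v) = c ^ 2 * dissipationSq v := by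
  simp [dissipationSq, fderiv_smul_field, norm_smul, mul_pow, integral_const_mul, ← Finset.mul_sum]

theorem torusInner_smul_left {d : ℕ} (c : ℝ) (v w : Euc d → Euc d) :
    torusInner (c • v) w = c * torusInner v w := by
  simp [torusInner, inner_smul_left, integral_const_mul]

theorem torusInner_smul_right {d : ℕ} (c : ℝ) (v w : Euc d → Euc d) :
    torusInner v (c • w) = c * torusInner v w := by
  rw [torusInner_comm, torusInner_smul_left, torusInner_comm]

theorem torusInner_add_left {d : ℕ} {v w φ : Euc d → Euc d} (hv : Continuous v) (hw : Continuous w)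
    (hφ : Continuous φ) : torusInner (v + w) φ = torusInner v φ + torusInner w φ := by
  simp only [torusInner, Pi.add_apply, inner_add_left]
  exact integral_add (f := fun x => inner ℝ (v x) (φ x)) (hv.inner hφ).integrable_torus
    (hw.inner hφ).integrable_torus

theorem divergence_smul {d : ℕ} (c : ℝ) (v : Euc d → Euc d) (x : Euc d) :
    divergence (c • v) x = c * divergence v x := by
  simp [divergence, fderiv_smul_field, Finset.mul_sum]

theorem convective_smul {d : ℕ} (c : ℝ) (v : Euc d → Euc d) :
    convective (c • v) = c ^ 2 • convective v := by
  funext x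
  simp [convective, fderiv_smul_field, smul_smul, sq]

theorem divTensor_smul {d : ℕ} (c : ℝ) (v : Euc d → Euc d) :
    divTensor (c • v) = c ^ 2 • divTensor v := by
  funext x
  have : ∀ j, (fun y => (c • v) y j • (c • v) y) = c ^ 2 • fun y => v y j • v y := by
    intro j
    funext y
    simp only [Pi.smul_apply, PiLp.smul_apply, smul_eq_mul, smul_smul]
    congr 1
    ring
  rw [Pi.smul_apply, divTensor, divTensor, Finset.smul_sum]
  refine Finset.sum_congr rfl fun j _ => ?_
  rw [this, fderiv_smul_field]
  rfl

theorem lpLow_smul {d : ℕ} (χ : Euc d → ℝ) (q : ℕ) (c : ℝ) (v : Euc d → Euc d) :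
    lpLow χ q (c • v) = c • lpLow χ q v :=
  fourierMultiplier_smul _ c v

theorem gradient_zero_field {d : ℕ} (x : Euc d) : gradient (fun _ : Euc d => (0 : ℝ)) x = 0 :=
  gradient_fun_const x 0

theorem abs_torusInner_le {d : ℕ} {v φ : Euc d → Euc d} (hv : Continuous v)
    (hφ : MemLp φ 2 (torusMeasure d)) :
    |torusInner v φ| ≤ Real.sqrt (energySq v) * (eLpNorm φ 2 (torusMeasure d)).toReal := by
  have hm : MemLp v 2 (torusMeasure d) :=
    (memLp_two_iff_integrable_sq_norm hv.aestronglyMeasurable).2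
      (hv.norm.pow 2).integrable_torus
  have h1 : torusInner v φ = inner ℝ (hm.toLp v) (hφ.toLp φ) := by
    rw [L2.inner_def]
    refine integral_congr_ae ?_
    filter_upwards [hm.coeFn_toLp, hφ.coeFn_toLp] with x h1 h2
    rw [h1, h2]
  rw [h1]
  refine (abs_real_inner_le_norm _ _).trans (le_of_eq ?_)
  rw [Lp.norm_toLp, Lp.norm_toLp, eLpNorm_two_torus hv, ENNReal.toReal_ofReal (Real.sqrt_nonneg _)]

namespace StageFamily

variable {d : ℕ} {T : ℝ} {τ : ℕ → ℝ} {S : ℕ → Finset (Fin d → ℤ)} {U : ℕ → Euc d → Euc d}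

/-! ### The equation and the energy balance -/

/-- With zero pressure. At each time at most one stage is active, so the quadratic term has no
interactions between stages and the forces simply add up. -/
theorem solvesNavierStokes (h : StageFamily T τ S U) :
    SolvesNavierStokes T (gluedField T τ U) (gluedForce T τ U) := by
  refine ⟨fun _ _ => 0, ⟨contDiffOn_const, fun _ _ _ _ => rfl⟩, fun t ht x => ?_⟩
  obtain ⟨m, hm⟩ := h.exists_stage t
  obtain ⟨M, hM⟩ := h.exists_lt_stageStart ht.2
  obtain ⟨e1, e2⟩ := glued_eq (U := U) hm
  have hd : HasDerivAt (fun s => gluedField T τ U s x)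
      (∑ k ∈ Finset.range M, deriv (timeBump T τ k) t • U k x) t := by
    have h1 : HasDerivAt (fun s => ∑ k ∈ Finset.range M, timeBump T τ k s • U k x)
        (∑ k ∈ Finset.range M, deriv (timeBump T τ k) t • U k x) t :=
      HasDerivAt.fun_sum fun k _ =>
        (((contDiff_timeBump T τ k).differentiable (by simp) t).hasDerivAt.smul_const (U k x))
    refine h1.congr_of_eventuallyEq ?_
    filter_upwards [gt_mem_nhds hM] with s hs
    exact h.gluedField_eq_sum hs x
  have hs : ∑ k ∈ Finset.range M, deriv (timeBump T τ k) t • U k x =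
      deriv (timeBump T τ m) t • U m x := by
    refine Finset.sum_eq_single m (fun k _ hk => by rw [(hm k hk).2, zero_smul]) fun hk => ?_
    rw [(h.timeBump_eq_zero (h.notMem_stageTime hk hM)).2, zero_smul]
  rw [hd.deriv, hs, e1, e2, divergence_smul, h.div_free, mul_zero, gradient_zero_field, add_zero,
    divTensor_smul, InnerProductSpace.laplacian_smul _
      ((h.trig m).contDiff.contDiffAt.of_le ENat.LEInfty.out)]
  exact ⟨rfl, rfl⟩

theorem torusInner_stageForce (h : StageFamily T τ S U) (m : ℕ) (t : ℝ) {φ : Euc d → Euc d}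
    (hφ : Continuous φ) : torusInner (stageForce T τ U m t) φ =
      deriv (timeBump T τ m) t * torusInner (U m) φ -
        timeBump T τ m t * torusInner (Laplacian.laplacian (U m)) φ +
        timeBump T τ m t ^ 2 * torusInner (divTensor (U m)) φ := by
  have hU := (h.trig m).contDiff
  have e : stageForce T τ U m t = (deriv (timeBump T τ m) t • U m +
      (-timeBump T τ m t) • Laplacian.laplacian (U m)) +
        timeBump T τ m t ^ 2 • divTensor (U m) := by
    funext x
    simp [stageForce, sub_eq_add_neg]
  have h1 : Continuous (deriv (timeBump T τ m) t • U m) := hU.continuous.const_smul _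
  have h2 : Continuous ((-timeBump T τ m t) • Laplacian.laplacian (U m)) :=
    (contDiff_laplacian hU).continuous.const_smul _
  have h3 : Continuous (timeBump T τ m t ^ 2 • divTensor (U m)) :=
    (contDiff_divTensor hU).continuous.const_smul _
  rw [e, torusInner_add_left (h1.add h2) h3 hφ, torusInner_add_left h1 h2 hφ, torusInner_smul_left,
    torusInner_smul_left, torusInner_smul_left]
  ring

theorem torusInner_divTensor_self (h : StageFamily T τ S U) (m : ℕ) :
    torusInner (divTensor (U m)) (U m) = 0 := by
  have hU := (h.trig m)
  rw [show divTensor (U m) = convective (U m) from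
    funext (divTensor_eq_convective hU.contDiff (h.div_free m))]
  exact integral_inner_transport_self hU.contDiff hU.contDiff hU.torusPeriodic hU.torusPeriodic
    (h.div_free m)

/-- The nonlinear part of the force does no work. The first term is the time derivative of half the
energy. -/
theorem work_eq (h : StageFamily T τ S U) (m : ℕ) (t : ℝ) :
    torusInner (timeBump T τ m t • U m) (stageForce T τ U m t) =
      timeBump T τ m t * deriv (timeBump T τ m) t * energySq (U m) +
        timeBump T τ m t ^ 2 * dissipationSq (U m) := by
  have hU := (h.trig m)
  rw [torusInner_smul_left, torusInner_comm, h.torusInner_stageForce m t hU.contDiff.continuous,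
    h.torusInner_divTensor_self, torusInner_laplacian_self hU.contDiff hU.torusPeriodic,
    energySq_eq_torusInner]
  ring

theorem sum_eq_of_stage (h : StageFamily T τ S U) {a : ℕ → ℝ} {t : ℝ} {M m : ℕ}
    (ht : t < stageStart T M)
    (hm : ∀ k ≠ m, timeBump T τ k t = 0 ∧ deriv (timeBump T τ k) t = 0)
    (ha : ∀ k, timeBump T τ k t = 0 → a k = 0) : ∑ k ∈ Finset.range M, a k = a m :=
  Finset.sum_eq_single m (fun k _ hk => ha k (hm k hk).1) fun hk =>
    ha m (h.timeBump_eq_zero (h.notMem_stageTime hk ht)).1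

theorem energySq_eq_sum (h : StageFamily T τ S U) {M : ℕ} {t : ℝ} (ht : t < stageStart T M) :
    energySq (gluedField T τ U t) =
      ∑ m ∈ Finset.range M, timeBump T τ m t ^ 2 * energySq (U m) := by
  obtain ⟨m, hm⟩ := h.exists_stage t
  rw [h.sum_eq_of_stage ht hm (fun k hk => by rw [hk]; ring), (glued_eq hm).1, energySq_smul]

theorem dissipationSq_eq_sum (h : StageFamily T τ S U) {M : ℕ} {t : ℝ} (ht : t < stageStart T M) :
    dissipationSq (gluedField T τ U t) =
      ∑ m ∈ Finset.range M, timeBump T τ m t ^ 2 * dissipationSq (U m) := by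
  obtain ⟨m, hm⟩ := h.exists_stage t
  rw [h.sum_eq_of_stage ht hm (fun k hk => by rw [hk]; ring), (glued_eq hm).1, dissipationSq_smul]

theorem work_eq_sum (h : StageFamily T τ S U) {M : ℕ} {t : ℝ} (ht : t < stageStart T M) :
    torusInner (gluedField T τ U t) (gluedForce T τ U t) =
      ∑ m ∈ Finset.range M, (timeBump T τ m t * deriv (timeBump T τ m) t * energySq (U m) +
        timeBump T τ m t ^ 2 * dissipationSq (U m)) := by
  obtain ⟨m, hm⟩ := h.exists_stage t
  rw [h.sum_eq_of_stage ht hm (fun k hk => by rw [hk]; ring), (glued_eq hm).1, (glued_eq hm).2,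
    h.work_eq]

theorem continuous_deriv_timeBump (m : ℕ) : Continuous (deriv (timeBump T τ m)) :=
  (contDiff_timeBump T τ m).continuous_deriv (by simp)

/-- Up to a time before `T` everything is a finite sum, and the fundamental theorem of calculus
applies. -/
theorem integral_work (h : StageFamily T τ S U) {a b : ℝ} (hab : a ≤ b) (hb : b < T) :
    ∫ t in a..b, torusInner (gluedField T τ U t) (gluedForce T τ U t) =
      energySq (gluedField T τ U b) / 2 - energySq (gluedField T τ U a) / 2 +
        ∫ t in a..b, dissipationSq (gluedField T τ U t) := by
  obtain ⟨M, hM⟩ := h.exists_lt_stageStart hb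
  have hlt : ∀ t ∈ uIcc a b, t < stageStart T M := fun t ht => by
    rw [uIcc_of_le hab] at ht
    exact ht.2.trans_lt hM
  have hc := fun m => (contDiff_timeBump T τ m).continuous
  have hc' := fun m => continuous_deriv_timeBump (T := T) (τ := τ) m
  have c1 : Continuous fun t => ∑ m ∈ Finset.range M,
      timeBump T τ m t * deriv (timeBump T τ m) t * energySq (U m) :=
    continuous_finsetSum _ fun m _ => ((hc m).mul (hc' m)).mul continuous_const
  have c2 : Continuous fun t => ∑ m ∈ Finset.range M,
      timeBump T τ m t ^ 2 * dissipationSq (U m) :=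
    continuous_finsetSum _ fun m _ => ((hc m).pow 2).mul continuous_const
  rw [intervalIntegral.integral_congr fun t ht => h.work_eq_sum (hlt t ht),
    intervalIntegral.integral_congr (g := fun t => ∑ m ∈ Finset.range M,
      timeBump T τ m t ^ 2 * dissipationSq (U m)) fun t ht => h.dissipationSq_eq_sum (hlt t ht)]
  simp only [Finset.sum_add_distrib]
  rw [intervalIntegral.integral_add (c1.intervalIntegrable _ _) (c2.intervalIntegrable _ _)]
  congr 1
  have hd : ∀ t ∈ uIcc a b, HasDerivAt
      (fun t => (∑ m ∈ Finset.range M, timeBump T τ m t ^ 2 * energySq (U m)) / 2)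
      (∑ m ∈ Finset.range M, timeBump T τ m t * deriv (timeBump T τ m) t * energySq (U m)) t := by
    intro t _
    have h1 : HasDerivAt (fun t => ∑ m ∈ Finset.range M, timeBump T τ m t ^ 2 * energySq (U m))
        (∑ m ∈ Finset.range M, (2 * timeBump T τ m t ^ (2 - 1) * deriv (timeBump T τ m) t) *
          energySq (U m)) t :=
      HasDerivAt.fun_sum fun m _ => by
        have := (((contDiff_timeBump T τ m).differentiable (by simp) t).hasDerivAt.pow 2).mul_const
          (energySq (U m))
        exact_mod_cast this
    refine (h1.div_const 2).congr_deriv ?_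
    rw [Finset.sum_div]
    exact Finset.sum_congr rfl fun m _ => by ring
  rw [intervalIntegral.integral_eq_sub_of_hasDerivAt hd (c1.intervalIntegrable _ _),
    h.energySq_eq_sum hM, h.energySq_eq_sum (hab.trans_lt hM)]

theorem continuousAt_energySq (h : StageFamily T τ S U) {t : ℝ} (ht : t < T) :
    ContinuousAt (fun t => energySq (gluedField T τ U t)) t := by
  obtain ⟨M, hM⟩ := h.exists_lt_stageStart ht
  have hc := fun m => (contDiff_timeBump T τ m).continuous
  have c2 : Continuous fun t => ∑ m ∈ Finset.range M, timeBump T τ m t ^ 2 * energySq (U m) :=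
    continuous_finsetSum _ fun m _ => ((hc m).pow 2).mul continuous_const
  refine c2.continuousAt.congr ?_
  filter_upwards [gt_mem_nhds hM] with s hs
  exact (h.energySq_eq_sum hs).symm

theorem continuousAt_dissipationSq (h : StageFamily T τ S U) {t : ℝ} (ht : t < T) :
    ContinuousAt (fun t => dissipationSq (gluedField T τ U t)) t := by
  obtain ⟨M, hM⟩ := h.exists_lt_stageStart ht
  have hc := fun m => (contDiff_timeBump T τ m).continuous
  have c2 : Continuous fun t => ∑ m ∈ Finset.range M, timeBump T τ m t ^ 2 * dissipationSq (U m) :=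
    continuous_finsetSum _ fun m _ => ((hc m).pow 2).mul continuous_const
  refine c2.continuousAt.congr ?_
  filter_upwards [gt_mem_nhds hM] with s hs
  exact (h.dissipationSq_eq_sum hs).symm

theorem continuousAt_work (h : StageFamily T τ S U) {t : ℝ} (ht : t < T) :
    ContinuousAt (fun t => torusInner (gluedField T τ U t) (gluedForce T τ U t)) t := by
  obtain ⟨M, hM⟩ := h.exists_lt_stageStart ht
  have hc := fun m => (contDiff_timeBump T τ m).continuous
  have hc' := fun m => continuous_deriv_timeBump (T := T) (τ := τ) m
  have c2 : Continuous fun t => ∑ m ∈ Finset.range M,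
      (timeBump T τ m t * deriv (timeBump T τ m) t * energySq (U m) +
        timeBump T τ m t ^ 2 * dissipationSq (U m)) :=
    continuous_finsetSum _ fun m _ => (((hc m).mul (hc' m)).mul continuous_const).add
      (((hc m).pow 2).mul continuous_const)
  refine c2.continuousAt.congr ?_
  filter_upwards [gt_mem_nhds hM] with s hs
  exact (h.work_eq_sum hs).symm

/-! ### Limits and integrability in time -/

/-- A function that is small during the late stages tends to zero at the final time. -/
theorem tendsto_zero_end (h : StageFamily T τ S U) {g : ℝ → ℝ} {δ : ℕ → ℝ}
    (hδ : Tendsto δ atTop (𝓝 0)) (hg : ∀ m, ∀ t ∈ stageTime T τ m, |g t| ≤ δ m)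
    (h0 : ∀ t, (∀ m, t ∉ stageTime T τ m) → g t = 0) : Tendsto g (𝓝[<] T) (𝓝 0) := by
  rw [Metric.tendsto_nhds]
  intro r hr
  obtain ⟨M, hM⟩ := eventually_atTop.1 (hδ.eventually (gt_mem_nhds hr))
  filter_upwards [mem_nhdsWithin_of_mem_nhds (lt_mem_nhds (h.stageStart_lt M))] with t ht
  rw [dist_zero_right, Real.norm_eq_abs]
  by_cases hs : ∃ m, t ∈ stageTime T τ m
  · obtain ⟨m, hm⟩ := hs
    refine (hg m t hm).trans_lt (hM m ?_)
    by_contra hlt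
    rw [not_le] at hlt
    have h1 := h.stageStart_add_le m
    have h2 := h.stageStart_mono hlt
    exact absurd hm.2 (not_lt.2 ((h1.trans h2).trans (le_of_lt ht)))
  · push Not at hs
    rw [h0 t hs, abs_zero]
    exact hr

theorem tendsto_zero_start (h : StageFamily T τ S U) {g : ℝ → ℝ}
    (h0 : ∀ t, (∀ m, t ∉ stageTime T τ m) → g t = 0) : Tendsto g (𝓝[>] 0) (𝓝 0) := by
  refine tendsto_const_nhds.congr' ?_
  filter_upwards [mem_nhdsWithin_of_mem_nhds (gt_mem_nhds (half_pos h.T_pos))] with t ht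
  exact (h0 t fun m hm => (h.stageTime_subset m hm).1.not_gt ht).symm

/-- Integrability in time is always reduced to this: stage `m` contributes at most `(c m) ^ p * τ
m`, and these numbers are dominated by a geometric series. -/
theorem eLpNorm_time_lt_top (h : StageFamily T τ S U) {G : ℝ → ℝ≥0∞} {c : ℕ → ℝ} {K : ℝ}
    {p : ℝ≥0∞} (hp : p ≠ 0) (hK : 0 ≤ K) (hc : ∀ m, 0 ≤ c m)
    (hG : ∀ m, ∀ t ∈ stageTime T τ m, G t ≤ ENNReal.ofReal (c m))
    (h0 : ∀ t, (∀ m, t ∉ stageTime T τ m) → G t = 0)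
    (hb : ∀ m, c m * τ m ^ (1 / p.toReal) ≤ K * (1 / 2) ^ m) :
    eLpNorm G p (volume.restrict (Ioo 0 T)) < ⊤ := by
  -- Here `(⊤ : ℝ≥0∞).toReal = 0` and `1 / 0 = 0`, so the hypothesis `hb` bounds `c m` itself.
  by_cases hp' : p = ⊤
  · subst hp'
    rw [eLpNorm_exponent_top]
    refine (eLpNormEssSup_le_of_ae_enorm_bound (C := ENNReal.ofReal K) (Eventually.of_forall
      fun t => ?_)).trans_lt ENNReal.ofReal_lt_top
    rw [enorm_eq_self]
    by_cases hs : ∃ m, t ∈ stageTime T τ m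
    · obtain ⟨m, hm⟩ := hs
      refine (hG m t hm).trans (ENNReal.ofReal_le_ofReal ?_)
      have := hb m
      rw [ENNReal.toReal_top, div_zero, Real.rpow_zero, mul_one] at this
      exact this.trans (mul_le_of_le_one_right hK (pow_le_one₀ (by norm_num) (by norm_num)))
    · push Not at hs
      rw [h0 t hs]
      exact zero_le
  rw [eLpNorm_lt_top_iff_lintegral_rpow_enorm_lt_top hp hp']
  set r := p.toReal with hr
  have hr0 : 0 < r := ENNReal.toReal_pos hp hp'
  have hle : ∀ t, ‖G t‖ₑ ^ r ≤
      ∑' m, (stageTime T τ m).indicator (fun _ => ENNReal.ofReal (c m) ^ r) t := by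
    intro t
    rw [enorm_eq_self]
    by_cases hs : ∃ m, t ∈ stageTime T τ m
    · obtain ⟨m, hm⟩ := hs
      refine le_trans ?_ (ENNReal.le_tsum m)
      rw [indicator_of_mem hm]
      exact ENNReal.rpow_le_rpow (hG m t hm) hr0.le
    · push Not at hs
      rw [h0 t hs, ENNReal.zero_rpow_of_pos hr0]
      exact zero_le
  have hsum : Summable fun m : ℕ => K ^ r * ((1 / 2 : ℝ) ^ r) ^ m :=
    (summable_geometric_of_lt_one (by positivity)
      (Real.rpow_lt_one (by norm_num) (by norm_num) hr0)).mul_left _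
  calc ∫⁻ t in Ioo 0 T, ‖G t‖ₑ ^ r ≤ ∫⁻ t, ‖G t‖ₑ ^ r := setLIntegral_le_lintegral _ _
    _ ≤ ∫⁻ t, ∑' m, (stageTime T τ m).indicator (fun _ => ENNReal.ofReal (c m) ^ r) t :=
        lintegral_mono hle
    _ = ∑' m, ENNReal.ofReal (c m) ^ r * ENNReal.ofReal (τ m) := by
        have hms : ∀ m, MeasurableSet (stageTime T τ m) := fun m => measurableSet_Ioo
        rw [lintegral_tsum fun m => (measurable_const.indicator (hms m)).aemeasurable]
        refine tsum_congr fun m => ?_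
        rw [lintegral_indicator (hms m), setLIntegral_const, stageTime, Real.volume_Ioo,
          add_sub_cancel_left]
    _ ≤ ∑' m : ℕ, ENNReal.ofReal (K ^ r * ((1 / 2 : ℝ) ^ r) ^ m) := by
        refine ENNReal.tsum_le_tsum fun m => ?_
        rw [ENNReal.ofReal_rpow_of_nonneg (hc m) hr0.le, ← ENNReal.ofReal_mul
          (Real.rpow_nonneg (hc m) _)]
        refine ENNReal.ofReal_le_ofReal ?_
        have h1 := Real.rpow_le_rpow (mul_nonneg (hc m) (Real.rpow_nonneg (h.τ_pos m).le _)) (hb m)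
          hr0.le
        rw [Real.mul_rpow (hc m) (Real.rpow_nonneg (h.τ_pos m).le _),
          ← Real.rpow_mul (h.τ_pos m).le, one_div_mul_cancel hr0.ne', Real.rpow_one,
          Real.mul_rpow hK (by positivity), ← Real.rpow_natCast, ← Real.rpow_mul (by norm_num),
          mul_comm (m : ℝ) r, Real.rpow_mul (by norm_num), Real.rpow_natCast] at h1
        exact h1
    _ < ⊤ := by
        rw [← ENNReal.ofReal_tsum_of_nonneg (fun m => by positivity) hsum]
        exact ENNReal.ofReal_lt_top

/-- The limit at `T` is zero and is in fact attained in norm, since the energies of the late stages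
tend to zero. -/
theorem isWeakL2Limit_end (h : StageFamily T τ S U)
    (hE : Tendsto (fun m => energySq (U m)) atTop (𝓝 0)) :
    IsWeakL2Limit (gluedField T τ U) (𝓝[<] T) (gluedField T τ U T) := by
  rw [(h.glued_of_ge le_rfl).1]
  refine ⟨fun _ _ => rfl, MemLp.zero, fun φ hφ => ?_⟩
  have : torusInner (0 : Euc d → Euc d) φ = 0 := by simp [torusInner]
  rw [this]
  refine h.tendsto_zero_end (δ := fun m => Real.sqrt (energySq (U m)) *
    (eLpNorm φ 2 (torusMeasure d)).toReal) ?_ (fun m t ht => ?_) fun t ht => ?_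
  · have := (hE.sqrt).mul_const (eLpNorm φ 2 (torusMeasure d)).toReal
    rwa [Real.sqrt_zero, zero_mul] at this
  · rw [(h.glued_of_mem ht).1, torusInner_smul_left, abs_mul, abs_of_nonneg (timeBump_nonneg _ _ _ _)]
    refine (mul_le_of_le_one_left (abs_nonneg _) (timeBump_le_one _ _ _ _)).trans ?_
    exact abs_torusInner_le (h.trig m).contDiff.continuous hφ
  · rw [(h.glued_of_notMem ht).1, this]

theorem isWeakL2Limit_start (h : StageFamily T τ S U) :
    IsWeakL2Limit (gluedField T τ U) (𝓝[>] 0) (gluedField T τ U 0) := by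
  rw [(h.glued_of_le (half_pos h.T_pos).le).1]
  refine ⟨fun _ _ => rfl, MemLp.zero, fun φ _ => ?_⟩
  have : torusInner (0 : Euc d → Euc d) φ = 0 := by simp [torusInner]
  rw [this]
  exact h.tendsto_zero_start fun t ht => by rw [(h.glued_of_notMem ht).1, this]

theorem dissipationSq_nonneg (v : Euc d → Euc d) : 0 ≤ dissipationSq v :=
  integral_nonneg fun _ => Finset.sum_nonneg fun _ _ => by positivity

theorem integrableOn_dissipationSq (h : StageFamily T τ S U)
    (hD : ∀ m, dissipationSq (U m) * τ m ≤ (1 / 2) ^ m) :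
    IntegrableOn (fun t => dissipationSq (gluedField T τ U t)) (Ioo 0 T) := by
  rw [IntegrableOn, ← memLp_one_iff_integrable]
  refine ⟨ContinuousOn.aestronglyMeasurable (fun t ht =>
    (h.continuousAt_dissipationSq ht.2).continuousWithinAt) measurableSet_Ioo, ?_⟩
  rw [← eLpNorm_enorm]
  refine h.eLpNorm_time_lt_top (c := fun m => dissipationSq (U m)) one_ne_zero zero_le_one
    (fun m => dissipationSq_nonneg _) (fun m t ht => ?_) (fun t ht => ?_) fun m => ?_
  · rw [Real.enorm_eq_ofReal (dissipationSq_nonneg _), (h.glued_of_mem ht).1, dissipationSq_smul]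
    refine ENNReal.ofReal_le_ofReal (mul_le_of_le_one_left (dissipationSq_nonneg _) ?_)
    exact pow_le_one₀ (timeBump_nonneg _ _ _ _) (timeBump_le_one _ _ _ _)
  · have : dissipationSq (0 : Euc d → Euc d) = 0 := by
      have := dissipationSq_smul 0 (0 : Euc d → Euc d)
      rwa [zero_smul, zero_pow two_ne_zero, zero_mul] at this
    rw [(h.glued_of_notMem ht).1, this, enorm_zero]
  · simpa using hD m

/-- The identity holds between any two times inside. Its right-hand side extends continuously to the
closed interval: the energy is continuous up to `T`, where it vanishes, and the primitive of the
integrable dissipation is continuous. -/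
theorem energyEquality (h : StageFamily T τ S U)
    (hE : Tendsto (fun m => energySq (U m)) atTop (𝓝 0))
    (hD : ∀ m, dissipationSq (U m) * τ m ≤ (1 / 2) ^ m) :
    EnergyEquality T (gluedField T τ U) (gluedForce T τ U) := by
  have hI := h.integrableOn_dissipationSq hD
  refine ⟨h.isWeakL2Limit_start, h.isWeakL2Limit_end hE, hI, fun t₀ t₁ h0 h01 h1 => ?_⟩
  have hII : IntervalIntegrable (fun t => dissipationSq (gluedField T τ U t)) volume 0 T := by
    rw [intervalIntegrable_iff_integrableOn_Ioo_of_le h.T_pos.le]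
    exact hI
  set D := fun t => dissipationSq (gluedField T τ U t) with hDdef
  set e := fun t => energySq (gluedField T τ U t) with hedef
  have hsub : ∀ {a b : ℝ}, a ∈ Icc 0 T → b ∈ Icc 0 T → IntervalIntegrable D volume a b :=
    fun ha hb => hII.mono_set (by
      rw [uIcc_of_le h.T_pos.le]
      exact uIcc_subset_Icc ha hb)
  have hΦ : ContinuousOn (fun x => ∫ t in (0 : ℝ)..x, D t) (Icc 0 T) := by
    have := intervalIntegral.continuousOn_primitive_interval' hII left_mem_uIcc
    rwa [uIcc_of_le h.T_pos.le] at this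
  have hm0 : t₀ ∈ Icc 0 T := ⟨h0, h01.le.trans h1⟩
  have hm1 : t₁ ∈ Icc 0 T := ⟨h0.trans h01.le, h1⟩
  have hΦ0 : Tendsto (fun x => ∫ t in (0 : ℝ)..x, D t) (𝓝[>] t₀) (𝓝 (∫ t in (0 : ℝ)..t₀, D t)) :=
    (hΦ t₀ hm0).mono_left (nhdsWithin_le_iff.2 (mem_of_superset
      (Ioo_mem_nhdsGT (h01.trans_le h1)) fun x hx => ⟨h0.trans hx.1.le, hx.2.le⟩))
  have hΦ1 : Tendsto (fun x => ∫ t in (0 : ℝ)..x, D t) (𝓝[<] t₁) (𝓝 (∫ t in (0 : ℝ)..t₁, D t)) :=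
    (hΦ t₁ hm1).mono_left (nhdsWithin_le_iff.2 (mem_of_superset
      (Ioo_mem_nhdsLT (h0.trans_lt h01)) fun x hx => ⟨hx.1.le, hx.2.le.trans h1⟩))
  have he0 : Tendsto e (𝓝[>] t₀) (𝓝 (e t₀)) :=
    (h.continuousAt_energySq (h01.trans_le h1)).tendsto.mono_left nhdsWithin_le_nhds
  have he1 : Tendsto e (𝓝[<] t₁) (𝓝 (e t₁)) := by
    rcases h1.lt_or_eq with hlt | rfl
    · exact (h.continuousAt_energySq hlt).tendsto.mono_left nhdsWithin_le_nhds
    · have z : energySq (0 : Euc d → Euc d) = 0 := by simp [energySq]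
      have : e t₁ = 0 := by rw [hedef]; simp only [(h.glued_of_ge le_rfl).1, z]
      rw [this]
      refine h.tendsto_zero_end hE (fun m t ht => ?_) fun t ht => ?_
      · rw [hedef]
        simp only [(h.glued_of_mem ht).1, energySq_smul]
        rw [abs_of_nonneg (mul_nonneg (sq_nonneg _) (energySq_nonneg _))]
        exact mul_le_of_le_one_left (energySq_nonneg _)
          (pow_le_one₀ (timeBump_nonneg _ _ _ _) (timeBump_le_one _ _ _ _))
      · rw [hedef]
        simp only [(h.glued_of_notMem ht).1, z]
  have hlim : Tendsto (fun p : ℝ × ℝ => e p.2 / 2 - e p.1 / 2 +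
      ((∫ t in (0 : ℝ)..p.2, D t) - ∫ t in (0 : ℝ)..p.1, D t)) (𝓝[>] t₀ ×ˢ 𝓝[<] t₁)
      (𝓝 (e t₁ / 2 - e t₀ / 2 + ((∫ t in (0 : ℝ)..t₁, D t) - ∫ t in (0 : ℝ)..t₀, D t))) :=
    (((he1.comp tendsto_snd).div_const 2).sub ((he0.comp tendsto_fst).div_const 2)).add
      ((hΦ1.comp tendsto_snd).sub (hΦ0.comp tendsto_fst))
  have hz : (0 : ℝ) ∈ Icc 0 T := ⟨le_rfl, h.T_pos.le⟩
  rw [intervalIntegral.integral_interval_sub_left (hsub hz hm1) (hsub hz hm0)] at hlim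
  refine hlim.congr' ?_
  obtain ⟨c, hc0, hc1⟩ := exists_between h01
  filter_upwards [prod_mem_prod (Ioo_mem_nhdsGT hc0) (Ioo_mem_nhdsLT hc1)] with p hp
  have hp1 : p.1 ∈ Icc 0 T := ⟨h0.trans hp.1.1.le, (hp.1.2.trans (hc1.trans_le h1)).le⟩
  have hp2 : p.2 ∈ Icc 0 T := ⟨h0.trans (hc0.trans hp.2.1).le, (hp.2.2.trans_le h1).le⟩
  rw [intervalIntegral.integral_interval_sub_left (hsub hz hp2) (hsub hz hp1),
    h.integral_work (hp.1.2.trans hp.2.1).le (hp.2.2.trans_le h1)]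

theorem hasDistributionLimit_start (h : StageFamily T τ S U) :
    HasDistributionLimit (gluedForce T τ U) (𝓝[>] 0) := fun φ _ _ =>
  ⟨0, h.tendsto_zero_start fun t ht => by
    rw [(h.glued_of_notMem ht).2]; simp [torusInner]⟩

theorem hasDistributionLimit_end (h : StageFamily T τ S U)
    (hf : ∀ φ : Euc d → Euc d, ContDiff ℝ ∞ φ → TorusPeriodic φ → ∃ δ : ℕ → ℝ,
      Tendsto δ atTop (𝓝 0) ∧ ∀ m t, |torusInner (stageForce T τ U m t) φ| ≤ δ m) :
    HasDistributionLimit (gluedForce T τ U) (𝓝[<] T) := fun φ hφ pφ => by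
  obtain ⟨δ, hδ, hle⟩ := hf φ hφ pφ
  refine ⟨0, h.tendsto_zero_end hδ (fun m t ht => ?_) fun t ht => ?_⟩
  · rw [(h.glued_of_mem ht).2]
    exact hle m t
  · rw [(h.glued_of_notMem ht).2]; simp [torusInner]

theorem smoothSolutionClass (h : StageFamily T τ S U)
    (hE : Tendsto (fun m => energySq (U m)) atTop (𝓝 0))
    (hE' : mixedNorm T ⊤ 2 (gluedField T τ U) < ⊤)
    (hD : ∀ m, dissipationSq (U m) * τ m ≤ (1 / 2) ^ m)
    (hf : ∀ φ : Euc d → Euc d, ContDiff ℝ ∞ φ → TorusPeriodic φ → ∃ δ : ℕ → ℝ,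
      Tendsto δ atTop (𝓝 0) ∧ ∀ m t, |torusInner (stageForce T τ U m t) φ| ≤ δ m) :
    SmoothSolutionClass T (gluedField T τ U) (gluedForce T τ U) where
  smooth_velocity := h.smoothOnQ_gluedField
  bounded_energy := hE'
  smooth_force := h.smoothOnQ_gluedForce
  equation := h.solvesNavierStokes
  finite_input := ⟨ContinuousOn.locallyIntegrableOn (fun _ ht =>
    (h.continuousAt_work ht.2).continuousWithinAt) measurableSet_Ioo,
    ⟨_, (h.energyEquality hE hD).2.2.2 0 T le_rfl h.T_pos le_rfl⟩⟩
  force_limit_zero := h.hasDistributionLimit_start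
  force_limit_end := h.hasDistributionLimit_end hf

/-! ### The energy flux -/

/-- The flux is cubic in the velocity, whence the cube of the bump. -/
theorem flux_eq_tsum (h : StageFamily T τ S U) (χ : Euc d → ℝ) (q : ℕ) (t : ℝ) :
    torusInner (lpLow χ q (convective (gluedField T τ U t))) (lpLow χ q (gluedField T τ U t)) =
      ∑' m, timeBump T τ m t ^ 3 *
        torusInner (lpLow χ q (convective (U m))) (lpLow χ q (U m)) := by
  obtain ⟨m, hm⟩ := h.exists_stage t
  rw [tsum_eq_single m fun k hk => by rw [(hm k hk).1]; ring, (glued_eq hm).1, convective_smul,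
    lpLow_smul, lpLow_smul, torusInner_smul_left, torusInner_smul_right]
  ring

theorem energyFlux_eq_tsum (h : StageFamily T τ S U) (χ : Euc d → ℝ) (q : ℕ)
    (hs : Summable fun m => (∫ t, timeBump T τ m t ^ 3) *
      torusInner (lpLow χ q (convective (U m))) (lpLow χ q (U m))) :
    energyFlux χ T (gluedField T τ U) q = ∑' m, (∫ t, timeBump T τ m t ^ 3) *
      torusInner (lpLow χ q (convective (U m))) (lpLow χ q (U m)) := by
  have hT := h.T_pos
  have hI : ∀ m, Integrable fun t => timeBump T τ m t ^ 3 := by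
    intro m
    refine Continuous.integrable_of_hasCompactSupport
      ((contDiff_timeBump T τ m).continuous.pow 3) ?_
    refine HasCompactSupport.intro (isCompact_Icc (a := T / 2) (b := T)) fun t ht => ?_
    rw [(h.timeBump_eq_zero fun hm => ht (Ioo_subset_Icc_self (h.stageTime_subset m hm))).1]
    norm_num
  have h1 : energyFlux χ T (gluedField T τ U) q =
      ∫ t, ∑' m, timeBump T τ m t ^ 3 *
        torusInner (lpLow χ q (convective (U m))) (lpLow χ q (U m)) := by
    rw [energyFlux, intervalIntegral.integral_of_le (by linarith),
      setIntegral_eq_integral_of_forall_compl_eq_zero]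
    · exact integral_congr_ae (Eventually.of_forall fun t => h.flux_eq_tsum χ q t)
    · intro t ht
      have : ∀ m, t ∉ stageTime T τ m := fun m hm =>
        ht (Ioo_subset_Ioc_self (h.stageTime_subset m hm))
      rw [h.flux_eq_tsum]
      simp [(h.timeBump_eq_zero (this _)).1]
  rw [h1, ← integral_tsum_of_summable_integral_norm (fun m => (hI m).mul_const _)]
  · simp only [integral_mul_const]
  · simp only [norm_mul, Real.norm_eq_abs, integral_mul_const]
    refine hs.abs.congr fun m => ?_
    rw [abs_mul]
    congr 1
    rw [abs_of_nonneg (integral_nonneg fun _ => pow_nonneg (timeBump_nonneg _ _ _ _) 3)]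
    exact integral_congr_ae (Eventually.of_forall fun t =>
      (abs_of_nonneg (pow_nonneg (timeBump_nonneg T τ m t) 3)).symm)

/-- The contribution of stage `m` is compared with the indicator of `Q m ≤ q < Q (m + 1)`. For large
`q` exactly one indicator is 1. The errors have a summable bound, and for fixed `m` they vanish as
soon as `q ≥ Q (m + 1)`, so dominated convergence removes them. -/
theorem tendsto_energyFlux (h : StageFamily T τ S U) (χ : Euc d → ℝ) {Q : ℕ → ℕ}
    (hQ : StrictMono Q) {δ : ℕ → ℝ} (hδ : Summable δ)
    (hin : ∀ m q, Q m ≤ q → q < Q (m + 1) → |(∫ t, timeBump T τ m t ^ 3) *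
      torusInner (lpLow χ q (convective (U m))) (lpLow χ q (U m)) - 1| ≤ δ m)
    (hlt : ∀ m q, q < Q m → |(∫ t, timeBump T τ m t ^ 3) *
      torusInner (lpLow χ q (convective (U m))) (lpLow χ q (U m))| ≤ δ m)
    (hge : ∀ m q, Q (m + 1) ≤ q →
      torusInner (lpLow χ q (convective (U m))) (lpLow χ q (U m)) = 0) :
    Tendsto (energyFlux χ T (gluedField T τ U)) atTop (𝓝 1) := by
  set F : ℕ → ℕ → ℝ := fun q m => (∫ t, timeBump T τ m t ^ 3) *
      torusInner (lpLow χ q (convective (U m))) (lpLow χ q (U m))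
  set I : ℕ → ℕ → ℝ := fun q m => if Q m ≤ q ∧ q < Q (m + 1) then 1 else 0
  have hδ0 : ∀ m, 0 ≤ δ m := fun m => (abs_nonneg _).trans (hin m (Q m) le_rfl (hQ (Nat.lt_succ_self m)))
  have hle : ∀ q m, |F q m - I q m| ≤ δ m := by
    intro q m
    by_cases hm : Q m ≤ q ∧ q < Q (m + 1)
    · simp only [I, if_pos hm]
      exact hin m q hm.1 hm.2
    · simp only [I, if_neg hm, sub_zero]
      rcases lt_or_ge q (Q m) with h1 | h1
      · exact hlt m q h1
      · have : F q m = 0 := by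
          simp only [F]
          rw [hge m q (not_lt.1 fun h2 => hm ⟨h1, h2⟩), mul_zero]
        rw [this, abs_zero]
        exact hδ0 m
  have hse : ∀ q, Summable fun m => F q m - I q m := fun q =>
    Summable.of_norm_bounded hδ fun m => hle q m
  have hsi : ∀ q, Summable (I q) := fun q =>
    summable_of_ne_finset_zero (s := Finset.range (q + 1)) fun m hm => by
      simp only [I]
      rw [if_neg]
      rintro ⟨h1, -⟩
      exact hm (Finset.mem_range.2 (Nat.lt_succ_of_le ((hQ.id_le m).trans h1)))
  have hF : ∀ q, energyFlux χ T (gluedField T τ U) q = (∑' m, (F q m - I q m)) + ∑' m, I q m := by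
    intro q
    have hs : Summable (F q) := ((hse q).add (hsi q)).congr fun m => by ring
    rw [h.energyFlux_eq_tsum χ q hs, ← (hse q).tsum_add (hsi q)]
    exact tsum_congr fun m => by ring
  have hI1 : ∀ q, Q 0 ≤ q → ∑' m, I q m = 1 := by
    intro q hq
    -- The stage whose range contains `q` is the predecessor of the first index with `q < Q m`.
    have hex : ∃ m, q < Q m := ⟨q + 1, (Nat.lt_succ_self q).trans_le (hQ.id_le (q + 1))⟩
    obtain ⟨m, hm⟩ : ∃ m, Nat.find hex = m + 1 := Nat.exists_eq_succ_of_ne_zero fun h0 => by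
      have := Nat.find_spec hex
      rw [h0] at this
      omega
    have h1 := Nat.find_spec hex
    have h2 := Nat.find_min hex (m := m) (by omega)
    rw [hm] at h1
    rw [not_lt] at h2
    rw [tsum_eq_single m]
    · simp only [I]; rw [if_pos ⟨h2, h1⟩]
    · intro k hk
      simp only [I]
      rw [if_neg]
      rintro ⟨h3, h4⟩
      have h5 : k < m + 1 := hQ.lt_iff_lt.1 (h3.trans_lt h1)
      have h6 : m < k + 1 := hQ.lt_iff_lt.1 (h2.trans_lt h4)
      omega
  have ht : Tendsto (fun q => ∑' m, (F q m - I q m)) atTop (𝓝 (∑' _ : ℕ, 0)) := by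
    refine tendsto_tsum_of_dominated_convergence hδ (fun m => ?_)
      (Eventually.of_forall fun q m => hle q m)
    refine tendsto_const_nhds.congr' ?_
    filter_upwards [eventually_ge_atTop (Q (m + 1))] with q hq
    simp only [F, I]
    rw [hge m q hq, if_neg fun h1 => absurd h1.2 (not_lt.2 hq), mul_zero, sub_zero]
  rw [tsum_zero] at ht
  have ht2 := ht.add_const 1
  rw [zero_add] at ht2
  refine ht2.congr' ?_
  filter_upwards [eventually_ge_atTop (Q 0)] with q hq
  rw [hF, hI1 q hq]

end StageFamily

/-! ### Norms of a rescaled two-scale field and of its force -/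

theorem energySq_add_add_le {d : ℕ} {u v w : Euc d → Euc d} (hu : Continuous u) (hv : Continuous v)
    (hw : Continuous w) :
    energySq (fun x => u x + v x + w x) ≤ 3 * (energySq u + energySq v + energySq w) := by
  have iu : Integrable (fun x => ‖u x‖ ^ 2) (torusMeasure d) := (hu.norm.pow 2).integrable_torus
  have iv : Integrable (fun x => ‖v x‖ ^ 2) (torusMeasure d) := (hv.norm.pow 2).integrable_torus
  have iw : Integrable (fun x => ‖w x‖ ^ 2) (torusMeasure d) := (hw.norm.pow 2).integrable_torus
  have e : 3 * (energySq u + energySq v + energySq w) =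
      ∫ x, 3 * (‖u x‖ ^ 2 + ‖v x‖ ^ 2 + ‖w x‖ ^ 2) ∂(torusMeasure d) := by
    rw [integral_const_mul,
      integral_add (f := fun x => ‖u x‖ ^ 2 + ‖v x‖ ^ 2) (iu.add iv) iw, integral_add iu iv]
    rfl
  rw [e]
  refine integral_mono (((hu.add hv).add hw).norm.pow 2).integrable_torus
    (((iu.add iv).add iw).const_mul 3) fun x => ?_
  have h1 : ‖u x + v x + w x‖ ≤ ‖u x‖ + ‖v x‖ + ‖w x‖ := norm_add₃_le
  refine (pow_le_pow_left₀ (norm_nonneg _) h1 2).trans ?_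
  show _ ≤ 3 * (‖u x‖ ^ 2 + ‖v x‖ ^ 2 + ‖w x‖ ^ 2)
  nlinarith [sq_nonneg (‖u x‖ - ‖v x‖), sq_nonneg (‖u x‖ - ‖w x‖), sq_nonneg (‖v x‖ - ‖w x‖)]

/-- For `q ≥ 1` the power `profile ^ q` is at most `profile`, whose integral is `(2π / N) ^ d`. At
`q = ⊤` the exponent of `N` is zero because `⊤.toReal = 0`. -/
theorem eLpNorm_le_of_norm_le_profile {d N : ℕ} (hN : 0 < N) {v : Euc d → Euc d}
    (hv : Continuous v) {A : ℝ} (hA : 0 ≤ A) (h : ∀ x, ‖v x‖ ≤ A * profile N x) {q : ℝ≥0∞}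
    (hq : 1 ≤ q) :
    eLpNorm v q (torusMeasure d) ≤
      ENNReal.ofReal (A * (2 * Real.pi) ^ d * (N : ℝ) ^ (-(d / q.toReal))) := by
  have h1 : ∀ x, ‖v x‖ ≤ A := fun x =>
    (h x).trans (mul_le_of_le_one_right hA (profile_le_one N x))
  have hpi := one_le_two_pi_pow d
  have hN' : (0 : ℝ) < N := by exact_mod_cast hN
  by_cases hq' : q = ⊤
  · subst hq'
    rw [eLpNorm_exponent_top, ENNReal.toReal_top, div_zero, neg_zero, Real.rpow_zero, mul_one]
    refine eLpNormEssSup_le_of_ae_enorm_bound (ae_of_all _ fun x => ?_)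
    rw [← ofReal_norm]
    exact ENNReal.ofReal_le_ofReal ((h1 x).trans (le_mul_of_one_le_right hA hpi))
  have hr1 : 1 ≤ q.toReal := by
    rw [← ENNReal.toReal_one]
    exact ENNReal.toReal_mono hq' hq
  have hr0 : 0 < q.toReal := by linarith
  have hm : MemLp v q (torusMeasure d) := MemLp.of_bound hv.aestronglyMeasurable A (ae_of_all _ h1)
  rw [hm.eLpNorm_eq_integral_rpow_norm (zero_lt_one.trans_le hq).ne' hq']
  refine ENNReal.ofReal_le_ofReal ?_
  set r := q.toReal
  have hc : Continuous (profile N : Euc d → ℝ) := (contDiff_profile d N).continuous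
  have h2 : ∫ x, ‖v x‖ ^ r ∂(torusMeasure d) ≤ A ^ r * (2 * Real.pi / N) ^ d := by
    rw [← integral_profile hN, ← integral_const_mul]
    refine integral_mono (hv.norm.rpow_const fun _ => Or.inr hr0.le).integrable_torus
      (continuous_const.mul hc).integrable_torus fun x => ?_
    refine (Real.rpow_le_rpow (norm_nonneg _) (h x) hr0.le).trans ?_
    rw [Real.mul_rpow hA (profile_nonneg N x)]
    refine mul_le_mul_of_nonneg_left ?_ (Real.rpow_nonneg hA _)
    exact Real.rpow_le_self_of_le_one (profile_nonneg N x) (profile_le_one N x) hr1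
  refine (Real.rpow_le_rpow (integral_nonneg fun x => by positivity) h2 (by positivity)).trans ?_
  rw [Real.mul_rpow (by positivity) (by positivity), ← Real.rpow_mul hA, mul_inv_cancel₀ hr0.ne',
    Real.rpow_one, div_pow, Real.div_rpow (by positivity) (by positivity), mul_assoc]
  refine mul_le_mul_of_nonneg_left ?_ hA
  rw [← Real.rpow_natCast (N : ℝ) d, ← Real.rpow_mul hN'.le, div_eq_mul_inv, ← Real.rpow_neg hN'.le,
    ← div_eq_mul_inv]
  refine mul_le_mul_of_nonneg_right ?_ (by positivity)
  calc ((2 * Real.pi) ^ d) ^ r⁻¹ ≤ ((2 * Real.pi) ^ d) ^ (1 : ℝ) :=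
        Real.rpow_le_rpow_of_exponent_le hpi (inv_le_one_of_one_le₀ hr1)
    _ = _ := Real.rpow_one _

/-- The derivative falls on `φ`. Its gradient is bounded on the fundamental cube, which lies in the
ball of radius `2π d`. -/
theorem exists_abs_torusInner_divTensor_le {d : ℕ} {φ : Euc d → Euc d} (hφ : ContDiff ℝ ∞ φ)
    (pφ : TorusPeriodic φ) : ∃ C : ℝ, 0 ≤ C ∧ ∀ v : Euc d → Euc d, ContDiff ℝ ∞ v →
      TorusPeriodic v → |torusInner (divTensor v) φ| ≤ C * energySq v := by
  have hc : Continuous (fderiv ℝ φ) := hφ.continuous_fderiv (by simp)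
  obtain ⟨C, hC⟩ := (isCompact_closedBall (0 : Euc d) (d * (2 * Real.pi))).exists_bound_of_continuousOn
    hc.continuousOn
  have hC0 : 0 ≤ C := (norm_nonneg _).trans (hC 0 (by
    rw [mem_closedBall_zero_iff, norm_zero]; positivity))
  have hms : MeasurableSet {x : Euc d | ∀ j, x j ∈ Ico (0 : ℝ) (2 * Real.pi)} := by
    have : {x : Euc d | ∀ j, x j ∈ Ico (0 : ℝ) (2 * Real.pi)} =
        ⋂ j, (fun x : Euc d => x j) ⁻¹' Ico (0 : ℝ) (2 * Real.pi) := by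
      ext x; simp
    rw [this]
    exact MeasurableSet.iInter fun j =>
      (EuclideanSpace.proj (𝕜 := ℝ) j).continuous.measurable measurableSet_Ico
  refine ⟨C, hC0, fun v hv pv => ?_⟩
  rw [torusInner_divTensor hv hφ pv pφ, abs_neg, energySq, ← integral_const_mul]
  refine (abs_integral_le_integral_abs).trans ?_
  refine integral_mono_ae ?_ ((hv.continuous.norm.pow 2).integrable_torus.const_mul C) ?_
  · exact ((hv.continuous.inner (hc.clm_apply hv.continuous)).abs).integrable_torus
  · refine (ae_restrict_iff' hms).2 (ae_of_all _ fun x hx => ?_)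
    have hb : ‖fderiv ℝ φ x‖ ≤ C := by
      refine hC x ?_
      rw [mem_closedBall_zero_iff]
      refine (norm_le_sum_abs x).trans ((Finset.sum_le_sum fun j _ => ?_).trans
        (le_of_eq (by rw [Finset.sum_const, Finset.card_univ, Fintype.card_fin, nsmul_eq_mul])))
      rw [abs_of_nonneg (hx j).1]
      exact (hx j).2.le
    refine (abs_real_inner_le_norm _ _).trans ?_
    calc ‖v x‖ * ‖fderiv ℝ φ x (v x)‖ ≤ ‖v x‖ * (C * ‖v x‖) :=
          mul_le_mul_of_nonneg_left ((ContinuousLinearMap.le_opNorm _ _).trans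
            (mul_le_mul_of_nonneg_right hb (norm_nonneg _))) (norm_nonneg _)
      _ = C * ‖v x‖ ^ 2 := by ring

theorem torusInner_laplacian_comm {d : ℕ} {v w : Euc d → Euc d}
    (hv : ContDiff ℝ ∞ v) (hw : ContDiff ℝ ∞ w) (pv : TorusPeriodic v) (pw : TorusPeriodic w) :
    torusInner (Laplacian.laplacian v) w = torusInner v (Laplacian.laplacian w) := by
  rw [torusInner_comm v, torusInner_laplacian hv hw pv pw, torusInner_laplacian hw hv pw pv]
  simp only [real_inner_comm]

/-- A potential of which the two-scale field is the divergence. -/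
def stagePotential {d : ℕ} (N L L' : ℕ) (i₀ i₁ i₂ : Fin d) (j : Fin d) (x : Euc d) : Euc d :=
  curlPotential i₁ i₂ (streamLow N L i₁) j x +
    (curlPotential i₀ i₁ (streamHigh N L L' i₀ i₁) j x +
      curlPotential i₀ i₂ (streamHigh N L L' i₀ i₁) j x)

namespace StageParams

variable {d N L L' Q Q' : ℕ} {i₀ i₁ i₂ : Fin d}

theorem trigField_potential (N L L' : ℕ) (i₀ i₁ i₂ : Fin d) (j : Fin d) :
    TrigField (freqLow d N L i₁ ∪ freqHigh d N L L' i₀ i₁)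
      (stagePotential N L L' i₀ i₁ i₂ j) :=
  ((trigField_curlPotential (isTrig_streamLow d N L i₁) j).mono Finset.subset_union_left).add
    (((trigField_curlPotential (isTrig_streamHigh d N L L' i₀ i₁) j).add
      (trigField_curlPotential (isTrig_streamHigh d N L L' i₀ i₁) j)).mono
        Finset.subset_union_right)

theorem stageField_eq_sum (N L L' : ℕ) (i₀ i₁ i₂ : Fin d) (x : Euc d) :
    stageField N L L' i₀ i₁ i₂ x = ∑ j, partialD j (stagePotential N L L' i₀ i₁ i₂ j) x := by
  have h1 := (isTrig_streamLow d N L i₁).contDiff_real.differentiable (by simp)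
  have h2 := (isTrig_streamHigh d N L L' i₀ i₁).contDiff_real.differentiable (by simp)
  have t1 := fun j => (trigField_curlPotential (p := i₁) (q := i₂)
    (isTrig_streamLow d N L i₁) j).contDiff.differentiable (by simp)
  have t2 := fun j => (trigField_curlPotential (p := i₀) (q := i₁)
    (isTrig_streamHigh d N L L' i₀ i₁) j).contDiff.differentiable (by simp)
  have t3 := fun j => (trigField_curlPotential (p := i₀) (q := i₂)
    (isTrig_streamHigh d N L L' i₀ i₁) j).contDiff.differentiable (by simp)
  rw [stageField, fieldLow, fieldHigh, curlField_eq_sum h1, curlField_eq_sum h2,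
    curlField_eq_sum h2, ← Finset.sum_add_distrib, ← Finset.sum_add_distrib]
  refine Finset.sum_congr rfl fun j _ => ?_
  rw [show stagePotential N L L' i₀ i₁ i₂ j = fun x => curlPotential i₁ i₂ (streamLow N L i₁) j x +
    (curlPotential i₀ i₁ (streamHigh N L L' i₀ i₁) j x +
      curlPotential i₀ i₂ (streamHigh N L L' i₀ i₁) j x) from rfl,
    partialD_add (t1 j) ((t2 j).fun_add (t3 j)), partialD_add (t2 j) (t3 j)]

theorem L_pos (h : StageParams d N L L' Q Q' i₀ i₁ i₂) : 0 < L := by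
  have h1 := h.four_N_le
  have h2 := h.N_pos
  omega

theorem half_pow_le (h : StageParams d N L L' Q Q' i₀ i₁ i₂) : (2 : ℝ) ^ Q / 2 ≤ L := by
  have h1 : (L : ℝ) + 2 * d ^ 2 * N = 2 ^ Q := by exact_mod_cast h.low
  have h2 := h.sep_real
  linarith

/-- The stream functions carry a factor at most `1 / L ≤ 2 / 2 ^ Q`; the three potentials contribute
`2 + 4 + 4 = 10` times it. -/
theorem norm_potential_le (h : StageParams d N L L' Q Q' i₀ i₁ i₂) (j : Fin d) (x : Euc d) :
    ‖stagePotential N L L' i₀ i₁ i₂ j x‖ ≤ 20 / 2 ^ Q * profile N x := by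
  have hL : (0 : ℝ) < L := by exact_mod_cast h.L_pos
  have hLL : (L : ℝ) ≤ L' := by exact_mod_cast h.L_le
  have hH := profile_nonneg N x
  have hQ : (0 : ℝ) < 2 ^ Q := by positivity
  have e0 : ∀ s : ℝ, ∀ c : ℝ, |s| ≤ c → |envelope N x * s| ≤ c * profile N x :=
    fun s c hs => abs_envelope_mul_le x hs
  have e1 : |streamLow N L i₁ x| ≤ (L : ℝ)⁻¹ * profile N x := by
    rw [streamLow, abs_mul, abs_of_pos (inv_pos.2 hL)]
    refine mul_le_mul_of_nonneg_left ?_ (inv_pos.2 hL).le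
    have := e0 _ 1 (Real.abs_sin_le_one (L * x i₁))
    rwa [one_mul] at this
  have e2 : |streamHigh N L L' i₀ i₁ x| ≤ (L : ℝ)⁻¹ * (2 * profile N x) := by
    rw [streamHigh, abs_mul, abs_of_pos (inv_pos.2 (hL.trans_le hLL))]
    refine mul_le_mul (inv_anti₀ hL hLL) (e0 _ 2 ?_) (abs_nonneg _) (inv_pos.2 hL).le
    have := abs_sin_mul_le (s := Real.sin (L' * x i₀)) (abs_one_add_sin_le (L * x i₁))
      (Real.abs_sin_le_one _)
    rwa [one_mul] at this
  have h1 := norm_curlPotential_le i₁ i₂ (streamLow N L i₁) j x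
  have h2 := norm_curlPotential_le i₀ i₁ (streamHigh N L L' i₀ i₁) j x
  have h3 := norm_curlPotential_le i₀ i₂ (streamHigh N L L' i₀ i₁) j x
  have h4 : (L : ℝ)⁻¹ ≤ 2 / 2 ^ Q := by
    rw [← inv_div]
    exact inv_anti₀ (by positivity) h.half_pow_le
  calc _ ≤ 10 * (L : ℝ)⁻¹ * profile N x := by
        refine (norm_add_le _ _).trans ?_
        have := norm_add_le (curlPotential i₀ i₁ (streamHigh N L L' i₀ i₁) j x)
          (curlPotential i₀ i₂ (streamHigh N L L' i₀ i₁) j x)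
        linarith
    _ ≤ 10 * (2 / 2 ^ Q) * profile N x := by gcongr
    _ = _ := by ring

theorem card_le (h : StageParams d N L L' Q Q' i₀ i₁ i₂) :
    ((freqLow d N L i₁ ∪ freqHigh d N L L' i₀ i₁).card : ℝ) ≤ 8 * (5 * d * N : ℝ) ^ d := by
  have hd : 1 ≤ d := Nat.one_le_of_lt i₀.2
  have hN := h.N_pos
  have h1 : (freqLow d N L i₁ ∪ freqHigh d N L L' i₀ i₁).card ≤ 8 * (5 * d * N) ^ d := by
    refine (Finset.card_union_le _ _).trans ((add_le_add (card_freqLow_le d N L i₁)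
      (card_freqHigh_le d N L L' i₀ i₁)).trans ?_)
    have h2 : 4 * d * N + 1 ≤ 5 * d * N := by
      have : 1 ≤ d * N := Nat.mul_pos hd hN
      nlinarith
    have h3 := Nat.pow_le_pow_left h2 d
    omega
  exact_mod_cast h1

/-- The decay of coefficients is measured by single coordinates, so one large coordinate must be
exhibited: `i₁` for the low and `i₀` for the high spectrum. -/
theorem exists_large_freq (h : StageParams d N L L' Q Q' i₀ i₁ i₂) {k : Fin d → ℤ}
    (hk : k ∈ freqLow d N L i₁ ∪ freqHigh d N L L' i₀ i₁) : ∃ j, (2 : ℝ) ^ Q / 2 ≤ |(k j : ℝ)| := by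
  have h1 : (L : ℝ) + 2 * d ^ 2 * N = 2 ^ Q := by exact_mod_cast h.low
  have h2 := h.sep_real
  have h3 : (L : ℝ) ≤ L' := by exact_mod_cast h.L_le
  have hd : (1 : ℝ) ≤ d := by exact_mod_cast Nat.one_le_of_lt i₀.2
  have h4 : (d : ℝ) * N ≤ d ^ 2 * N := by
    refine mul_le_mul_of_nonneg_right ?_ (Nat.cast_nonneg N)
    nlinarith
  rcases Finset.mem_union.1 hk with hk | hk
  · exact ⟨i₁, le_trans (by linarith) (freqLow_bounds hk).2.2⟩
  · exact ⟨i₀, le_trans (by linarith) (freqHigh_bounds h.ne01 hk).2.2⟩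

theorem norm_smul_le (h : StageParams d N L L' Q Q' i₀ i₁ i₂) {b : ℝ} (hb : 0 ≤ b) (x : Euc d) :
    ‖(b • stageField N L L' i₀ i₁ i₂) x‖ ≤ 12 * b * profile N x := by
  rw [Pi.smul_apply, norm_smul, Real.norm_eq_abs, abs_of_nonneg hb]
  have := mul_le_mul_of_nonneg_left (h.norm_le x) hb
  linarith

theorem trigField_smul (N L L' : ℕ) (i₀ i₁ i₂ : Fin d) (b : ℝ) :
    TrigField (freqLow d N L i₁ ∪ freqHigh d N L L' i₀ i₁) (b • stageField N L L' i₀ i₁ i₂) :=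
  (trigField N L L' i₀ i₁ i₂).const_smul b

theorem energySq_smul_le (h : StageParams d N L L' Q Q' i₀ i₁ i₂) (b : ℝ) :
    energySq (b • stageField N L L' i₀ i₁ i₂) ≤ b ^ 2 * (144 * (2 * Real.pi / N) ^ d) := by
  rw [energySq_smul]
  exact mul_le_mul_of_nonneg_left h.energySq_le (sq_nonneg b)

theorem dissipationSq_smul_le (h : StageParams d N L L' Q Q' i₀ i₁ i₂) (b : ℝ) :
    dissipationSq (b • stageField N L L' i₀ i₁ i₂) ≤
      b ^ 2 * (((2 : ℝ) ^ Q') ^ 2 * (144 * (2 * Real.pi / N) ^ d)) := by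
  rw [dissipationSq_smul]
  exact mul_le_mul_of_nonneg_left h.dissipationSq_le (sq_nonneg b)

open scoped Pointwise in
/-- The negative Sobolev norm of the force of a stage. -/
theorem besovNorm_force_le {χ : Euc d → ℝ} (hχ : IsLPCutoff χ)
    (h : StageParams d N L L' Q Q' i₀ i₁ i₂) {b c c' : ℝ} (hb : 0 ≤ b) (hc : |c| ≤ 1) :
    besovNorm χ (-1) 2 2 (fun x => c' • (b • stageField N L L' i₀ i₁ i₂) x -
      c • Laplacian.laplacian (b • stageField N L L' i₀ i₁ i₂) x +
      c ^ 2 • divTensor (b • stageField N L L' i₀ i₁ i₂) x) ≤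
    ENNReal.ofReal (Real.sqrt (24 * (2 * Real.pi / N) ^ d * (d * (c' * b * (20 / 2 ^ Q)) ^ 2 +
      144 * (b * 2 ^ Q') ^ 2 + d * (144 * b ^ 2) ^ 2))) := by
  set U := b • stageField N L L' i₀ i₁ i₂ with hU_def
  have hU := trigField_smul N L L' i₀ i₁ i₂ b
  rw [← hU_def] at hU
  set A := stagePotential N L L' i₀ i₁ i₂
  have hA := trigField_potential N L L' i₀ i₁ i₂
  set S := freqLow d N L i₁ ∪ freqHigh d N L L' i₀ i₁
  set I := (2 * Real.pi / N) ^ d with hI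
  have hUj : ∀ j, TrigField (S + S) fun x => U x j • U x := fun j => TrigField.smul (hU j) hU
  have g1 : ∀ j, TrigField S fun x => (c' * b) • A j x := fun j => (hA j).const_smul _
  have g2 : ∀ j, TrigField S fun x => (-c) • partialD j U x := fun j => (hU.partialD j).const_smul _
  have g3 : ∀ j, TrigField (S + S) fun x => c ^ 2 • (U x j • U x) := fun j => (hUj j).const_smul _
  have hG : ∀ j, TrigField (S ∪ (S + S)) fun x =>
      (c' * b) • A j x + (-c) • partialD j U x + c ^ 2 • (U x j • U x) := fun j =>
    (((g1 j).add (g2 j)).mono Finset.subset_union_left).add ((g3 j).mono Finset.subset_union_right)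
  -- The force is the divergence of the potential times `c' b`, minus `c` times the gradient, plus
  -- `c²` times the tensor square. The `H^{-1}` norm is thus bounded by three `L²` norms.
  have hf : (fun x => c' • U x - c • Laplacian.laplacian U x + c ^ 2 • divTensor U x) =
      fun x => ∑ j, partialD j (fun x =>
        (c' * b) • A j x + (-c) • partialD j U x + c ^ 2 • (U x j • U x)) x := by
    funext x
    have e : ∀ j, partialD j (fun x =>
        (c' * b) • A j x + (-c) • partialD j U x + c ^ 2 • (U x j • U x)) x =
        (c' * b) • partialD j (A j) x - c • partialD j (partialD j U) x +
          c ^ 2 • partialD j (fun y => U y j • U y) x := by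
      intro j
      rw [partialD_add (((g1 j).add (g2 j)).contDiff.differentiable (by simp))
        ((g3 j).contDiff.differentiable (by simp)),
        partialD_add ((g1 j).contDiff.differentiable (by simp))
        ((g2 j).contDiff.differentiable (by simp))]
      have s : ∀ (a : ℝ) (v : Euc d → Euc d), partialD j (fun x => a • v x) x =
          a • partialD j v x := fun a v => by
        have := fderiv_smul_field a v x
        rw [partialD, show (fun x => a • v x) = a • v from rfl, this]
        rfl
      rw [s, s, s, neg_smul, ← sub_eq_add_neg]
    rw [Finset.sum_congr rfl fun j _ => e j, Finset.sum_add_distrib, Finset.sum_sub_distrib,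
      ← Finset.smul_sum, ← Finset.smul_sum, ← Finset.smul_sum, ← stageField_eq_sum,
      laplacian_eq_sum_partialD hU.contDiff, divTensor_eq_sum, hU_def, Pi.smul_apply, smul_smul]
  rw [hf]
  refine (besovNorm_neg_one_divergence_le hχ hG).trans (ENNReal.ofReal_le_ofReal
    (Real.sqrt_le_sqrt ?_))
  have b1 : ∀ j, energySq (fun x => (c' * b) • A j x) ≤ (c' * b) ^ 2 * ((20 / 2 ^ Q) ^ 2 * I) := by
    intro j
    rw [show (fun x => (c' * b) • A j x) = (c' * b) • A j from rfl, energySq_smul, hI,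
      ← integral_profile h.N_pos]
    exact mul_le_mul_of_nonneg_left (energySq_le_of_norm_le (hA j).contDiff.continuous
      (h.norm_potential_le j)) (sq_nonneg _)
  have hc2 : c ^ 2 ≤ 1 := by rw [← sq_abs]; exact pow_le_one₀ (abs_nonneg c) hc
  have b2 : ∑ j, energySq (fun x => (-c) • partialD j U x) ≤
      b ^ 2 * (((2 : ℝ) ^ Q') ^ 2 * (144 * I)) := by
    refine le_trans ?_ (h.dissipationSq_smul_le b)
    rw [dissipationSq_eq_sum_energySq hU.contDiff]
    refine Finset.sum_le_sum fun j _ => ?_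
    rw [show (fun x => (-c) • partialD j U x) = (-c) • partialD j U from rfl, energySq_smul, neg_sq]
    exact mul_le_of_le_one_left (energySq_nonneg _) hc2
  -- The tensor square is bounded pointwise by `144 b²` times the square of the profile, hence by
  -- that times the profile.
  have b3 : ∀ j, energySq (fun x => c ^ 2 • (U x j • U x)) ≤ (144 * b ^ 2) ^ 2 * I := by
    intro j
    rw [hI, ← integral_profile h.N_pos]
    refine energySq_le_of_norm_le (g3 j).contDiff.continuous fun x => ?_
    have hn := h.norm_smul_le hb x
    have hp := profile_nonneg N x
    have hp1 := profile_le_one N x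
    rw [norm_smul, norm_smul, Real.norm_eq_abs, abs_of_nonneg (sq_nonneg c)]
    calc c ^ 2 * (‖U x j‖ * ‖U x‖) ≤ 1 * ((12 * b * profile N x) * (12 * b * profile N x)) := by
          gcongr
          exact (PiLp.norm_apply_le _ j).trans hn
      _ = 144 * b ^ 2 * (profile N x * profile N x) := by ring
      _ ≤ 144 * b ^ 2 * (1 * profile N x) := by gcongr
      _ = _ := by ring
  calc 8 * ∑ j, energySq (fun x => (c' * b) • A j x + (-c) • partialD j U x +
        c ^ 2 • (U x j • U x)) ≤ 8 * ∑ j, 3 * (energySq (fun x => (c' * b) • A j x) +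
          energySq (fun x => (-c) • partialD j U x) +
          energySq (fun x => c ^ 2 • (U x j • U x))) := by
        gcongr with j
        exact energySq_add_add_le (g1 j).contDiff.continuous (g2 j).contDiff.continuous
          (g3 j).contDiff.continuous
    _ = 24 * (∑ j, energySq (fun x => (c' * b) • A j x) +
          ∑ j, energySq (fun x => (-c) • partialD j U x) +
          ∑ j, energySq (fun x => c ^ 2 • (U x j • U x))) := by
        rw [← Finset.mul_sum, Finset.sum_add_distrib, Finset.sum_add_distrib]
        ring
    _ ≤ 24 * (∑ _j : Fin d, (c' * b) ^ 2 * ((20 / 2 ^ Q) ^ 2 * I) +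
          b ^ 2 * (((2 : ℝ) ^ Q') ^ 2 * (144 * I)) + ∑ _j : Fin d, (144 * b ^ 2) ^ 2 * I) := by
        gcongr with j _ j _
        · exact b1 j
        · exact b3 j
    _ = _ := by
        simp only [Finset.sum_const, Finset.card_univ, Fintype.card_fin, nsmul_eq_mul]
        ring

/-- The Besov norm of a rescaled two-scale field. -/
theorem besovNorm_three_le {χ : Euc d → ℝ} (hχ : IsLPCutoff χ)
    (h : StageParams d N L L' Q Q' i₀ i₁ i₂) {b : ℝ} (hb : 0 ≤ b) (s : ℝ) :
    besovNorm χ s 3 ⊤ (b • stageField N L L' i₀ i₁ i₂) ≤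
      ENNReal.ofReal ((2 : ℝ) ^ |s| * (2 * 2 ^ Q' : ℝ) ^ (max s 0) *
        (Real.sqrt (8 * (5 * d * N : ℝ) ^ d) *
          (b * Real.sqrt (144 * (2 * Real.pi / N) ^ d)) ^ 3) ^ (1 / 3 : ℝ)) := by
  refine ((trigField_smul N L L' i₀ i₁ i₂ b).besovNorm_three_top_le hχ (R := 2 ^ Q')
    (one_le_pow₀ one_le_two) (fun k hk => h.freq_le hk) s).trans ?_
  rw [← ENNReal.ofReal_mul (by positivity)]
  refine ENNReal.ofReal_le_ofReal (mul_le_mul_of_nonneg_left ?_ (by positivity))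
  refine Real.rpow_le_rpow (by positivity) (mul_le_mul (Real.sqrt_le_sqrt h.card_le)
    (pow_le_pow_left₀ (Real.sqrt_nonneg _) ?_ 3) (by positivity) (by positivity)) (by norm_num)
  refine (Real.sqrt_le_sqrt (h.energySq_smul_le b)).trans (le_of_eq ?_)
  rw [Real.sqrt_mul (sq_nonneg b), Real.sqrt_sq hb]

end StageParams

/-! ### The parameters of the stages -/

/-- The quantity in which the parameters of the stages are measured. -/
def growth (n : ℕ) : ℝ := 2 ^ n ^ 2

/-- The spatial concentration of a stage. -/
def concentration (M n : ℕ) : ℕ := 2 ^ ((2 * M + 5) * n ^ 2)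

/-- The dyadic index of the low frequencies of a stage. -/
def shell (d M n : ℕ) : ℕ := d * M * n ^ 2

/-- The duration of a stage. -/
def duration (d M n : ℕ) : ℝ := growth n ^ (-((2 * M + 1) * d) : ℝ)

/-- The ratio between the high and the low frequencies of a stage. -/
def shellRatio (d M n : ℕ) : ℝ := 2 ^ (d * M * (2 * n + 1))

theorem one_le_growth (n : ℕ) : 1 ≤ growth n := one_le_pow₀ one_le_two

theorem growth_pos (n : ℕ) : 0 < growth n := zero_lt_one.trans_le (one_le_growth n)

theorem one_le_shellRatio (d M n : ℕ) : 1 ≤ shellRatio d M n := one_le_pow₀ one_le_two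

theorem duration_pos (d M n : ℕ) : 0 < duration d M n := Real.rpow_pos_of_pos (growth_pos n) _

theorem concentration_pos (M n : ℕ) : 0 < concentration M n := by unfold concentration; positivity

theorem concentration_eq (M n : ℕ) : (concentration M n : ℝ) = growth n ^ (2 * M + 5 : ℝ) := by
  have : (2 * M + 5 : ℝ) = ((2 * M + 5 : ℕ) : ℝ) := by push_cast; ring
  rw [this, Real.rpow_natCast, growth, concentration, ← pow_mul, mul_comm (n ^ 2)]
  push_cast
  rfl

theorem two_pow_shell (d M n : ℕ) : (2 : ℝ) ^ shell d M n = growth n ^ (d * M : ℝ) := by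
  have : (d * M : ℝ) = ((d * M : ℕ) : ℝ) := by push_cast; ring
  rw [this, Real.rpow_natCast, growth, shell, ← pow_mul, mul_comm (n ^ 2)]

theorem two_pow_shell_succ (d M n : ℕ) :
    (2 : ℝ) ^ shell d M (n + 1) = growth n ^ (d * M : ℝ) * shellRatio d M n := by
  rw [← two_pow_shell, shell, shell, shellRatio, ← pow_add]
  congr 1
  ring

theorem profile_integral_eq (d M n : ℕ) : (2 * Real.pi / concentration M n) ^ d =
    (2 * Real.pi) ^ d * growth n ^ (-((2 * M + 5) * d) : ℝ) := by
  rw [div_pow, concentration_eq, ← Real.rpow_natCast (growth n ^ _) d,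
    ← Real.rpow_mul (growth_pos n).le, div_eq_mul_inv, ← Real.rpow_neg (growth_pos n).le]

theorem sqrt_rpow {y : ℝ} (hy : 0 < y) (x : ℝ) : Real.sqrt (y ^ x) = y ^ (x / 2) := by
  rw [Real.sqrt_eq_rpow, ← Real.rpow_mul hy.le]
  congr 1
  ring

theorem sqrt_profile_integral_eq (d M n : ℕ) (c : ℝ) (hc : 0 ≤ c) :
    Real.sqrt (c * (2 * Real.pi / concentration M n) ^ d) =
      Real.sqrt (c * (2 * Real.pi) ^ d) * growth n ^ (-((2 * M + 5) * d) / 2 : ℝ) := by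
  rw [profile_integral_eq, ← mul_assoc, Real.sqrt_mul (by positivity), sqrt_rpow (growth_pos n)]

/-- Negative powers of the growth beat every power of the frequency ratio. -/
theorem eventually_growth_le (d M : ℕ) (C : ℝ) {s : ℝ} (hs : 0 < s) (k : ℝ) :
    ∀ᶠ n : ℕ in atTop, C * growth n ^ (-s) * shellRatio d M n ^ k ≤ (1 / 2) ^ n := by
  set A : ℝ := k * (d * M * 2) with hA
  set B : ℝ := k * (d * M) with hB
  have hexp : ∀ n : ℕ, growth n ^ (-s) * shellRatio d M n ^ k =
      (2 : ℝ) ^ (-s * n ^ 2 + A * n + B) := by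
    intro n
    rw [growth, shellRatio, ← Real.rpow_natCast, ← Real.rpow_natCast, ← Real.rpow_mul two_pos.le,
      ← Real.rpow_mul two_pos.le, ← Real.rpow_add two_pos]
    congr 1
    push_cast
    ring
  have h1 : ∀ᶠ n : ℕ in atTop, |C| * (2 : ℝ) ^ B ≤ 2 ^ n :=
    (tendsto_pow_atTop_atTop_of_one_lt one_lt_two).eventually_ge_atTop _
  have h2 : ∀ᶠ n : ℕ in atTop, (A + 2) / s ≤ (n : ℝ) :=
    tendsto_natCast_atTop_atTop.eventually_ge_atTop _
  filter_upwards [h1, h2] with n h1 h2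
  -- The quadratic exponent absorbs the linear one once `n` exceeds `(A + 2) / s`. Of the remaining
  -- `2 ^ (-2 n)` one half is the claim and the other absorbs the constants.
  have h3 : -s * (n : ℝ) ^ 2 + A * n + B ≤ -(2 * n) + B := by
    rw [div_le_iff₀ hs] at h2
    nlinarith [Nat.cast_nonneg (α := ℝ) n]
  have h4 : (2 : ℝ) ^ (-(2 * n : ℝ) + B) = (1 / 2) ^ n * ((1 / 2) ^ n * 2 ^ B) := by
    rw [Real.rpow_add two_pos, Real.rpow_neg two_pos.le, two_mul, Real.rpow_add two_pos,
      Real.rpow_natCast, mul_inv, ← inv_pow, one_div]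
    ring
  have h5 : (0 : ℝ) < (1 / 2) ^ n := by positivity
  rw [mul_assoc, hexp]
  calc C * (2 : ℝ) ^ (-s * n ^ 2 + A * n + B) ≤ |C| * 2 ^ (-(2 * n : ℝ) + B) :=
        mul_le_mul (le_abs_self C) (Real.rpow_le_rpow_of_exponent_le one_le_two h3)
          (by positivity) (abs_nonneg C)
    _ = (1 / 2) ^ n * ((1 / 2) ^ n * (|C| * 2 ^ B)) := by rw [h4]; ring
    _ ≤ (1 / 2) ^ n * ((1 / 2) ^ n * 2 ^ n) := by gcongr
    _ = (1 / 2) ^ n := by rw [← mul_pow (1 / 2 : ℝ) 2 n]; norm_num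

theorem eventually_growth_le' (C : ℝ) {s : ℝ} (hs : 0 < s) :
    ∀ᶠ n : ℕ in atTop, C * growth n ^ (-s) ≤ (1 / 2) ^ n := by
  filter_upwards [eventually_growth_le 0 0 C hs 0] with n hn
  rwa [Real.rpow_zero, mul_one] at hn

/-- The ratio of frequencies is at least `4 ^ n`. -/
theorem eventually_inv_shellRatio_le {d M : ℕ} (hdM : 1 ≤ d * M) (C : ℝ) :
    ∀ᶠ n : ℕ in atTop, C * (shellRatio d M n)⁻¹ ≤ (1 / 2) ^ n := by
  filter_upwards [(tendsto_pow_atTop_atTop_of_one_lt (one_lt_two (α := ℝ))).eventually_ge_atTop |C|]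
    with n h1
  have h2 : (2 : ℝ) ^ n * 2 ^ n ≤ shellRatio d M n := by
    rw [← pow_add, shellRatio]
    refine pow_le_pow_right₀ one_le_two ?_
    nlinarith
  have h3 : (0 : ℝ) < 2 ^ n := by positivity
  rw [one_div, inv_pow, ← div_eq_mul_inv, div_le_iff₀ (zero_lt_one.trans_le (one_le_shellRatio d M n))]
  calc C ≤ 2 ^ n := (le_abs_self C).trans h1
    _ = (2 ^ n)⁻¹ * (2 ^ n * 2 ^ n) := by field_simp
    _ ≤ _ := by gcongr

/-! ### Size of each norm of a stage as a power of the growth. -/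

section Bounds

variable {d M : ℕ} {b : ℕ → ℝ} {Cb : ℝ}

/-- The exponent is `2 (dM + 2d) - (2M + 5) d = -d`. -/
theorem eventually_energy_le (hd : 1 ≤ d) (hb : ∀ᶠ n in atTop, 0 ≤ b n ∧
      b n ≤ Cb * growth n ^ (d * M + 2 * d : ℝ)) :
    ∀ᶠ n : ℕ in atTop, b n ^ 2 * (144 * (2 * Real.pi / concentration M n) ^ d) ≤ (1 / 2) ^ n := by
  have hd' : (0 : ℝ) < d := by exact_mod_cast hd
  filter_upwards [hb, eventually_growth_le' (Cb ^ 2 * (144 * (2 * Real.pi) ^ d)) hd'] with n hb hn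
  refine le_trans ?_ hn
  have hy := growth_pos n
  rw [profile_integral_eq]
  set y := growth n
  have e : (y ^ (d * M + 2 * d : ℝ)) ^ 2 * y ^ (-((2 * M + 5) * d) : ℝ) = y ^ (-d : ℝ) := by
    rw [← Real.rpow_natCast, ← Real.rpow_mul hy.le, ← Real.rpow_add hy]
    congr 1
    push_cast
    ring
  calc _ ≤ (Cb * y ^ (d * M + 2 * d : ℝ)) ^ 2 *
        (144 * ((2 * Real.pi) ^ d * y ^ (-((2 * M + 5) * d) : ℝ))) := by
        gcongr
        · exact hb.1
        · exact hb.2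
    _ = Cb ^ 2 * (144 * (2 * Real.pi) ^ d) *
        ((y ^ (d * M + 2 * d : ℝ)) ^ 2 * y ^ (-((2 * M + 5) * d) : ℝ)) := by ring
    _ = _ := by rw [e]

/-- To the exponent `-d` of the energy come `2dM` from two derivatives and `-(2M + 1) d` from the
duration: in all `-2d`, up to the square of the frequency ratio. -/
theorem eventually_dissipation_le (hd : 1 ≤ d) (hb : ∀ᶠ n in atTop, 0 ≤ b n ∧
      b n ≤ Cb * growth n ^ (d * M + 2 * d : ℝ)) :
    ∀ᶠ n : ℕ in atTop, b n ^ 2 * (((2 : ℝ) ^ shell d M (n + 1)) ^ 2 *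
      (144 * (2 * Real.pi / concentration M n) ^ d)) * duration d M n ≤ (1 / 2) ^ n := by
  have hd' : (0 : ℝ) < 2 * d := by
    have : (0 : ℝ) < d := by exact_mod_cast hd
    linarith
  filter_upwards [hb, eventually_growth_le d M (Cb ^ 2 * (144 * (2 * Real.pi) ^ d)) hd' 2]
    with n hb hn
  refine le_trans ?_ hn
  have hy := growth_pos n
  have hw := one_le_shellRatio d M n
  rw [profile_integral_eq, two_pow_shell_succ, duration]
  set y := growth n
  set w := shellRatio d M n
  have e : (y ^ (d * M + 2 * d : ℝ)) ^ 2 * (y ^ (d * M : ℝ)) ^ 2 * y ^ (-((2 * M + 5) * d) : ℝ) *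
      y ^ (-((2 * M + 1) * d) : ℝ) = y ^ (-(2 * d) : ℝ) := by
    rw [← Real.rpow_natCast, ← Real.rpow_natCast, ← Real.rpow_mul hy.le, ← Real.rpow_mul hy.le,
      ← Real.rpow_add hy, ← Real.rpow_add hy, ← Real.rpow_add hy]
    congr 1
    push_cast
    ring
  calc _ ≤ (Cb * y ^ (d * M + 2 * d : ℝ)) ^ 2 * ((y ^ (d * M : ℝ) * w) ^ 2 *
        (144 * ((2 * Real.pi) ^ d * y ^ (-((2 * M + 5) * d) : ℝ)))) *
          y ^ (-((2 * M + 1) * d) : ℝ) := by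
        gcongr
        · exact hb.1
        · exact hb.2
    _ = Cb ^ 2 * (144 * (2 * Real.pi) ^ d) *
        ((y ^ (d * M + 2 * d : ℝ)) ^ 2 * (y ^ (d * M : ℝ)) ^ 2 * y ^ (-((2 * M + 5) * d) : ℝ) *
          y ^ (-((2 * M + 1) * d) : ℝ)) * w ^ 2 := by ring
    _ = _ := by rw [e, ← Real.rpow_natCast w 2]; norm_num

/-- The exponent of the growth is `d` times the left-hand side of the condition on `p` and `q`. Here
`p` and `q` stand for reciprocals of the Lebesgue exponents. The threshold for `n` does not depend
on them, so one construction serves all pairs. -/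
theorem eventually_mixed_le (hd : 1 ≤ d) (hCb : 0 ≤ Cb) (hb : ∀ᶠ n in atTop, 0 ≤ b n ∧
      b n ≤ Cb * growth n ^ (d * M + 2 * d : ℝ)) :
    ∀ᶠ n : ℕ in atTop, ∀ p q : ℝ, (M + 2 : ℝ) - (2 * M + 5) * q - (2 * M + 1) * p ≤ -(1 / 2) →
      12 * b n * (2 * Real.pi) ^ d * (concentration M n : ℝ) ^ (-(d * q)) *
        duration d M n ^ p ≤ (1 / 2) ^ n := by
  have hd' : (1 : ℝ) ≤ d := by exact_mod_cast hd
  filter_upwards [hb, eventually_growth_le' (12 * Cb * (2 * Real.pi) ^ d)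
    (s := d / 2) (by positivity)] with n hb hn p q hpq
  refine le_trans ?_ hn
  have hy := growth_pos n
  rw [concentration_eq, duration, ← Real.rpow_mul hy.le, ← Real.rpow_mul hy.le]
  set y := growth n
  calc _ ≤ 12 * (Cb * y ^ (d * M + 2 * d : ℝ)) * (2 * Real.pi) ^ d *
        y ^ ((2 * M + 5 : ℝ) * (-(d * q))) * y ^ (-((2 * M + 1) * d) * p : ℝ) := by
        gcongr
        exact hb.2
    _ = 12 * Cb * (2 * Real.pi) ^ d * (y ^ (d * M + 2 * d : ℝ) *
        y ^ ((2 * M + 5 : ℝ) * (-(d * q))) * y ^ (-((2 * M + 1) * d) * p : ℝ)) := by ring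
    _ ≤ _ := by
        rw [← Real.rpow_add hy, ← Real.rpow_add hy]
        refine mul_le_mul_of_nonneg_left (Real.rpow_le_rpow_of_exponent_le (one_le_growth n) ?_)
          (by positivity)
        nlinarith

/-- The cube of the `L³` norm, times the duration, is bounded by `N^(d/2) (b N^(-d/2))³ τ`, of
exponent `-dM`. Its cube root beats the weight `2 ^ (Q' σ)`, which is `growth n ^ (dMσ)` up to the
frequency ratio, because `σ < 1/3`. -/
theorem eventually_besov_le (hd : 1 ≤ d) (hM : 1 ≤ M) (hCb : 0 ≤ Cb) {s : ℝ} (hs : s < 1 / 3)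
    (hb : ∀ᶠ n in atTop, 0 ≤ b n ∧ b n ≤ Cb * growth n ^ (d * M + 2 * d : ℝ)) :
    ∀ᶠ n : ℕ in atTop, (2 : ℝ) ^ |s| * (2 * 2 ^ shell d M (n + 1) : ℝ) ^ (max s 0) *
        (Real.sqrt (8 * (5 * d * concentration M n : ℝ) ^ d) *
          (b n * Real.sqrt (144 * (2 * Real.pi / concentration M n) ^ d)) ^ 3) ^ (1 / 3 : ℝ) *
        duration d M n ^ (1 / 3 : ℝ) ≤ (1 / 2) ^ n := by
  set σ := max s 0 with hσ
  have hσ0 : 0 ≤ σ := le_max_right _ _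
  have hσ1 : σ < 1 / 3 := max_lt hs (by norm_num)
  have hd' : (1 : ℝ) ≤ d := by exact_mod_cast hd
  have hM' : (1 : ℝ) ≤ M := by exact_mod_cast hM
  have hpos : (0 : ℝ) < d * M * (1 / 3 - σ) := by
    have : (0 : ℝ) < 1 / 3 - σ := by linarith
    positivity
  set P := Real.sqrt (144 * (2 * Real.pi) ^ d)
  set R := Real.sqrt (8 * (5 * d : ℝ) ^ d)
  have hP0 : 0 ≤ P := Real.sqrt_nonneg _
  have hR0 : 0 ≤ R := Real.sqrt_nonneg _
  filter_upwards [hb, eventually_growth_le d M ((2 : ℝ) ^ |s| * 2 ^ σ *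
    (R * (Cb * P) ^ 3) ^ (1 / 3 : ℝ)) hpos σ] with n hb hn
  refine le_trans ?_ hn
  have hy := growth_pos n
  have hw := one_le_shellRatio d M n
  have hR : Real.sqrt (8 * (5 * d * concentration M n : ℝ) ^ d) =
      R * growth n ^ ((2 * M + 5) * d / 2 : ℝ) := by
    rw [mul_pow, ← mul_assoc, Real.sqrt_mul (by positivity), concentration_eq,
      ← Real.rpow_natCast (growth n ^ _) d, ← Real.rpow_mul hy.le, sqrt_rpow hy]
  rw [hR, sqrt_profile_integral_eq d M n 144 (by norm_num), two_pow_shell_succ, duration]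
  set y := growth n
  set w := shellRatio d M n
  have e : y ^ ((2 * M + 5) * d / 2 : ℝ) * (y ^ (d * M + 2 * d : ℝ) *
      y ^ (-((2 * M + 5) * d) / 2 : ℝ)) ^ 3 * y ^ (-((2 * M + 1) * d) : ℝ) =
      y ^ (-(d * M) : ℝ) := by
    rw [← Real.rpow_add hy, ← Real.rpow_natCast, ← Real.rpow_mul hy.le, ← Real.rpow_add hy,
      ← Real.rpow_add hy]
    congr 1
    push_cast
    ring
  have e2 : y ^ (d * M * σ : ℝ) * (y ^ (-(d * M) : ℝ)) ^ (1 / 3 : ℝ) =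
      y ^ (-(d * M * (1 / 3 - σ)) : ℝ) := by
    rw [← Real.rpow_mul hy.le, ← Real.rpow_add hy]
    congr 1
    ring
  calc _ ≤ (2 : ℝ) ^ |s| * (2 * (y ^ (d * M : ℝ) * w)) ^ σ *
        (R * y ^ ((2 * M + 5) * d / 2 : ℝ) * ((Cb * y ^ (d * M + 2 * d : ℝ)) *
          (P * y ^ (-((2 * M + 5) * d) / 2 : ℝ))) ^ 3) ^ (1 / 3 : ℝ) *
        (y ^ (-((2 * M + 1) * d) : ℝ)) ^ (1 / 3 : ℝ) := by
        have := hb.1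
        gcongr
        exact hb.2
    _ = (2 : ℝ) ^ |s| * (2 * (y ^ (d * M : ℝ) * w)) ^ σ *
        ((R * (Cb * P) ^ 3) * (y ^ ((2 * M + 5) * d / 2 : ℝ) * (y ^ (d * M + 2 * d : ℝ) *
          y ^ (-((2 * M + 5) * d) / 2 : ℝ)) ^ 3 * y ^ (-((2 * M + 1) * d) : ℝ))) ^ (1 / 3 : ℝ) := by
        rw [mul_assoc ((2 : ℝ) ^ |s| * _), ← Real.mul_rpow (by positivity) (by positivity)]
        congr 2
        ring
    _ = (2 : ℝ) ^ |s| * (2 ^ σ * (y ^ (d * M * σ : ℝ) * w ^ σ)) *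
        ((R * (Cb * P) ^ 3) ^ (1 / 3 : ℝ) * (y ^ (-(d * M) : ℝ)) ^ (1 / 3 : ℝ)) := by
        rw [e, Real.mul_rpow (by positivity) (by positivity),
          Real.mul_rpow (by positivity) (by positivity),
          Real.mul_rpow (by positivity) (by positivity), ← Real.rpow_mul hy.le]
    _ = (2 : ℝ) ^ |s| * 2 ^ σ * (R * (Cb * P) ^ 3) ^ (1 / 3 : ℝ) *
        (y ^ (d * M * σ : ℝ) * (y ^ (-(d * M) : ℝ)) ^ (1 / 3 : ℝ)) * w ^ σ := by ring
    _ = _ := by rw [e2]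

theorem sqrt_add_add_le {x y z : ℝ} (hx : 0 ≤ x) (hy : 0 ≤ y) (hz : 0 ≤ z) :
    Real.sqrt (x ^ 2 + y ^ 2 + z ^ 2) ≤ x + y + z :=
  Real.sqrt_le_iff.2 ⟨by positivity, by
    nlinarith [mul_nonneg hx hy, mul_nonneg hx hz, mul_nonneg hy hz]⟩

/-- All three parts of the force are at most of order `growth n ^ (2dM + 4d)` times the frequency
ratio. With the volume factor `N^(-d/2)` and the duration the exponent becomes `d (M + 3/2 - (2M +
1) / (2 - ε))`. -/
theorem eventually_force_le (hd : 1 ≤ d) {ε : ℝ} (hε : 0 < ε) (hε2 : ε < 2) (hM : 4 ≤ ε * M)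
    (hCb : 0 ≤ Cb) (Cρ : ℝ) (hCρ : 0 ≤ Cρ)
    (hb : ∀ᶠ n in atTop, 0 ≤ b n ∧ b n ≤ Cb * growth n ^ (d * M + 2 * d : ℝ)) :
    ∀ᶠ n : ℕ in atTop, Real.sqrt (24 * (2 * Real.pi / concentration M n) ^ d *
      (d * (Cρ * (duration d M n)⁻¹ * b n * (20 / 2 ^ shell d M n)) ^ 2 +
      144 * (b n * 2 ^ shell d M (n + 1)) ^ 2 + d * (144 * b n ^ 2) ^ 2)) *
      duration d M n ^ (1 / (2 - ε)) ≤ (1 / 2) ^ n := by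
  have hd' : (1 : ℝ) ≤ d := by exact_mod_cast hd
  have hd0 : (0 : ℝ) < d := by linarith
  have h2ε : (0 : ℝ) < 2 - ε := by linarith
  -- This amounts to `(M + 5/2) (2 - ε) ≤ 2M + 1`, which is where `4 ≤ ε M` is needed.
  have hexp : (M + 3 / 2 : ℝ) - (2 * M + 1) * (1 / (2 - ε)) ≤ -1 := by
    have : (M + 5 / 2 : ℝ) ≤ (2 * M + 1) * (1 / (2 - ε)) := by
      rw [mul_one_div, le_div_iff₀ h2ε]
      nlinarith
    linarith
  set P := Real.sqrt (24 * (2 * Real.pi) ^ d)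
  set D := Real.sqrt d
  set C := P * (D * Cρ * Cb * 20 + 12 * Cb + D * 144 * Cb ^ 2)
  filter_upwards [hb, eventually_growth_le d M C hd0 1] with n hb hn
  refine le_trans ?_ hn
  have hy := growth_pos n
  have hy1 := one_le_growth n
  have hw := one_le_shellRatio d M n
  have hτ : (duration d M n)⁻¹ = growth n ^ ((2 * M + 1) * d : ℝ) := by
    rw [duration, ← Real.rpow_neg hy.le, neg_neg]
  have hL : (20 / 2 ^ shell d M n : ℝ) = 20 * growth n ^ (-(d * M) : ℝ) := by
    rw [two_pow_shell, Real.rpow_neg hy.le, div_eq_mul_inv]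
  rw [Real.sqrt_mul (by positivity), sqrt_profile_integral_eq d M n 24 (by norm_num), hτ, hL,
    two_pow_shell_succ, duration, ← Real.rpow_mul hy.le, Real.rpow_one]
  set y := growth n
  set w := shellRatio d M n
  set β := (d * M + 2 * d : ℝ) with hβ
  have hbn := hb.1
  have hDD : D ^ 2 = d := Real.sq_sqrt hd0.le
  have s1 : Real.sqrt (d * (Cρ * y ^ ((2 * M + 1) * d : ℝ) * b n * (20 * y ^ (-(d * M) : ℝ))) ^ 2 +
      144 * (b n * (y ^ (d * M : ℝ) * w)) ^ 2 + d * (144 * b n ^ 2) ^ 2) ≤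
      D * (Cρ * y ^ ((2 * M + 1) * d : ℝ) * b n * (20 * y ^ (-(d * M) : ℝ))) +
        12 * (b n * (y ^ (d * M : ℝ) * w)) + D * (144 * b n ^ 2) := by
    refine le_trans (le_of_eq ?_) (sqrt_add_add_le (by positivity) (by positivity) (by positivity))
    rw [mul_pow D, mul_pow D, hDD]
    congr 1
    ring
  -- The time derivative is the mildest of the three terms: thanks to the potential its exponent is
  -- only `2dM + 3d`.
  have i1 : y ^ ((2 * M + 1) * d : ℝ) * y ^ β * y ^ (-(d * M) : ℝ) ≤
      y ^ (2 * d * M + 4 * d : ℝ) * w := by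
    rw [← Real.rpow_add hy, ← Real.rpow_add hy]
    refine (Real.rpow_le_rpow_of_exponent_le hy1 ?_).trans
      (le_mul_of_one_le_right (by positivity) hw)
    rw [hβ]
    nlinarith
  have i2 : y ^ β * y ^ (d * M : ℝ) ≤ y ^ (2 * d * M + 4 * d : ℝ) := by
    rw [← Real.rpow_add hy]
    refine Real.rpow_le_rpow_of_exponent_le hy1 ?_
    rw [hβ]
    linarith
  have i3 : (y ^ β) ^ 2 ≤ y ^ (2 * d * M + 4 * d : ℝ) * w := by
    rw [← Real.rpow_natCast, ← Real.rpow_mul hy.le]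
    refine (Real.rpow_le_rpow_of_exponent_le hy1 (le_of_eq ?_)).trans
      (le_mul_of_one_le_right (by positivity) hw)
    rw [hβ]
    push_cast
    ring
  have s2 : D * (Cρ * y ^ ((2 * M + 1) * d : ℝ) * b n * (20 * y ^ (-(d * M) : ℝ))) +
        12 * (b n * (y ^ (d * M : ℝ) * w)) + D * (144 * b n ^ 2) ≤
      (D * Cρ * Cb * 20 + 12 * Cb + D * 144 * Cb ^ 2) * (y ^ (2 * d * M + 4 * d : ℝ) * w) := by
    calc _ ≤ D * (Cρ * y ^ ((2 * M + 1) * d : ℝ) * (Cb * y ^ β) * (20 * y ^ (-(d * M) : ℝ))) +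
        12 * ((Cb * y ^ β) * (y ^ (d * M : ℝ) * w)) + D * (144 * (Cb * y ^ β) ^ 2) := by
          gcongr
          · exact hb.2
          · exact hb.2
          · exact hb.2
      _ = D * Cρ * Cb * 20 * (y ^ ((2 * M + 1) * d : ℝ) * y ^ β * y ^ (-(d * M) : ℝ)) +
        12 * Cb * ((y ^ β * y ^ (d * M : ℝ)) * w) + D * 144 * Cb ^ 2 * (y ^ β) ^ 2 := by ring
      _ ≤ D * Cρ * Cb * 20 * (y ^ (2 * d * M + 4 * d : ℝ) * w) +
        12 * Cb * (y ^ (2 * d * M + 4 * d : ℝ) * w) +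
          D * 144 * Cb ^ 2 * (y ^ (2 * d * M + 4 * d : ℝ) * w) := by gcongr
      _ = _ := by ring
  calc _ ≤ P * y ^ (-((2 * M + 5) * d) / 2 : ℝ) *
        ((D * Cρ * Cb * 20 + 12 * Cb + D * 144 * Cb ^ 2) * (y ^ (2 * d * M + 4 * d : ℝ) * w)) *
        y ^ (-((2 * M + 1) * d) * (1 / (2 - ε)) : ℝ) := by
        gcongr
        exact s1.trans s2
    _ = C * (y ^ (-((2 * M + 5) * d) / 2 : ℝ) * y ^ (2 * d * M + 4 * d : ℝ) *
        y ^ (-((2 * M + 1) * d) * (1 / (2 - ε)) : ℝ)) * w := by ring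
    _ ≤ _ := by
        rw [← Real.rpow_add hy, ← Real.rpow_add hy]
        refine mul_le_mul_of_nonneg_right (mul_le_mul_of_nonneg_left
          (Real.rpow_le_rpow_of_exponent_le hy1 ?_) (by positivity)) (by linarith)
        nlinarith

/-- Six powers of the frequency outweigh the number of frequencies, the amplitude and the inverse
duration together: the exponent is `-(2dM - 11d/2)`. -/
theorem eventually_pairing_le (hd : 1 ≤ d) (hM : 3 ≤ M)
    (hb : ∀ᶠ n in atTop, 0 ≤ b n ∧ b n ≤ Cb * growth n ^ (d * M + 2 * d : ℝ)) :
    ∀ᶠ n : ℕ in atTop, 8 * (5 * d * concentration M n : ℝ) ^ d *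
      (b n * Real.sqrt (144 * (2 * Real.pi / concentration M n) ^ d)) /
      (2 ^ shell d M n / 2) ^ 6 * (duration d M n)⁻¹ ≤ (1 / 2) ^ n := by
  have hd' : (1 : ℝ) ≤ d := by exact_mod_cast hd
  have hM' : (3 : ℝ) ≤ M := by exact_mod_cast hM
  set P := Real.sqrt (144 * (2 * Real.pi) ^ d)
  set C := 8 * (5 * d : ℝ) ^ d * Cb * P * 2 ^ 6
  have hs : (0 : ℝ) < 2 * d * M - 11 / 2 * d := by nlinarith
  filter_upwards [hb, eventually_growth_le' C hs] with n hb hn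
  refine le_trans ?_ hn
  have hy := growth_pos n
  have hτ : (duration d M n)⁻¹ = growth n ^ ((2 * M + 1) * d : ℝ) := by
    rw [duration, ← Real.rpow_neg hy.le, neg_neg]
  have hN : (5 * d * concentration M n : ℝ) ^ d =
      (5 * d : ℝ) ^ d * growth n ^ ((2 * M + 5) * d : ℝ) := by
    rw [mul_pow, concentration_eq, ← Real.rpow_natCast (growth n ^ _) d, ← Real.rpow_mul hy.le]
  have hR : ((2 : ℝ) ^ shell d M n / 2) ^ 6 = (2 ^ 6)⁻¹ * growth n ^ (d * M * 6 : ℝ) := by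
    rw [two_pow_shell, div_pow, ← Real.rpow_natCast (growth n ^ _) 6, ← Real.rpow_mul hy.le]
    push_cast
    ring
  rw [hτ, hN, hR, sqrt_profile_integral_eq d M n 144 (by norm_num), div_eq_mul_inv, mul_inv,
    inv_inv, ← Real.rpow_neg hy.le]
  set y := growth n
  have e : y ^ ((2 * M + 5) * d : ℝ) * y ^ (d * M + 2 * d : ℝ) *
      y ^ (-((2 * M + 5) * d) / 2 : ℝ) * y ^ (-(d * M * 6) : ℝ) * y ^ ((2 * M + 1) * d : ℝ) =
      y ^ (-(2 * d * M - 11 / 2 * d) : ℝ) := by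
    rw [← Real.rpow_add hy, ← Real.rpow_add hy, ← Real.rpow_add hy, ← Real.rpow_add hy]
    congr 1
    ring
  calc _ ≤ 8 * ((5 * d : ℝ) ^ d * y ^ ((2 * M + 5) * d : ℝ)) *
      ((Cb * y ^ (d * M + 2 * d : ℝ)) * (P * y ^ (-((2 * M + 5) * d) / 2 : ℝ))) *
      (2 ^ 6 * y ^ (-(d * M * 6) : ℝ)) * y ^ ((2 * M + 1) * d : ℝ) := by
        gcongr
        exact hb.2
    _ = C * (y ^ ((2 * M + 5) * d : ℝ) * y ^ (d * M + 2 * d : ℝ) *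
      y ^ (-((2 * M + 5) * d) / 2 : ℝ) * y ^ (-(d * M * 6) : ℝ) *
      y ^ ((2 * M + 1) * d : ℝ)) := by ring
    _ = _ := by rw [e]

end Bounds

/-! ### The amplitude of a stage -/

/-- The modulation frequency of the low-frequency field of a stage. -/
def lowFrequency (d M n : ℕ) : ℕ := 2 ^ shell d M n - 2 * d ^ 2 * concentration M n

/-- The modulation frequency of the high-frequency field of a stage. -/
def highFrequency (d M n : ℕ) : ℕ := 2 ^ shell d M (n + 1) - 2 ^ shell d M n

/-- The rate of energy transfer of a stage of amplitude one. -/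
def stageTransfer {d : ℕ} (M : ℕ) (i₀ i₁ i₂ : Fin d) (n : ℕ) : ℝ :=
  StageParams.transfer (concentration M n) (lowFrequency d M n) (highFrequency d M n) i₀ i₁ i₂

/-- The amplitude at which a stage transfers a unit of energy. -/
def amplitude {d : ℕ} (M : ℕ) (i₀ i₁ i₂ : Fin d) (n : ℕ) : ℝ :=
  (duration d M n * (∫ t, unitBump t ^ 3) * stageTransfer M i₀ i₁ i₂ n) ^ (-(1 / 3) : ℝ)

section

variable {d M : ℕ} {i₀ i₁ i₂ : Fin d}

theorem shell_add_le (n : ℕ) : shell d M n + d * M ≤ shell d M (n + 1) := by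
  have h1 : shell d M (n + 1) = shell d M n + d * M * (2 * n + 1) := by unfold shell; ring
  have h2 : d * M ≤ d * M * (2 * n + 1) := Nat.le_mul_of_pos_right _ (by omega)
  omega

theorem strictMono_shell (hdM : 1 ≤ d * M) : StrictMono (shell d M) :=
  strictMono_nat_of_lt_succ fun n => by
    have := shell_add_le (d := d) (M := M) n
    omega

/-- From `(d - 2) M ≥ 6 > 5`. This says that the frequencies of a stage exceed the bandwidth of its
envelope by a power of the growth. -/
theorem exponent_gap_pos (hd : 3 ≤ d) (hM : 6 ≤ M) : (0 : ℝ) < d * M - (2 * M + 5) := by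
  have h1 : (3 : ℝ) ≤ d := by exact_mod_cast hd
  have h2 : (6 : ℝ) ≤ M := by exact_mod_cast hM
  nlinarith

theorem eventually_mul_concentration_le (hd : 3 ≤ d) (hM : 6 ≤ M) (C : ℝ) :
    ∀ᶠ n : ℕ in atTop, C * concentration M n ≤ 2 ^ shell d M n := by
  filter_upwards [eventually_growth_le' C (exponent_gap_pos hd hM)] with n hn
  have hy := growth_pos n
  have h1 : C * growth n ^ (-(d * M - (2 * M + 5)) : ℝ) ≤ 1 :=
    hn.trans (pow_le_one₀ (by norm_num) (by norm_num))
  rw [concentration_eq, two_pow_shell]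
  have e : growth n ^ (2 * M + 5 : ℝ) =
      growth n ^ (-(d * M - (2 * M + 5)) : ℝ) * growth n ^ (d * M : ℝ) := by
    rw [← Real.rpow_add hy]
    congr 1
    ring
  rw [e, ← mul_assoc]
  exact mul_le_of_le_one_left (by positivity) h1

theorem eventually_stageParams (hd : 3 ≤ d) (hM : 6 ≤ M) (h01 : i₀ ≠ i₁) (h02 : i₀ ≠ i₂)
    (h12 : i₁ ≠ i₂) : ∀ᶠ n : ℕ in atTop, StageParams d (concentration M n) (lowFrequency d M n)
      (highFrequency d M n) (shell d M n) (shell d M (n + 1)) i₀ i₁ i₂ := by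
  filter_upwards [eventually_mul_concentration_le hd hM (8 * d ^ 2)] with n hn
  have h8 : 8 * d ^ 2 * concentration M n ≤ 2 ^ shell d M n := by exact_mod_cast hn
  have h2 : 2 * d ^ 2 * concentration M n ≤ 2 ^ shell d M n := by
    rw [mul_assoc] at h8 ⊢
    omega
  have hdM : 18 ≤ d * M := Nat.mul_le_mul hd hM
  have hgap : shell d M n + 3 ≤ shell d M (n + 1) := by
    have := shell_add_le (d := d) (M := M) n
    omega
  exact ⟨concentration_pos M n, h01, h02, h12, Nat.sub_add_cancel h2,
    Nat.sub_add_cancel (Nat.pow_le_pow_right two_pos (by omega)), h8, hgap⟩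

/-- A constant in the lower bound for the energy transfer. -/
def transferConst (d : ℕ) : ℝ := (1 / 512) ^ d / 4

theorem transferConst_pos (d : ℕ) : 0 < transferConst d := by unfold transferConst; positivity

/-- Write `c` for `transferConst d`. As `(1/512) ^ d = 4 c` and `L ≥ 2 ^ Q / 2`, the main term is at
least `2 c` in these units. The error carries `N` in place of `L` and is at most `c`. -/
theorem eventually_stageTransfer_ge (hd : 3 ≤ d) (hM : 6 ≤ M) (h01 : i₀ ≠ i₁) (h02 : i₀ ≠ i₂)
    (h12 : i₁ ≠ i₂) : ∀ᶠ n : ℕ in atTop,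
      transferConst d * (growth n ^ (d * M : ℝ) * growth n ^ (-((2 * M + 5) * d) : ℝ)) ≤
        stageTransfer M i₀ i₁ i₂ n := by
  filter_upwards [eventually_stageParams hd hM h01 h02 h12, eventually_mul_concentration_le hd hM
    ((300 * d + 3000) * (2 * Real.pi) ^ d / transferConst d)] with n h hn
  refine le_trans ?_ h.transfer_ge
  have hN : (1 / (512 * concentration M n) : ℝ) ^ d =
      (1 / 512) ^ d * growth n ^ (-((2 * M + 5) * d) : ℝ) := by
    have := profile_integral_eq d M n
    rw [div_pow, div_eq_mul_inv] at this
    have h3 : (((concentration M n : ℝ)) ^ d)⁻¹ = growth n ^ (-((2 * M + 5) * d) : ℝ) :=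
      mul_left_cancel₀ (by positivity : ((2 * Real.pi) ^ d : ℝ) ≠ 0) this
    rw [← h3, one_div, one_div, inv_pow, inv_pow, mul_pow, mul_inv]
  have hL := h.half_pow_le
  have hc := transferConst_pos d
  rw [profile_integral_eq, hN]
  rw [two_pow_shell] at hL hn
  have hz : 0 < growth n ^ (-((2 * M + 5) * d) : ℝ) := Real.rpow_pos_of_pos (growth_pos n) _
  set z := growth n ^ (-((2 * M + 5) * d) : ℝ)
  set a := growth n ^ (d * M : ℝ)
  have h1 : (300 * d + 3000) * (2 * Real.pi) ^ d * concentration M n ≤ transferConst d * a := by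
    rw [div_mul_eq_mul_div, div_le_iff₀ hc] at hn
    linarith
  have h2 : (1 / 512 : ℝ) ^ d = 4 * transferConst d := by unfold transferConst; ring
  rw [h2]
  calc transferConst d * (a * z) = a / 2 * (4 * transferConst d * z) - transferConst d * a * z := by
        ring
    _ ≤ lowFrequency d M n * (4 * transferConst d * z) -
        (300 * d + 3000) * (2 * Real.pi) ^ d * concentration M n * z := by gcongr
    _ = _ := by ring

/-- The transfer is cubic in the amplitude, whence the power `-1/3` in its definition. -/
theorem eventually_amplitude (hd : 3 ≤ d) (hM : 6 ≤ M) (h01 : i₀ ≠ i₁) (h02 : i₀ ≠ i₂)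
    (h12 : i₁ ≠ i₂) : ∀ᶠ n : ℕ in atTop, duration d M n * (∫ t, unitBump t ^ 3) *
      amplitude M i₀ i₁ i₂ n ^ 3 * stageTransfer M i₀ i₁ i₂ n = 1 := by
  filter_upwards [eventually_stageTransfer_ge hd hM h01 h02 h12] with n hn
  have hy := growth_pos n
  have hc := transferConst_pos d
  have ht : 0 < stageTransfer M i₀ i₁ i₂ n := lt_of_lt_of_le (by positivity) hn
  have hz : 0 < duration d M n * (∫ t, unitBump t ^ 3) * stageTransfer M i₀ i₁ i₂ n :=
    mul_pos (mul_pos (duration_pos d M n) integral_unitBump_cube_pos) ht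
  rw [amplitude, ← Real.rpow_natCast, ← Real.rpow_mul hz.le, mul_right_comm]
  norm_num
  rw [Real.rpow_neg_one, mul_inv_cancel₀ hz.ne']

/-- Duration times transfer has the exponent `-(2M + 1) d + dM - (2M + 5) d = -3 (dM + 2d)`. -/
theorem exists_amplitude_le (hd : 3 ≤ d) (hM : 6 ≤ M) (h01 : i₀ ≠ i₁) (h02 : i₀ ≠ i₂)
    (h12 : i₁ ≠ i₂) : ∃ C : ℝ, 0 ≤ C ∧ ∀ᶠ n : ℕ in atTop, 0 ≤ amplitude M i₀ i₁ i₂ n ∧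
      amplitude M i₀ i₁ i₂ n ≤ C * growth n ^ (d * M + 2 * d : ℝ) := by
  have hc := transferConst_pos d
  have hI := integral_unitBump_cube_pos
  refine ⟨((∫ t, unitBump t ^ 3) * transferConst d) ^ (-(1 / 3) : ℝ), by positivity, ?_⟩
  filter_upwards [eventually_stageTransfer_ge hd hM h01 h02 h12] with n hn
  have hy := growth_pos n
  have hτ := duration_pos d M n
  have hlow : ((∫ t, unitBump t ^ 3) * transferConst d) * growth n ^ (-(3 * (d * M + 2 * d)) : ℝ) ≤
      duration d M n * (∫ t, unitBump t ^ 3) * stageTransfer M i₀ i₁ i₂ n := by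
    have e : growth n ^ (-(3 * (d * M + 2 * d)) : ℝ) = duration d M n *
        (growth n ^ (d * M : ℝ) * growth n ^ (-((2 * M + 5) * d) : ℝ)) := by
      rw [duration, ← Real.rpow_add hy, ← Real.rpow_add hy]
      congr 1
      ring
    calc _ = duration d M n * (∫ t, unitBump t ^ 3) * (transferConst d *
          (growth n ^ (d * M : ℝ) * growth n ^ (-((2 * M + 5) * d) : ℝ))) := by rw [e]; ring
      _ ≤ _ := by gcongr
  have hpos : 0 < ((∫ t, unitBump t ^ 3) * transferConst d) *
      growth n ^ (-(3 * (d * M + 2 * d)) : ℝ) := by positivity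
  refine ⟨Real.rpow_nonneg (hpos.le.trans hlow) _, ?_⟩
  refine (Real.rpow_le_rpow_of_nonpos hpos hlow (by norm_num)).trans (le_of_eq ?_)
  rw [Real.mul_rpow (by positivity) (by positivity), ← Real.rpow_mul hy.le]
  congr 2
  ring

/-- Relative to the transfer, with `w` the frequency ratio, the low edge contributes `(N / 2 ^ Q)²
w` and the high edge `w⁻² w = w⁻¹`; the extra `w` is the derivative in the crude bound of the
nonlinearity. So `w` has to tend to infinity, but more slowly than the square of `2 ^ Q / N`. -/
theorem eventually_fluxError_le (hd : 3 ≤ d) (hM : 6 ≤ M) (h01 : i₀ ≠ i₁) (h02 : i₀ ≠ i₂)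
    (h12 : i₁ ≠ i₂) (K : ℝ) : ∀ᶠ n : ℕ in atTop, duration d M n * (∫ t, unitBump t ^ 3) *
      amplitude M i₀ i₁ i₂ n ^ 3 *
        StageParams.fluxError d (concentration M n) (shell d M n) (shell d M (n + 1)) K ≤
      (1 / 2) ^ n := by
  have hc := transferConst_pos d
  set A := K ^ 2 * 1728 * d * (2 * Real.pi) ^ d / transferConst d with hA
  have hdM : 1 ≤ d * M := Nat.mul_pos (by omega) (by omega)
  have hd' : (3 : ℝ) ≤ d := by exact_mod_cast hd
  have hM' : (6 : ℝ) ≤ M := by exact_mod_cast hM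
  have hs : (0 : ℝ) < 2 * (d * M) - 2 * (2 * M + 5) := by nlinarith
  filter_upwards [eventually_amplitude hd hM h01 h02 h12,
    eventually_stageTransfer_ge hd hM h01 h02 h12,
    eventually_growth_le d M (2 * (A * 16 * d ^ 4)) hs 1,
    eventually_inv_shellRatio_le hdM (2 * (A * 4))] with n h1 h2 h3 h4
  have hy := growth_pos n
  have hτ := duration_pos d M n
  have hw := one_le_shellRatio d M n
  have hI := integral_unitBump_cube_pos
  have ht : 0 < stageTransfer M i₀ i₁ i₂ n := lt_of_lt_of_le (by positivity) h2
  have hk : duration d M n * (∫ t, unitBump t ^ 3) * amplitude M i₀ i₁ i₂ n ^ 3 =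
      (stageTransfer M i₀ i₁ i₂ n)⁻¹ := eq_inv_of_mul_eq_one_left h1
  rw [hk, inv_mul_le_iff₀ ht]
  refine le_trans ?_ (mul_le_mul_of_nonneg_right h2 (by positivity))
  rw [StageParams.fluxError, profile_integral_eq, two_pow_shell_succ, two_pow_shell,
    concentration_eq]
  rw [Real.rpow_one] at h3
  have e : growth n ^ (-(2 * (d * M) - 2 * (2 * M + 5)) : ℝ) =
      (growth n ^ (2 * M + 5 : ℝ)) ^ 2 / (growth n ^ (d * M : ℝ)) ^ 2 := by
    rw [← Real.rpow_natCast, ← Real.rpow_natCast, ← Real.rpow_mul hy.le, ← Real.rpow_mul hy.le,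
      ← Real.rpow_sub hy]
    congr 1
    push_cast
    ring
  rw [e] at h3
  have ha : 0 < growth n ^ (d * M : ℝ) := by positivity
  have hz : 0 < growth n ^ (-((2 * M + 5) * d) : ℝ) := by positivity
  set a := growth n ^ (d * M : ℝ)
  set z := growth n ^ (-((2 * M + 5) * d) : ℝ)
  set N := growth n ^ (2 * M + 5 : ℝ)
  set w := shellRatio d M n
  have hw0 : 0 < w := by linarith
  have hAc : A * transferConst d = K ^ 2 * 1728 * d * (2 * Real.pi) ^ d := by
    rw [hA, div_mul_cancel₀ _ hc.ne']
  calc _ = transferConst d * (a * z) *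
        (A * 16 * d ^ 4 * (N ^ 2 / a ^ 2) * w + A * 4 * w⁻¹) := by
        have : ((K * (4 * d ^ 2 * N / a)) ^ 2 + (K * (2 * a / (a * w))) ^ 2) *
            (1728 * d * (a * w) * ((2 * Real.pi) ^ d * z)) =
            (K ^ 2 * 1728 * d * (2 * Real.pi) ^ d) * (a * z) *
              (16 * d ^ 4 * (N ^ 2 / a ^ 2) * w + 4 * w⁻¹) := by
          field_simp
          ring
        rw [this, ← hAc]
        ring
    _ ≤ transferConst d * (a * z) * (1 / 2) ^ n := by
        refine mul_le_mul_of_nonneg_left ?_ (by positivity)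
        linarith

end

/-! ### The solution -/

theorem mixedNorm_lt_top {d : ℕ} {T : ℝ} {τ : ℕ → ℝ} {S : ℕ → Finset (Fin d → ℤ)}
    {U : ℕ → Euc d → Euc d} (h : StageFamily T τ S U) {N : ℕ → ℕ} (hN : ∀ m, 0 < N m) {b : ℕ → ℝ}
    (hb : ∀ m, 0 ≤ b m) (hU : ∀ m x, ‖U m x‖ ≤ 12 * b m * profile (N m) x) {p q : ℝ≥0∞}
    (hp : p ≠ 0) (hq : 1 ≤ q)
    (hle : ∀ m, 12 * b m * (2 * Real.pi) ^ d * (N m : ℝ) ^ (-(d * (1 / q.toReal))) *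
      τ m ^ (1 / p.toReal) ≤ (1 / 2) ^ m) : mixedNorm T p q (gluedField T τ U) < ⊤ := by
  refine h.eLpNorm_time_lt_top hp zero_le_one (c := fun m =>
    12 * b m * (2 * Real.pi) ^ d * (N m : ℝ) ^ (-(d * (1 / q.toReal)))) (fun m => ?_)
    (fun m t ht => ?_) (fun t ht => ?_) fun m => ?_
  · have := hb m
    positivity
  · rw [(h.glued_of_mem ht).1, mul_one_div]
    refine eLpNorm_le_of_norm_le_profile (hN m) ((h.trig m).contDiff.continuous.const_smul _)
      (mul_nonneg (by norm_num) (hb m)) (fun x => ?_) hq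
    rw [Pi.smul_apply, norm_smul, Real.norm_eq_abs, abs_of_nonneg (timeBump_nonneg _ _ _ _)]
    exact (mul_le_of_le_one_left (norm_nonneg _) (timeBump_le_one _ _ _ _)).trans (hU m x)
  · rw [(h.glued_of_notMem ht).1, eLpNorm_zero]
  · rw [one_mul]
    exact hle m

theorem besovNorm_zero {d : ℕ} (χ : Euc d → ℝ) (s : ℝ) (p r : ℝ≥0∞) :
    besovNorm χ s p r (0 : Euc d → Euc d) = 0 := by
  have h1 : ∀ (m : Euc d → ℝ), fourierMultiplier m (0 : Euc d → Euc d) = 0 := fun m => by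
    have h := fourierMultiplier_smul m 0 (0 : Euc d → Euc d)
    simp only [zero_smul] at h
    exact h
  have h2 : ∀ n, lpBlock χ n (0 : Euc d → Euc d) = 0 := fun n => by
    rw [lpBlock_eq]
    exact h1 _
  rw [besovNorm]
  simp only [h2, eLpNorm_zero, mul_zero]
  exact eLpNorm_zero

/-- The term with the time derivative of the bump carries the large factor `1 / τ m`, which is
beaten by the decay of the coefficients of `φ` at the high frequencies of `U m`. In the other two
terms the derivatives move to `φ`, and they vanish with the energy. -/
theorem StageFamily.exists_pairing_bound {d : ℕ} {T : ℝ} {τ : ℕ → ℝ}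
    {S : ℕ → Finset (Fin d → ℤ)} {U : ℕ → Euc d → Euc d} (h : StageFamily T τ S U)
    (hE : Tendsto (fun m => energySq (U m)) atTop (𝓝 0)) {R : ℕ → ℝ} (hR : ∀ m, 0 < R m)
    (hS : ∀ m, ∀ k ∈ S m, ∃ j, R m ≤ |(k j : ℝ)|)
    (hle : ∀ m, (S m).card * Real.sqrt (energySq (U m)) / R m ^ 6 * (τ m)⁻¹ ≤ (1 / 2) ^ m)
    {φ : Euc d → Euc d} (hφ : ContDiff ℝ ∞ φ) (pφ : TorusPeriodic φ) :
    ∃ δ : ℕ → ℝ, Tendsto δ atTop (𝓝 0) ∧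
      ∀ m t, |torusInner (stageForce T τ U m t) φ| ≤ δ m := by
  obtain ⟨C, hC0, hC⟩ := exists_torusCoeff_decay hφ pφ 6
  obtain ⟨C', hC'0, hC'⟩ := exists_abs_torusInner_divTensor_le hφ pφ
  obtain ⟨Cρ, hCρ0, hCρ⟩ := exists_abs_deriv_unitBump_le
  have hΔ := contDiff_laplacian hφ
  have hm : MemLp (Laplacian.laplacian φ) 2 (torusMeasure d) :=
    (memLp_two_iff_integrable_sq_norm hΔ.continuous.aestronglyMeasurable).2
      (hΔ.continuous.norm.pow 2).integrable_torus
  set A := (eLpNorm (Laplacian.laplacian φ) 2 (torusMeasure d)).toReal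
  refine ⟨fun m => Cρ * ((2 * Real.pi) ^ d * (d * C)) * (1 / 2) ^ m +
    Real.sqrt (energySq (U m)) * A + C' * energySq (U m), ?_, fun m t => ?_⟩
  · have h1 : Tendsto (fun m : ℕ => (1 / 2 : ℝ) ^ m) atTop (𝓝 0) :=
      tendsto_pow_atTop_nhds_zero_of_lt_one (by norm_num) (by norm_num)
    have := ((h1.const_mul (Cρ * ((2 * Real.pi) ^ d * (d * C)))).add
      (hE.sqrt.mul_const A)).add (hE.const_mul C')
    simpa using this
  · have hU := h.trig m
    have hτ := h.τ_pos m
    rw [h.torusInner_stageForce m t hφ.continuous, torusInner_laplacian_comm hU.contDiff hφ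
      hU.torusPeriodic pφ]
    have b1 := abs_torusInner_le_of_high_freq hU hφ.continuous (hR m) hC (hS m)
    have b2 := abs_torusInner_le hU.contDiff.continuous hm
    have b3 := hC' _ hU.contDiff hU.torusPeriodic
    have hθ : |timeBump T τ m t| ≤ 1 := by
      rw [abs_of_nonneg (timeBump_nonneg _ _ _ _)]
      exact timeBump_le_one _ _ _ _
    have hθ2 : |timeBump T τ m t ^ 2| ≤ 1 := by
      rw [abs_pow]
      exact pow_le_one₀ (abs_nonneg _) hθ
    have hθ' : |deriv (timeBump T τ m) t| ≤ Cρ * (τ m)⁻¹ := by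
      rw [deriv_timeBump, abs_mul, abs_of_pos (inv_pos.2 hτ)]
      exact mul_le_mul_of_nonneg_right (hCρ _) (inv_pos.2 hτ).le
    refine (abs_add_le _ _).trans (add_le_add ((abs_sub _ _).trans (add_le_add ?_ ?_)) ?_)
    · rw [abs_mul]
      calc _ ≤ Cρ * (τ m)⁻¹ * ((2 * Real.pi) ^ d *
            ((S m).card * d * C * Real.sqrt (energySq (U m))) / R m ^ 6) := by gcongr
        _ = Cρ * ((2 * Real.pi) ^ d * (d * C)) *
            ((S m).card * Real.sqrt (energySq (U m)) / R m ^ 6 * (τ m)⁻¹) := by ring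
        _ ≤ _ := by
            gcongr
            exact hle m
    · rw [abs_mul]
      exact (mul_le_of_le_one_left (abs_nonneg _) hθ).trans b2
    · rw [abs_mul]
      exact (mul_le_of_le_one_left (abs_nonneg _) hθ2).trans b3

theorem dyadicFlux_smul {d : ℕ} (χ : Euc d → ℝ) (N L L' : ℕ) (i₀ i₁ i₂ : Fin d) (b : ℝ) (q : ℕ) :
    torusInner (lpLow χ q (convective (b • stageField N L L' i₀ i₁ i₂)))
      (lpLow χ q (b • stageField N L L' i₀ i₁ i₂)) =
      b ^ 3 * StageParams.dyadicFlux χ N L L' i₀ i₁ i₂ q := by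
  rw [convective_smul, lpLow_smul, lpLow_smul, torusInner_smul_left, torusInner_smul_right,
    StageParams.dyadicFlux]
  ring

end

theorem theorem1p5 (d : ℕ) (hd : 3 ≤ d) (χ : Euc d → ℝ) (hχ : IsLPCutoff χ)
    (T : ℝ) (hT : 0 < T) (ε : ℝ) (hε : 0 < ε) :
    ∃ u f : ℝ → Euc d → Euc d,
      SmoothSolutionClass T u f ∧
      EnergyEquality T u f ∧
      (∃ L : ℝ, 0 < L ∧ Tendsto (fun q : ℕ => |energyFlux χ T u q|) atTop (𝓝 L)) ∧
      timeBesovNorm χ T 3 (1 / 3 - ε) 3 ⊤ u < ⊤ ∧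
      (∀ p q : ℝ≥0∞, 1 ≤ p → 1 ≤ q → 2 / p + 2 / q = 1 + ENNReal.ofReal ε →
        mixedNorm T p q u < ⊤) ∧
      (ε < 2 → timeBesovNorm χ T (ENNReal.ofReal (2 - ε)) (-1) 2 2 f < ⊤) := by
  -- The bound 6 makes frequencies exceed the bandwidth already for `d = 3`; the bound `4 / ε`
  -- serves the `L^p L^q` and force estimates.
  obtain ⟨M, hM6, hMε⟩ : ∃ M : ℕ, 6 ≤ M ∧ 4 ≤ ε * M := by
    obtain ⟨M, hM⟩ := exists_nat_ge (4 / ε)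
    refine ⟨max 6 M, le_max_left _ _, ?_⟩
    rw [div_le_iff₀ hε, mul_comm] at hM
    exact hM.trans (mul_le_mul_of_nonneg_left (by exact_mod_cast le_max_right 6 M) hε.le)
  have hd1 : 1 ≤ d := by omega
  have hdM : 1 ≤ d * M := Nat.mul_pos hd1 (by omega)
  obtain ⟨i₀, i₁, i₂, h01, h02, h12⟩ : ∃ i₀ i₁ i₂ : Fin d, i₀ ≠ i₁ ∧ i₀ ≠ i₂ ∧ i₁ ≠ i₂ :=
    ⟨⟨0, by omega⟩, ⟨1, by omega⟩, ⟨2, by omega⟩, by simp, by simp, by simp⟩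
  obtain ⟨K, -, hK⟩ := hχ.exists_le_mul
  obtain ⟨Cρ, hCρ0, hCρ⟩ := exists_abs_deriv_unitBump_le
  obtain ⟨Cb, hCb, hb⟩ := exists_amplitude_le hd hM6 h01 h02 h12
  -- With `ε < 2` as a premise inside, the construction does not depend on whether the bound on the
  -- force is asked for.
  have hforce : ∀ᶠ n : ℕ in atTop, ε < 2 → Real.sqrt (24 * (2 * Real.pi / concentration M n) ^ d *
      (d * (Cρ * (duration d M n)⁻¹ * amplitude M i₀ i₁ i₂ n * (20 / 2 ^ shell d M n)) ^ 2 +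
      144 * (amplitude M i₀ i₁ i₂ n * 2 ^ shell d M (n + 1)) ^ 2 +
      d * (144 * amplitude M i₀ i₁ i₂ n ^ 2) ^ 2)) *
      duration d M n ^ (1 / (2 - ε)) ≤ (1 / 2) ^ n := by
    by_cases h2 : ε < 2
    · filter_upwards [eventually_force_le hd1 hε h2 hMε hCb Cρ hCρ0.le hb] with n hn _
      exact hn
    · exact Eventually.of_forall fun n h => absurd h h2
  have hdur : ∀ᶠ n : ℕ in atTop, duration d M n ≤ T / 4 * (1 / 2) ^ n := by
    have hs : (0 : ℝ) < (2 * M + 1) * d := by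
      have : (1 : ℝ) ≤ d := by exact_mod_cast hd1
      positivity
    filter_upwards [eventually_growth_le' (4 / T) hs] with n hn
    calc duration d M n = T / 4 * (4 / T * duration d M n) := by field_simp
      _ ≤ _ := mul_le_mul_of_nonneg_left hn (by positivity)
  -- All estimates hold from a common index on; stage `m` uses the parameters of index `m + n₀`.
  obtain ⟨n₀, hn₀⟩ := eventually_atTop.1 ((eventually_stageParams hd hM6 h01 h02 h12).and
    (hb.and (hdur.and (hforce.and ((eventually_energy_le hd1 hb).and
    ((eventually_dissipation_le hd1 hb).and ((eventually_mixed_le hd1 hCb hb).and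
    ((eventually_besov_le hd1 (by omega) hCb (by linarith : 1 / 3 - ε < 1 / 3) hb).and
    ((eventually_pairing_le hd1 (by omega) hb).and
    ((eventually_amplitude hd hM6 h01 h02 h12).and
    (eventually_fluxError_le hd hM6 h01 h02 h12 K)))))))))))
  have hn (m : ℕ) := hn₀ (m + n₀) (Nat.le_add_left _ _)
  clear hn₀ hforce hdur hb
  have hhalf : ∀ m : ℕ, (1 / 2 : ℝ) ^ (m + n₀) ≤ (1 / 2) ^ m := fun m =>
    pow_le_pow_of_le_one (by norm_num) (by norm_num) (Nat.le_add_right _ _)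
  set τ : ℕ → ℝ := fun m => duration d M (m + n₀) with hτ
  set b : ℕ → ℝ := fun m => amplitude M i₀ i₁ i₂ (m + n₀) with hbdef
  set N : ℕ → ℕ := fun m => concentration M (m + n₀) with hN
  set V : ℕ → Euc d → Euc d := fun m => stageField (N m) (lowFrequency d M (m + n₀))
    (highFrequency d M (m + n₀)) i₀ i₁ i₂ with hV
  set U : ℕ → Euc d → Euc d := fun m => b m • V m with hU
  have hP (m : ℕ) := (hn m).1
  have hb0 : ∀ m, 0 ≤ b m := fun m => (hn m).2.1.1
  have hfam : StageFamily T τ (fun m => freqLow d (N m) (lowFrequency d M (m + n₀)) i₁ ∪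
      freqHigh d (N m) (lowFrequency d M (m + n₀)) (highFrequency d M (m + n₀)) i₀ i₁) U := by
    refine ⟨hT, fun m => duration_pos _ _ _, fun m => ?_, fun m =>
      StageParams.trigField_smul _ _ _ _ _ _ _, fun m x => ?_⟩
    · refine (hn m).2.2.1.trans ((mul_le_mul_of_nonneg_left (hhalf m) (by positivity)).trans
        (le_of_eq ?_))
      ring
    · rw [hU]
      simp only [divergence_smul]
      rw [hV]
      simp only [StageParams.divergence_eq_zero, mul_zero]
  have hE : ∀ m, energySq (U m) ≤ (1 / 2) ^ m := fun m =>
    ((hP m).energySq_smul_le (b m)).trans ((hn m).2.2.2.2.1.trans (hhalf m))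
  have hE0 : Tendsto (fun m => energySq (U m)) atTop (𝓝 0) :=
    squeeze_zero (fun m => energySq_nonneg _) hE
      (tendsto_pow_atTop_nhds_zero_of_lt_one (by norm_num) (by norm_num))
  have hD : ∀ m, dissipationSq (U m) * τ m ≤ (1 / 2) ^ m := fun m =>
    (mul_le_mul_of_nonneg_right ((hP m).dissipationSq_smul_le (b m))
      (duration_pos _ _ _).le).trans ((hn m).2.2.2.2.2.1.trans (hhalf m))
  have hmix : ∀ p q : ℝ≥0∞, p ≠ 0 → 1 ≤ q →
      (M + 2 : ℝ) - (2 * M + 5) * (1 / q.toReal) - (2 * M + 1) * (1 / p.toReal) ≤ -(1 / 2) →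
      mixedNorm T p q (gluedField T τ U) < ⊤ := fun p q hp hq hpq =>
    mixedNorm_lt_top hfam (fun m => concentration_pos _ _) hb0
      (fun m x => (hP m).norm_smul_le (hb0 m) x) hp hq fun m =>
        ((hn m).2.2.2.2.2.2.1 _ _ hpq).trans (hhalf m)
  have hpair : ∀ φ : Euc d → Euc d, ContDiff ℝ ∞ φ → TorusPeriodic φ → ∃ δ : ℕ → ℝ,
      Tendsto δ atTop (𝓝 0) ∧ ∀ m t, |torusInner (stageForce T τ U m t) φ| ≤ δ m := by
    intro φ hφ pφ
    refine hfam.exists_pairing_bound hE0 (R := fun m => 2 ^ shell d M (m + n₀) / 2)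
      (fun m => by positivity) (fun m k hk => (hP m).exists_large_freq hk) (fun m => ?_) hφ pφ
    refine le_trans ?_ ((hn m).2.2.2.2.2.2.2.2.1.trans (hhalf m))
    have h1 := (hP m).card_le
    have h2 : Real.sqrt (energySq (U m)) ≤
        b m * Real.sqrt (144 * (2 * Real.pi / N m) ^ d) := by
      refine (Real.sqrt_le_sqrt ((hP m).energySq_smul_le (b m))).trans (le_of_eq ?_)
      rw [Real.sqrt_mul (sq_nonneg _), Real.sqrt_sq (hb0 m)]
    have h3 := duration_pos d M (m + n₀)
    gcongr
  have hflux : Tendsto (energyFlux χ T (gluedField T τ U)) atTop (𝓝 1) := by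
    have hκ : ∀ m, 0 ≤ τ m * (∫ t, unitBump t ^ 3) * b m ^ 3 := fun m =>
      mul_nonneg (mul_nonneg (duration_pos _ _ _).le integral_unitBump_cube_pos.le)
        (pow_nonneg (hb0 m) 3)
    have herr : ∀ m, τ m * (∫ t, unitBump t ^ 3) * b m ^ 3 *
        StageParams.fluxError d (N m) (shell d M (m + n₀)) (shell d M (m + n₀ + 1)) K ≤
          (1 / 2) ^ m := fun m => (hn m).2.2.2.2.2.2.2.2.2.2.trans (hhalf m)
    refine hfam.tendsto_energyFlux χ (Q := fun m => shell d M (m + n₀))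
      (fun m k hmk => strictMono_shell hdM (by omega)) (δ := fun m => (1 / 2) ^ m)
      (summable_geometric_of_lt_one (by norm_num) (by norm_num)) (fun m q h1 h2 => ?_)
      (fun m q h1 => ?_) fun m q h1 => ?_
    · have h2' : q < shell d M (m + n₀ + 1) := by rwa [Nat.add_right_comm] at h2
      rw [hfam.integral_timeBump_cube, hU]
      simp only [hV, dyadicFlux_smul]
      -- The amplitude turns the transfer into exactly 1, so the deviation of the flux from 1 is the
      -- normalized edge error.
      have h3 := (hP m).abs_dyadicFlux_sub_le hχ hK h1 h2'
      have h4 : ∀ x, τ m * (∫ t, unitBump t ^ 3) * (b m ^ 3 * x) - 1 =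
          τ m * (∫ t, unitBump t ^ 3) * b m ^ 3 * (x - stageTransfer M i₀ i₁ i₂ (m + n₀)) :=
        fun x => by linear_combination (hn m).2.2.2.2.2.2.2.2.2.1
      rw [h4, abs_mul, abs_of_nonneg (hκ m)]
      exact (mul_le_mul_of_nonneg_left h3 (hκ m)).trans (herr m)
    · rw [hfam.integral_timeBump_cube, hU]
      simp only [hV, dyadicFlux_smul]
      have h3 := (hP m).abs_dyadicFlux_le hχ hK h1
      rw [← mul_assoc, abs_mul, abs_of_nonneg (hκ m)]
      exact (mul_le_mul_of_nonneg_left h3 (hκ m)).trans (herr m)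
    · have h1' : shell d M (m + n₀ + 1) ≤ q := by rwa [Nat.add_right_comm] at h1
      rw [hU]
      simp only [hV, dyadicFlux_smul]
      rw [(hP m).dyadicFlux_of_ge hχ h1', mul_zero]
  -- Boundedness of the energy is the mixed norm with `p = ⊤`, `q = 2`, for which the exponent
  -- condition holds with equality.
  refine ⟨gluedField T τ U, gluedForce T τ U,
    hfam.smoothSolutionClass hE0 (hmix ⊤ 2 ENNReal.top_ne_zero (by norm_num) ?_) hD hpair,
    hfam.energyEquality hE0 hD, ⟨1, one_pos, by simpa using hflux.abs⟩, ?_, fun p q hp hq hpq => ?_,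
    fun hε2 => ?_⟩
  · rw [ENNReal.toReal_top, ENNReal.toReal_ofNat]
    linarith
  · refine hfam.eLpNorm_time_lt_top (by norm_num) zero_le_one (c := fun m =>
      (2 : ℝ) ^ |1 / 3 - ε| * (2 * 2 ^ shell d M (m + n₀ + 1) : ℝ) ^ (max (1 / 3 - ε) 0) *
        (Real.sqrt (8 * (5 * d * N m : ℝ) ^ d) *
          (b m * Real.sqrt (144 * (2 * Real.pi / N m) ^ d)) ^ 3) ^ (1 / 3 : ℝ)) (fun m => ?_)
      (fun m t ht => ?_) (fun t ht => ?_) fun m => ?_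
    · have := hb0 m
      positivity
    · have hθ := timeBump_nonneg T τ m t
      have hbm := hb0 m
      rw [(hfam.glued_of_mem ht).1, hU]
      simp only [smul_smul]
      refine ((hP m).besovNorm_three_le hχ (mul_nonneg hθ hbm) _).trans
        (ENNReal.ofReal_le_ofReal ?_)
      gcongr
      exact mul_le_of_le_one_left hbm (timeBump_le_one _ _ _ _)
    · rw [(hfam.glued_of_notMem ht).1, besovNorm_zero]
    · rw [one_mul, ENNReal.toReal_ofNat]
      exact (hn m).2.2.2.2.2.2.2.1.trans (hhalf m)
  -- Since `2M + 5 ≥ 2M + 1`, the negative terms amount to at least `(2M + 1) (1 + ε) / 2 ≥ M + 1/2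
  -- + ε M`, and `ε M ≥ 4` leaves room to spare.
  · refine hmix p q (zero_lt_one.trans_le hp).ne' hq ?_
    have hp0 : (2 : ℝ≥0∞) / p ≠ ⊤ := ENNReal.div_ne_top (by simp) (zero_lt_one.trans_le hp).ne'
    have hq0 : (2 : ℝ≥0∞) / q ≠ ⊤ := ENNReal.div_ne_top (by simp) (zero_lt_one.trans_le hq).ne'
    have h1 := congrArg ENNReal.toReal hpq
    rw [ENNReal.toReal_add hp0 hq0, ENNReal.toReal_add ENNReal.one_ne_top ENNReal.ofReal_ne_top,
      ENNReal.toReal_div, ENNReal.toReal_div, ENNReal.toReal_ofNat, ENNReal.toReal_one,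
      ENNReal.toReal_ofReal hε.le] at h1
    have h2 : 2 * (1 / p.toReal) + 2 * (1 / q.toReal) = 1 + ε := by rw [← h1]; ring
    have h3 : 0 ≤ 1 / q.toReal := by positivity
    have h4 : (2 * M + 1 : ℝ) * (2 * (1 / p.toReal) + 2 * (1 / q.toReal)) =
        (2 * M + 1) * (1 + ε) := by rw [h2]
    nlinarith
  · have hr : 0 < 2 - ε := by linarith
    refine hfam.eLpNorm_time_lt_top (ENNReal.ofReal_pos.2 hr).ne' zero_le_one (c := fun m =>
      Real.sqrt (24 * (2 * Real.pi / N m) ^ d *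
      (d * (Cρ * (τ m)⁻¹ * b m * (20 / 2 ^ shell d M (m + n₀))) ^ 2 +
      144 * (b m * 2 ^ shell d M (m + n₀ + 1)) ^ 2 + d * (144 * b m ^ 2) ^ 2)))
      (fun m => Real.sqrt_nonneg _) (fun m t ht => ?_) (fun t ht => ?_) fun m => ?_
    · rw [(hfam.glued_of_mem ht).2]
      refine ((hP m).besovNorm_force_le hχ (c := timeBump T τ m t)
        (c' := deriv (timeBump T τ m) t) (hb0 m) ?_).trans
        (ENNReal.ofReal_le_ofReal (Real.sqrt_le_sqrt ?_))
      · rw [abs_of_nonneg (timeBump_nonneg _ _ _ _)]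
        exact timeBump_le_one _ _ _ _
      · have hbm := hb0 m
        have hθ' : |deriv (timeBump T τ m) t| ≤ Cρ * (τ m)⁻¹ := by
          rw [deriv_timeBump, abs_mul, abs_of_pos (inv_pos.2 (duration_pos _ _ _))]
          exact mul_le_mul_of_nonneg_right (hCρ _) (inv_pos.2 (duration_pos _ _ _)).le
        have hsq : (deriv (timeBump T τ m) t * b m * (20 / 2 ^ shell d M (m + n₀))) ^ 2 ≤
            (Cρ * (τ m)⁻¹ * b m * (20 / 2 ^ shell d M (m + n₀))) ^ 2 := by
          rw [← sq_abs, abs_mul, abs_mul, abs_of_nonneg hbm,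
            abs_of_nonneg (by positivity : (0 : ℝ) ≤ 20 / 2 ^ shell d M (m + n₀))]
          gcongr
        gcongr
    · rw [(hfam.glued_of_notMem ht).2, besovNorm_zero]
    · rw [one_mul, ENNReal.toReal_ofReal hr.le]
      exact ((hn m).2.2.2.1 hε2).trans (hhalf m)
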